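/- Theorem 1. Let $K\ge 1$ be the number of arms, $m$ the number of tasks, $n\ge K$ the number of rounds in each task, and let $\sigma_q,\sigma_0,\sigma>0$. Model. A mean vector $\mu_*\sim\mathcal N(\mathbf 0,\sigma_q^2 I_K)$ is drawn once and defines the instance prior $P_*=\mathcal N(\mu_*,\sigma_0^2I_K)$. In each task $s=1,\dots,m$ a problem instance $\theta_{s,*}\in\mathbb R^K$ is drawn, independently given $\mu_*$, from $P_*$. Whenever arm $i$ is pulled in task $s$, a reward is observed that is drawn independently from $\mathcal N(\theta_{s,*}(i),\sigma^2)$. Let $A_{s,t}$ be the arm pulled in round $t$ of task $s$, let $H_s$ be the history (pulled arms and their rewards) of all $n$ rounds of task $s$, and let $A_{s,*}=\arg\max_i\theta_{s,*}(i)$. Algorithm (MetaTS, with each arm pulled once at the end of each task). At the beginning of task $s$ the agent draws $\tilde\mu_s$ from the meta-posterior $Q_s$, which is the Bayesian posterior distribution of $\mu_*$ given $H_1,\dots,H_{s-1}$ (so $Q_1=\mathcal N(\mathbf 0,\sigma_q^2I_K)$). In rounds $t=1,\dots,n-K$ of task $s$ it runs Thompson sampling with prior $\mathcal N(\tilde\mu_s,\sigma_0^2I_K)$: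 it draws $\theta_{s,t}$ from the posterior obtained from this prior and the observations of the earlier rounds of task $s$, and pulls $A_{s,t}=\arg\max_i\theta_{s,t}(i)$. In the last $K$ rounds of the task it pulls the arms $1,\dots,K$ once each. Regret. The Bayes regret, a function of $\mu_*$, is $$R(m,n;P_*)=\sum_{s=1}^m\mathbb E\Big[\sum_{t=1}^n\theta_{s,*}(A_{s,*})-\theta_{s,*}(A_{s,t})\,\Big|\,P_*\Big],$$ and its version in which the meta-posterior samples are not averaged out is $$\tilde R(m,n;P_*)=\sum_{s=1}^m\mathbb E\Big[\sum_{t=1}^n\theta_{s,*}(A_{s,*})-\theta_{s,*}(A_{s,t})\,\Big|\,P_*,\tilde\mu_s\Big].$$ Claim. There are constants $C>0$ and $p\in\mathbb N$ that depend only on $\sigma_q,\sigma_0,\sigma$ such that for all $K\ge1$, all $m$, all $n\ge K$ and all $\delta>0$, with probability at least $1-(2m+1)\delta$ over the joint realization of $\mu_*$, of the instances $\theta_{s,*}$ and of the meta-posterior samples $\tilde\mu_s$ (and of the histories), both $R(m,n;P_*)$ and $\tilde R(m,n;P_*)$ are at most $$c_1\sqrt K\Big(\sqrt{n+\sigma^2\sigma_0^{-2}K}-\sqrt{\sigma^2\sigma_0^{-2}K}\Big)m+c_2(\delta)c_3(\delta)Kn^2\sqrt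 m+C\Big(1+\log\frac{Kn}{\delta}\Big)^p(Km+n),$$ where $$c_1=4\sqrt{2\sigma^2\log n},\qquad c_2(\delta)=2\Big(\sqrt{2\sigma_q^2\log(2K/\delta)}+\sqrt{2\sigma_0^2\log n}\Big),\qquad c_3(\delta)=8\sqrt{\frac{(\sigma_0^2+\sigma^2)\log(4K/\delta)}{\pi\sigma_0^2}}.$$ The last term is the $\tilde O(Km+n)$ term. -/

import Mathlib

open MeasureTheory ProbabilityTheory
open scoped ENNReal NNReal

namespace MetaTS

noncomputable section

/-- The Gaussian measure `N(μ, s² I_K)` on `ℝ^K`. -/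
def gauss {K : ℕ} (μ : Fin K → ℝ) (s : ℝ≥0) : Measure (Fin K → ℝ) :=
  Measure.pi fun i => gaussianReal (μ i) (s ^ 2)

/-- The optimal arm under the mean vector `θ` (the smallest index in case of ties). -/
def argmax {K : ℕ} [NeZero K] (θ : Fin K → ℝ) : Fin K :=
  (Finset.univ.filter fun i => ∀ j, θ j ≤ θ i).min' <| by
    obtain ⟨i, hi⟩ := Finite.exists_max θ
    exact ⟨i, by simpa using hi⟩

/-- A history of `t` rounds of one task: the pulled arms and their observed rewards. -/
abbrev Hist (K t : ℕ) : Type := Fin t → Fin K × ℝ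

/-- The likelihood of the rewards observed in the history `h` in the `K`-armed Gaussian bandit with
mean vector `θ` and reward noise `N(0, σ²)`. -/
def lik {K t : ℕ} (σ : ℝ≥0) (h : Hist K t) (θ : Fin K → ℝ) : ℝ≥0∞ :=
  ∏ j, gaussianPDF (θ (h j).1) (σ ^ 2) (h j).2

/-- Bayes' rule: the posterior, whose density with respect to `prior` is proportional to `L`. -/
def bayes {Θ : Type*} [MeasurableSpace Θ] (prior : Measure Θ) (L : Θ → ℝ≥0∞) : Measure Θ :=
  (∫⁻ θ, L θ ∂prior)⁻¹ • prior.withDensity L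

/-- Thompson sampling with prior `N(ν, σ₀² I_K)`: the law of the next arm after the in-task history
`h`. A mean vector is sampled from the posterior, and the arm that is optimal under the sample is
pulled. -/
def thompson {K : ℕ} [NeZero K] (σ₀ σ : ℝ≥0) (ν : Fin K → ℝ) {t : ℕ} (h : Hist K t) :
    Measure (Fin K) :=
  (bayes (gauss ν σ₀) (lik σ h)).map argmax

/-- The law of the arm pulled after `t` rounds of a task of `n` rounds: Thompson sampling with
prior `N(ν, σ₀² I_K)`, except that in the last `K` rounds the arms `0, …, K - 1` are pulled once
each, in this order. -/
def policy {K : ℕ} [NeZero K] (σ₀ σ : ℝ≥0) (n : ℕ) (ν : Fin K → ℝ) (t : ℕ) (h : Hist K t) :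
    Measure (Fin K) :=
  if t + K < n then thompson σ₀ σ ν h else Measure.dirac (Fin.ofNat K (t + K - n))

/-- The law of the history of the first `t` rounds of the interaction of the policy `π` with the
Gaussian bandit instance `θ`: given the history `h`, the arm is `a ∼ π t h` and its reward is
`y ∼ N(θ a, σ²)`. -/
def interact {K : ℕ} (σ : ℝ≥0) (π : (t : ℕ) → Hist K t → Measure (Fin K)) (θ : Fin K → ℝ) :
    (t : ℕ) → Measure (Hist K t)
  | 0 => Measure.dirac Fin.elim0
  | t + 1 => (interact σ π θ t).bind fun h => (π t h).bind fun a =>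
      (gaussianReal (θ a) (σ ^ 2)).map fun y => (Fin.snoc h (a, y) : Hist K (t + 1))

/-- The meta-posterior over the mean `μ_*` of the instance prior, given the histories `H` of the
previous tasks. -/
def metaPosterior {K n s : ℕ} (σq σ₀ σ : ℝ≥0) (H : Fin s → Hist K n) : Measure (Fin K → ℝ) :=
  bayes (gauss 0 σq) fun μ => ∏ l, ∫⁻ θ, lik σ (H l) θ ∂(gauss μ σ₀)

/-- What happens in one task. -/
structure TaskRecord (K n : ℕ) : Type where
  /-- the problem instance `θ_{s,*}` -/
  inst : Fin K → ℝ
  /-- the meta-posterior sample, which is the mean of the prior used by Thompson sampling -/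
  sample : Fin K → ℝ
  /-- the history of the task -/
  hist : Hist K n

instance (K n : ℕ) : MeasurableSpace (TaskRecord K n) :=
  MeasurableSpace.comap (fun r => (r.inst, r.sample, r.hist)) inferInstance

/-- The conditional law of the first `s` tasks given `μ_* = μ`. In each task, `ν` is sampled from
the meta-posterior, the instance is `θ ∼ N(μ, σ₀² I_K)`, and (modified) Thompson sampling with prior
`N(ν, σ₀² I_K)` interacts with `θ` for `n` rounds. -/
def tasksLaw {K : ℕ} [NeZero K] (σq σ₀ σ : ℝ≥0) (n : ℕ) (μ : Fin K → ℝ) :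
    (s : ℕ) → Measure (Fin s → TaskRecord K n)
  | 0 => Measure.dirac Fin.elim0
  | s + 1 => (tasksLaw σq σ₀ σ n μ s).bind fun ω =>
      (metaPosterior σq σ₀ σ fun l => (ω l).hist).bind fun ν =>
        (gauss μ σ₀).bind fun θ =>
          (interact σ (policy σ₀ σ n ν) θ n).map fun h =>
            (Fin.snoc ω ⟨θ, ν, h⟩ : Fin (s + 1) → TaskRecord K n)

/-- The joint law of `μ_* ∼ N(0, σq² I_K)` and of the `m` tasks. -/
def jointLaw (σq σ₀ σ : ℝ≥0) (K m n : ℕ) [NeZero K] :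
    Measure ((Fin K → ℝ) × (Fin m → TaskRecord K n)) :=
  (gauss 0 σq).bind fun μ => (tasksLaw σq σ₀ σ n μ m).map fun ω => (μ, ω)

/-- The `n`-round regret `∑ₜ θ(A_*) - θ(A_t)` in the instance `θ`, which is nonnegative. -/
def regret {K n : ℕ} [NeZero K] (θ : Fin K → ℝ) (h : Hist K n) : ℝ :=
  ∑ t, (θ (argmax θ) - θ (h t).1)

/-- The Bayes regret `R(m, n; P_*)` for `P_* = N(μ, σ₀² I_K)`: the sum over the tasks of the expected
regret given `μ_* = μ`. The expectations, of nonnegative variables, take values in `[0, ∞]`. -/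
def bayesRegret {K : ℕ} [NeZero K] (σq σ₀ σ : ℝ≥0) (m n : ℕ) (μ : Fin K → ℝ) : ℝ≥0∞ :=
  ∑ s : Fin m, ∫⁻ ω, ENNReal.ofReal (regret (ω s).inst (ω s).hist) ∂(tasksLaw σq σ₀ σ n μ m)

/-- The expected regret in one task given `μ_* = μ` and given that the meta-posterior sample of the
task is `ν`. -/
def taskBayesRegret {K : ℕ} [NeZero K] (σ₀ σ : ℝ≥0) (n : ℕ) (μ ν : Fin K → ℝ) : ℝ≥0∞ :=
  ∫⁻ θ, ∫⁻ h, ENNReal.ofReal (regret θ h) ∂(interact σ (policy σ₀ σ n ν) θ n) ∂(gauss μ σ₀)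

/-- `c₁ = 4 √(2 σ² log n)` -/
def c₁ (σ : ℝ≥0) (n : ℕ) : ℝ := 4 * √(2 * (σ : ℝ) ^ 2 * Real.log n)

/-- `c₂(δ) = 2 (√(2 σq² log(2 K / δ)) + √(2 σ₀² log n))` -/
def c₂ (σq σ₀ : ℝ≥0) (K n : ℕ) (δ : ℝ) : ℝ :=
  2 * (√(2 * (σq : ℝ) ^ 2 * Real.log (2 * K / δ)) + √(2 * (σ₀ : ℝ) ^ 2 * Real.log n))

/-- `c₃(δ) = 8 √((σ₀² + σ²) log(4 K / δ) / (π σ₀²))` -/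
def c₃ (σ₀ σ : ℝ≥0) (K : ℕ) (δ : ℝ) : ℝ :=
  8 * √(((σ₀ : ℝ) ^ 2 + (σ : ℝ) ^ 2) * Real.log (4 * K / δ) / (Real.pi * (σ₀ : ℝ) ^ 2))

end

end MetaTS

open MetaTS

/-!
The Bayes regret of MetaTS splits, task by task, into the regret that Thompson sampling would have
with the correct prior `N(μ, σ₀² I)`, and the price of using the meta-posterior sample `ν` in place
of `μ`.

*Correct prior* (`taskBayesRegret_self_le`). The density of the law of a history factorizes into
the probabilities of the policy and the likelihood (`lintegral_interact`). Hence Bayes' rule gives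
the conditional law of the instance given the history (`lintegral_interact_eq_bayes`), and under
this law the arm pulled by Thompson sampling is an independent copy of the optimal arm. So the
regret of a round is about `√(2 log n)` posterior standard deviations of the pulled arm
(`lintegral_gap_le`). Their sum is bounded on every path, by a telescoping sum for each arm and the
Cauchy-Schwarz inequality over the arms (`sdSum_le`). Each of the last `K` rounds costs at most the
width of the instance, which is the gap between its best and its worst arm.

*Misspecified prior* (`taskBayesRegret_le_add`). If the prior mean is shifted, then so is the
posterior mean, by a distance that is no larger relative to the covariance. By a bound on the total
variation distance of shifted Gaussians (`lintegral_gaussian_shift_le`) the law of the arm in each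
round changes by at most `√K ‖μ - ν‖ / σ₀`, the law of the history by `n` times as much, and the
regret is at most `n` times the width. The expected width is at most `c₂(δ)` unless `μ` is
unusually large (`lintegral_width_le`, `gauss_norm_tail_le`).

*Learning the prior* (`lintegral_sampleError_le`). The likelihood of `μ` given the histories of the
earlier tasks is the density of their law up to a factor that does not depend on `μ`
(`exists_lintegral_hists`). So, given these histories, `μ` and `ν` are independent with the same
law, the meta-posterior, which is Gaussian; since every arm is pulled in every task, its variances
are at most `(σ₀² + σ²) / s` after `s` tasks (`exists_metaPosterior_eq`). Therefore the exponential
of `s ‖μ - ν‖² / (8 (σ₀² + σ²))` has expectation at most `2 K`. Markov's inequality bounds it for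
the realized `ν`, and also its average over `ν` given `μ`, which is what the averaged regret needs,
by Jensen's inequality (`lintegral_norm_le_errorBound`). With the event that `μ` is large, these
are `2 m + 1` events of probability at most `δ`. Outside of them, `‖μ - ν‖` is of the order of
`1 / √s` from the second task on, which sums to `2 √m`; the first task has regret at most
`n c₂(δ)`.
-/

/-! ### Products of measures -/

theorem lintegral_pi_prod {ι : Type*} [Fintype ι] {X : ι → Type*} [∀ i, MeasurableSpace (X i)]
    (μ : ∀ i, Measure (X i)) [∀ i, IsProbabilityMeasure (μ i)] {f : ∀ i, X i → ℝ≥0∞}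
    (hf : ∀ i, Measurable (f i)) :
    ∫⁻ x, ∏ i, f i (x i) ∂(Measure.pi μ) = ∏ i, ∫⁻ x, f i x ∂(μ i) := by
  have hind : iIndepFun (fun i (x : ∀ i, X i) => f i (x i)) (Measure.pi μ) :=
    iIndepFun_pi (fun i => (hf i).aemeasurable)
  rw [lintegral_prod_eq_prod_lintegral_of_indepFun Finset.univ _ hind
    (fun i => (hf i).comp (measurable_pi_apply i))]
  refine Finset.prod_congr rfl fun i _ => ?_
  exact (measurePreserving_eval μ i).lintegral_comp (hf i)

/-- If each `μ i`, weighted by `f i`, is a multiple of a probability measure `ν i`, then the product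
of the `μ i`, weighted by the product density, is a multiple of the product of the `ν i`. -/
theorem pi_withDensity_prod {ι : Type*} [Fintype ι] {X : ι → Type*} [∀ i, MeasurableSpace (X i)]
    (μ ν : ∀ i, Measure (X i)) [∀ i, IsProbabilityMeasure (μ i)] [∀ i, IsProbabilityMeasure (ν i)]
    {f : ∀ i, X i → ℝ≥0∞} (hf : ∀ i, Measurable (f i)) {c : ι → ℝ≥0∞}
    (hc0 : ∀ i, c i ≠ 0) (hc : ∀ i, c i ≠ ∞) (h : ∀ i, (μ i).withDensity (f i) = c i • ν i) :
    (Measure.pi μ).withDensity (fun x => ∏ i, f i (x i)) = (∏ i, c i) • Measure.pi ν := by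
  have hp0 : ∏ i, c i ≠ 0 := Finset.prod_ne_zero_iff.2 fun i _ => hc0 i
  have hp : ∏ i, c i ≠ ∞ := ENNReal.prod_ne_top fun i _ => hc i
  have key : Measure.pi ν
      = (∏ i, c i)⁻¹ • (Measure.pi μ).withDensity (fun x => ∏ i, f i (x i)) := by
    refine Measure.pi_eq fun s hs => ?_
    rw [Measure.smul_apply, withDensity_apply _ (MeasurableSet.univ_pi hs),
      ← lintegral_indicator (MeasurableSet.univ_pi hs)]
    have : ∀ x : ∀ i, X i, (Set.univ.pi s).indicator (fun x => ∏ i, f i (x i)) x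
        = ∏ i, (s i).indicator (f i) (x i) := by
      intro x
      by_cases hx : x ∈ Set.univ.pi s
      · rw [Set.indicator_of_mem hx]
        refine Finset.prod_congr rfl fun i _ => ?_
        rw [Set.indicator_of_mem (hx i (Set.mem_univ i))]
      · rw [Set.indicator_of_notMem hx]
        simp only [Set.mem_pi, Set.mem_univ, true_imp_iff, not_forall] at hx
        obtain ⟨i, hi⟩ := hx
        exact (Finset.prod_eq_zero (Finset.mem_univ i) (Set.indicator_of_notMem hi _)).symm
    simp_rw [this]
    rw [lintegral_pi_prod μ fun i => (hf i).indicator (hs i)]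
    have : ∀ i, ∫⁻ x, (s i).indicator (f i) x ∂(μ i) = c i * ν i (s i) := by
      intro i
      rw [lintegral_indicator (hs i), ← withDensity_apply _ (hs i), h i, Measure.smul_apply,
        smul_eq_mul]
    simp_rw [this, Finset.prod_mul_distrib, smul_eq_mul, ← mul_assoc]
    rw [ENNReal.inv_mul_cancel hp0 hp, one_mul]
  rw [key, smul_smul, ENNReal.mul_inv_cancel hp0 hp, one_smul]

/-! ### Gaussian conjugacy -/

/-- The variance of the posterior when the prior has variance `w` and the observations have total
precision `a`. -/
noncomputable def postVar (w a : ℝ≥0) : ℝ≥0 := (w⁻¹ + a)⁻¹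

/-- The mean of the posterior for the prior `N(m, w)` and the likelihood
`exp (b x - a x² / 2)`. -/
noncomputable def postMean (w a : ℝ≥0) (m b : ℝ) : ℝ := (postVar w a : ℝ) * (m / w + b)

/-- The integral of the likelihood `exp (b x - a x² / 2)` with respect to `N(m, w)`. -/
noncomputable def evidence (w a : ℝ≥0) (m b : ℝ) : ℝ :=
  √((postVar w a : ℝ) / w) * Real.exp (postMean w a m b ^ 2 / (2 * postVar w a) - m ^ 2 / (2 * w))

theorem postVar_pos {w : ℝ≥0} (hw : 0 < w) (a : ℝ≥0) : 0 < postVar w a := by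
  unfold postVar; positivity

theorem evidence_pos {w : ℝ≥0} (hw : 0 < w) (a : ℝ≥0) (m b : ℝ) : 0 < evidence w a m b := by
  have h1 : (0 : ℝ) < w := hw
  have h2 : (0 : ℝ) < postVar w a := postVar_pos hw a
  unfold evidence; positivity

theorem gaussianPDFReal_mul_exp {w : ℝ≥0} (hw : 0 < w) (a : ℝ≥0) (m b x : ℝ) :
    gaussianPDFReal m w x * Real.exp (b * x - a * x ^ 2 / 2)
      = evidence w a m b * gaussianPDFReal (postMean w a m b) (postVar w a) x := by
  have h1 : (0 : ℝ) < w := hw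
  have h2 : (0 : ℝ) < postVar w a := postVar_pos hw a
  have hv : (w : ℝ)⁻¹ + a = (postVar w a : ℝ)⁻¹ := by simp [postVar]
  have ha : (a : ℝ) = (postVar w a : ℝ)⁻¹ - (w : ℝ)⁻¹ := by rw [← hv]; ring
  have hb : b = postMean w a m b / postVar w a - m / w := by
    unfold postMean; field_simp; ring
  set v : ℝ := (postVar w a : ℝ) with hvdef
  set M := postMean w a m b with hM
  unfold gaussianPDFReal evidence
  rw [← hM, ← hvdef]
  have hs : (√(2 * Real.pi * w))⁻¹ = √(v / w) * (√(2 * Real.pi * v))⁻¹ := by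
    rw [Real.sqrt_div h2.le, Real.sqrt_mul (x := 2 * Real.pi) (by positivity) w,
      Real.sqrt_mul (x := 2 * Real.pi) (by positivity) v]
    have := Real.sqrt_pos.2 h2
    have := Real.sqrt_pos.2 h1
    field_simp
  rw [hs, mul_assoc, ← Real.exp_add, mul_mul_mul_comm, ← Real.exp_add]
  congr 2
  rw [hb, ha]
  field_simp
  ring

theorem gaussianReal_withDensity_exp {w : ℝ≥0} (hw : 0 < w) (a : ℝ≥0) (m b : ℝ) :
    (gaussianReal m w).withDensity (fun x => ENNReal.ofReal (Real.exp (b * x - a * x ^ 2 / 2)))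
      = ENNReal.ofReal (evidence w a m b) • gaussianReal (postMean w a m b) (postVar w a) := by
  rw [gaussianReal_of_var_ne_zero _ hw.ne', gaussianReal_of_var_ne_zero _ (postVar_pos hw a).ne',
    ← withDensity_mul _ (measurable_gaussianPDF _ _) (by fun_prop),
    ← withDensity_smul _ (measurable_gaussianPDF _ _)]
  congr 1
  funext x
  simp only [Pi.mul_apply, Pi.smul_apply, smul_eq_mul, gaussianPDF]
  rw [← ENNReal.ofReal_mul (gaussianPDFReal_nonneg _ _ _), gaussianPDFReal_mul_exp hw,
    ENNReal.ofReal_mul (evidence_pos hw a m b).le]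

/-- The evidence is again of the form `exp (b' m - a' m² / 2)`, up to a constant factor. -/
theorem evidence_eq {w : ℝ≥0} (hw : 0 < w) (a : ℝ≥0) (m b : ℝ) :
    evidence w a m b = (√(postVar w a / w) * Real.exp (postVar w a * b ^ 2 / 2)) *
      Real.exp ((postVar w a / w * b) * m - (a * postVar w a / w : ℝ≥0) * m ^ 2 / 2) := by
  have h1 : (0 : ℝ) < w := hw
  have h2 : (0 : ℝ) < postVar w a := postVar_pos hw a
  have hv : (w : ℝ)⁻¹ + a = (postVar w a : ℝ)⁻¹ := by simp [postVar]
  have ha : (a : ℝ) = (postVar w a : ℝ)⁻¹ - (w : ℝ)⁻¹ := by rw [← hv]; ring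
  unfold evidence postMean
  push_cast
  rw [mul_assoc, ← Real.exp_add]
  congr 2
  rw [ha]
  field_simp
  ring

/-- The likelihood of a mean vector when arm `i` has been observed with total precision `a i` and
precision-weighted sum of rewards `b i`, up to a factor that does not depend on the vector. -/
noncomputable def quadLik {K : ℕ} (a : Fin K → ℝ≥0) (b θ : Fin K → ℝ) : ℝ≥0∞ :=
  ∏ i, ENNReal.ofReal (Real.exp (b i * θ i - a i * θ i ^ 2 / 2))

theorem measurable_quadLik {K : ℕ} (a : Fin K → ℝ≥0) (b : Fin K → ℝ) :
    Measurable (quadLik a b) := by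
  unfold quadLik; fun_prop

instance {K : ℕ} (μ : Fin K → ℝ) (s : ℝ≥0) : IsProbabilityMeasure (gauss μ s) := by
  unfold gauss; infer_instance

theorem gauss_withDensity_quadLik {K : ℕ} {s : ℝ≥0} (hs : 0 < s) (μ : Fin K → ℝ)
    (a : Fin K → ℝ≥0) (b : Fin K → ℝ) :
    (gauss μ s).withDensity (quadLik a b)
      = (∏ i, ENNReal.ofReal (evidence (s ^ 2) (a i) (μ i) (b i))) •
        Measure.pi fun i => gaussianReal (postMean (s ^ 2) (a i) (μ i) (b i))
          (postVar (s ^ 2) (a i)) := by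
  have hw : 0 < s ^ 2 := by positivity
  have hpos : ∀ i, ENNReal.ofReal (evidence (s ^ 2) (a i) (μ i) (b i)) ≠ 0 := fun i => by
    simpa using evidence_pos hw _ _ _
  exact pi_withDensity_prod (fun i => gaussianReal (μ i) (s ^ 2)) _
    (f := fun i x => ENNReal.ofReal (Real.exp (b i * x - a i * x ^ 2 / 2)))
    (fun i => by fun_prop) hpos (fun i => ENNReal.ofReal_ne_top)
    fun i => gaussianReal_withDensity_exp hw (a i) (μ i) (b i)

theorem lintegral_quadLik {K : ℕ} {s : ℝ≥0} (hs : 0 < s) (μ : Fin K → ℝ)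
    (a : Fin K → ℝ≥0) (b : Fin K → ℝ) :
    ∫⁻ θ, quadLik a b θ ∂(gauss μ s)
      = ∏ i, ENNReal.ofReal (evidence (s ^ 2) (a i) (μ i) (b i)) := by
  rw [← setLIntegral_univ, ← withDensity_apply _ MeasurableSet.univ,
    gauss_withDensity_quadLik hs]
  simp

theorem bayes_quadLik {K : ℕ} {s : ℝ≥0} (hs : 0 < s) (μ : Fin K → ℝ) {c : ℝ≥0∞} (hc0 : c ≠ 0)
    (hc : c ≠ ∞) (a : Fin K → ℝ≥0) (b : Fin K → ℝ) {L : (Fin K → ℝ) → ℝ≥0∞}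
    (hL : ∀ θ, L θ = c * quadLik a b θ) :
    bayes (gauss μ s) L
      = Measure.pi fun i => gaussianReal (postMean (s ^ 2) (a i) (μ i) (b i))
          (postVar (s ^ 2) (a i)) := by
  have hw : 0 < s ^ 2 := by positivity
  have h : L = c • quadLik a b := funext hL
  have hp0 : ∏ i, ENNReal.ofReal (evidence (s ^ 2) (a i) (μ i) (b i)) ≠ 0 :=
    Finset.prod_ne_zero_iff.2 fun i _ => by simpa using evidence_pos hw _ _ _
  have hp : ∏ i, ENNReal.ofReal (evidence (s ^ 2) (a i) (μ i) (b i)) ≠ ∞ :=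
    ENNReal.prod_ne_top fun i _ => by simp
  rw [bayes, h, withDensity_smul _ (measurable_quadLik a b), gauss_withDensity_quadLik hs]
  simp only [Pi.smul_apply, smul_eq_mul]
  rw [lintegral_const_mul _ (measurable_quadLik a b), lintegral_quadLik hs, smul_smul, smul_smul,
    ← smul_eq_mul, ← smul_eq_mul]
  rw [smul_eq_mul, smul_eq_mul, mul_assoc, ENNReal.inv_mul_cancel (mul_ne_zero hc0 hp0)
    (ENNReal.mul_ne_top hc hp), one_smul]

/-! ### Likelihoods and posteriors -/

theorem gaussianPDF_eq_mul_exp (θ : ℝ) (v : ℝ≥0) (y : ℝ) :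
    gaussianPDF θ v y
      = gaussianPDF 0 v y * ENNReal.ofReal (Real.exp (y / v * θ - 1 / v * θ ^ 2 / 2)) := by
  rw [gaussianPDF, gaussianPDF, ← ENNReal.ofReal_mul (gaussianPDFReal_nonneg _ _ _)]
  unfold gaussianPDFReal
  rw [mul_assoc (√(2 * Real.pi * v))⁻¹, ← Real.exp_add]
  congr 3
  by_cases hv : (v : ℝ) = 0
  · simp [hv]
  · field_simp
    ring

/-- The total precision of the rewards of arm `i` in the history `h`. -/
noncomputable def obsPrec {K t : ℕ} (σ : ℝ≥0) (h : Hist K t) (i : Fin K) : ℝ≥0 :=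
  ∑ j, if (h j).1 = i then 1 / σ ^ 2 else 0

/-- The precision-weighted sum of the rewards of arm `i` in the history `h`. -/
noncomputable def obsSum {K t : ℕ} (σ : ℝ≥0) (h : Hist K t) (i : Fin K) : ℝ :=
  ∑ j, if (h j).1 = i then (h j).2 / (σ : ℝ) ^ 2 else 0

/-- The factor of the likelihood that does not depend on the mean vector. -/
noncomputable def baseLik {K t : ℕ} (σ : ℝ≥0) (h : Hist K t) : ℝ≥0∞ :=
  ∏ j, gaussianPDF 0 (σ ^ 2) (h j).2

theorem baseLik_ne_zero {K t : ℕ} {σ : ℝ≥0} (hσ : 0 < σ) (h : Hist K t) : baseLik σ h ≠ 0 :=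
  Finset.prod_ne_zero_iff.2 fun _ _ => (gaussianPDF_pos _ (by positivity) _).ne'

theorem baseLik_ne_top {K t : ℕ} (σ : ℝ≥0) (h : Hist K t) : baseLik σ h ≠ ∞ :=
  ENNReal.prod_ne_top fun _ _ => gaussianPDF_ne_top

theorem quadLik_eq_exp_sum {K : ℕ} (a : Fin K → ℝ≥0) (b θ : Fin K → ℝ) :
    quadLik a b θ = ENNReal.ofReal (Real.exp (∑ i, (b i * θ i - a i * θ i ^ 2 / 2))) := by
  rw [quadLik, Real.exp_sum, ENNReal.ofReal_prod_of_nonneg fun _ _ => (Real.exp_pos _).le]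

theorem lik_eq {K t : ℕ} (σ : ℝ≥0) (h : Hist K t) (θ : Fin K → ℝ) :
    lik σ h θ = baseLik σ h * quadLik (obsPrec σ h) (obsSum σ h) θ := by
  unfold lik
  simp_rw [fun j => gaussianPDF_eq_mul_exp (θ (h j).1) (σ ^ 2) (h j).2]
  rw [Finset.prod_mul_distrib, ← baseLik, quadLik_eq_exp_sum,
    ← ENNReal.ofReal_prod_of_nonneg fun _ _ => (Real.exp_pos _).le, ← Real.exp_sum]
  congr 3
  simp only [obsSum, obsPrec, NNReal.coe_sum, Finset.sum_mul, Finset.sum_div,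
    ← Finset.sum_sub_distrib]
  rw [Finset.sum_comm]
  refine Finset.sum_congr rfl fun j _ => ?_
  rw [Finset.sum_eq_single (h j).1 (fun i _ hi => by simp [hi.symm]) (by simp)]
  simp

/-- The mean of the posterior of arm `i` after the history `h` for the prior `N(μ, s² I)`. -/
noncomputable def tsMean {K t : ℕ} (s σ : ℝ≥0) (μ : Fin K → ℝ) (h : Hist K t) (i : Fin K) : ℝ :=
  postMean (s ^ 2) (obsPrec σ h i) (μ i) (obsSum σ h i)

/-- The variance of the posterior of arm `i` after the history `h` for a prior `N(μ, s² I)`. -/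
noncomputable def tsVar {K t : ℕ} (s σ : ℝ≥0) (h : Hist K t) (i : Fin K) : ℝ≥0 :=
  postVar (s ^ 2) (obsPrec σ h i)

theorem bayes_lik {K t : ℕ} {s σ : ℝ≥0} (hs : 0 < s) (hσ : 0 < σ) (μ : Fin K → ℝ) (h : Hist K t) :
    bayes (gauss μ s) (lik σ h)
      = Measure.pi fun i => gaussianReal (tsMean s σ μ h i) (tsVar s σ h i) :=
  bayes_quadLik hs μ (baseLik_ne_zero hσ h) (baseLik_ne_top σ h) _ _ (lik_eq σ h)

theorem prod_quadLik {ι : Type*} [Fintype ι] {K : ℕ} (a : ι → Fin K → ℝ≥0) (b : ι → Fin K → ℝ)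
    (θ : Fin K → ℝ) :
    ∏ l, quadLik (a l) (b l) θ = quadLik (fun i => ∑ l, a l i) (fun i => ∑ l, b l i) θ := by
  simp_rw [quadLik_eq_exp_sum]
  rw [← ENNReal.ofReal_prod_of_nonneg fun _ _ => (Real.exp_pos _).le, ← Real.exp_sum,
    Finset.sum_comm]
  simp [Finset.sum_sub_distrib, Finset.sum_mul, Finset.sum_div]

/-- The likelihood of the mean `μ` of the instance prior, given the history `h` of one task. -/
noncomputable def margLik {K t : ℕ} (σ₀ σ : ℝ≥0) (h : Hist K t) (μ : Fin K → ℝ) : ℝ≥0∞ :=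
  ∫⁻ θ, lik σ h θ ∂(gauss μ σ₀)

/-- The precision about the mean of arm `i` of the instance prior from the history `h` of a task. -/
noncomputable def margPrec {K t : ℕ} (σ₀ σ : ℝ≥0) (h : Hist K t) (i : Fin K) : ℝ≥0 :=
  obsPrec σ h i * tsVar σ₀ σ h i / σ₀ ^ 2

theorem exists_margLik_eq {K t : ℕ} {σ₀ σ : ℝ≥0} (hσ₀ : 0 < σ₀) (hσ : 0 < σ) (h : Hist K t) :
    ∃ c : ℝ≥0∞, c ≠ 0 ∧ c ≠ ∞ ∧ ∃ b : Fin K → ℝ, ∀ μ : Fin K → ℝ,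
      margLik σ₀ σ h μ = c * quadLik (margPrec σ₀ σ h) b μ := by
  have hw : 0 < σ₀ ^ 2 := by positivity
  have hwr : (0 : ℝ) < (σ₀ ^ 2 : ℝ≥0) := hw
  have hv : ∀ i, (0 : ℝ) < postVar (σ₀ ^ 2) (obsPrec σ h i) := fun i => postVar_pos hw _
  refine ⟨baseLik σ h * ∏ i, ENNReal.ofReal
    (√((postVar (σ₀ ^ 2) (obsPrec σ h i) : ℝ) / (σ₀ ^ 2 : ℝ≥0)) *
      Real.exp (postVar (σ₀ ^ 2) (obsPrec σ h i) * obsSum σ h i ^ 2 / 2)), ?_, ?_,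
    fun i => (postVar (σ₀ ^ 2) (obsPrec σ h i) : ℝ) / (σ₀ ^ 2 : ℝ≥0) * obsSum σ h i, fun μ => ?_⟩
  · refine mul_ne_zero (baseLik_ne_zero hσ h) (Finset.prod_ne_zero_iff.2 fun i _ => ?_)
    have := hv i
    rw [Ne, ENNReal.ofReal_eq_zero, not_le]
    positivity
  · exact ENNReal.mul_ne_top (baseLik_ne_top σ h) (ENNReal.prod_ne_top fun _ _ =>
      ENNReal.ofReal_ne_top)
  · unfold margLik
    simp_rw [lik_eq]
    rw [lintegral_const_mul _ (measurable_quadLik _ _), lintegral_quadLik hσ₀, mul_assoc, quadLik,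
      ← Finset.prod_mul_distrib]
    congr 1
    refine Finset.prod_congr rfl fun i _ => ?_
    rw [evidence_eq hw, ENNReal.ofReal_mul (by positivity)]
    rfl

theorem exists_prod_margLik_eq {K n s : ℕ} {σ₀ σ : ℝ≥0} (hσ₀ : 0 < σ₀) (hσ : 0 < σ)
    (H : Fin s → Hist K n) :
    ∃ c : ℝ≥0∞, c ≠ 0 ∧ c ≠ ∞ ∧ ∃ b : Fin K → ℝ, ∀ μ : Fin K → ℝ,
      ∏ l, margLik σ₀ σ (H l) μ = c * quadLik (fun i => ∑ l, margPrec σ₀ σ (H l) i) b μ := by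
  choose c hc0 hc b hb using fun l => exists_margLik_eq hσ₀ hσ (H l)
  refine ⟨∏ l, c l, Finset.prod_ne_zero_iff.2 fun l _ => hc0 l,
    ENNReal.prod_ne_top fun l _ => hc l, fun i => ∑ l, b l i, fun μ => ?_⟩
  simp_rw [hb]
  rw [Finset.prod_mul_distrib, prod_quadLik]

/-- One observation of an arm gives the precision `1 / (σ₀² + σ²)` about the mean of its prior. -/
theorem le_margPrec {K t : ℕ} {σ₀ σ : ℝ≥0} (hσ₀ : 0 < σ₀) (hσ : 0 < σ) {h : Hist K t} {i : Fin K}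
    (hi : ∃ j, (h j).1 = i) : 1 / (σ₀ ^ 2 + σ ^ 2) ≤ margPrec σ₀ σ h i := by
  obtain ⟨j, hj⟩ := hi
  have ha : 1 / σ ^ 2 ≤ obsPrec σ h i := by
    unfold obsPrec
    have := Finset.single_le_sum (f := fun j => if (h j).1 = i then 1 / σ ^ 2 else 0)
      (fun _ _ => zero_le) (Finset.mem_univ j)
    simpa [hj] using this
  have ha' : (1 / σ ^ 2 : ℝ) ≤ obsPrec σ h i := by exact_mod_cast ha
  rw [← NNReal.coe_le_coe]
  unfold margPrec tsVar postVar
  push_cast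
  have h0 : (0 : ℝ) < σ₀ := hσ₀
  have h1 : (0 : ℝ) < σ := hσ
  set a : ℝ := (obsPrec σ h i : ℝ)
  have hapos : 0 < a := lt_of_lt_of_le (by positivity) ha'
  rw [div_le_iff₀ (by positivity)] at ha'
  rw [show a * (((σ₀ : ℝ) ^ 2)⁻¹ + a)⁻¹ / (σ₀ : ℝ) ^ 2 = a / (1 + a * (σ₀ : ℝ) ^ 2) by field_simp,
    div_le_div_iff₀ (by positivity) (by positivity)]
  nlinarith

/-- The meta-posterior is a product of Gaussians, whose variances are `O(1/s)` once every arm has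
been observed in each of the `s` tasks. -/
theorem exists_metaPosterior_eq {K n s : ℕ} {σq σ₀ σ : ℝ≥0} (hσq : 0 < σq) (hσ₀ : 0 < σ₀)
    (hσ : 0 < σ) (H : Fin s → Hist K n) :
    ∃ m : Fin K → ℝ, ∃ v : Fin K → ℝ≥0,
      metaPosterior σq σ₀ σ H = Measure.pi (fun i => gaussianReal (m i) (v i)) ∧ (∀ i, 0 < v i) ∧
      ((∀ l i, ∃ j, (H l j).1 = i) → ∀ i, (v i : ℝ) * s ≤ (σ₀ : ℝ) ^ 2 + (σ : ℝ) ^ 2) := by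
  obtain ⟨c, hc0, hc, b, hb⟩ := exists_prod_margLik_eq hσ₀ hσ H
  refine ⟨_, _, bayes_quadLik hσq 0 hc0 hc _ b hb, fun i => postVar_pos (by positivity) _,
    fun hH i => ?_⟩
  have hsum : s * (1 / (σ₀ ^ 2 + σ ^ 2)) ≤ ∑ l, margPrec σ₀ σ (H l) i := by
    calc s * (1 / (σ₀ ^ 2 + σ ^ 2)) = ∑ _l : Fin s, 1 / (σ₀ ^ 2 + σ ^ 2) := by simp
      _ ≤ _ := Finset.sum_le_sum fun l _ => le_margPrec hσ₀ hσ (hH l i)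
  set A := ∑ l, margPrec σ₀ σ (H l) i
  have hsum' : (s : ℝ) * (1 / ((σ₀ : ℝ) ^ 2 + (σ : ℝ) ^ 2)) ≤ A := by exact_mod_cast hsum
  have h0 : (0 : ℝ) < σ₀ := hσ₀
  have h1 : (0 : ℝ) < σq := hσq
  unfold postVar
  push_cast
  have hA : (0 : ℝ) ≤ A := A.2
  rw [mul_one_div, div_le_iff₀ (by positivity)] at hsum'
  rw [inv_mul_le_iff₀ (by positivity)]
  have : 0 ≤ ((σq : ℝ) ^ 2)⁻¹ * ((σ₀ : ℝ) ^ 2 + (σ : ℝ) ^ 2) := by positivity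
  nlinarith

/-! ### Measurability -/

section Kernels

variable {X Y : Type*} [MeasurableSpace X] [MeasurableSpace Y]

theorem measurable_lintegral_family {κ : X → Measure Y} (hκ : Measurable κ)
    (hp : ∀ x, IsProbabilityMeasure (κ x)) {f : X → Y → ℝ≥0∞}
    (hf : Measurable (Function.uncurry f)) : Measurable fun x => ∫⁻ y, f x y ∂(κ x) := by
  let k : Kernel X Y := ⟨κ, hκ⟩
  have : IsMarkovKernel k := ⟨hp⟩
  exact Measurable.lintegral_kernel_prod_right (κ := k) hf

theorem measurable_of_measurable_lintegral {κ : X → Measure Y}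
    (h : ∀ f : Y → ℝ≥0∞, Measurable f → Measurable fun x => ∫⁻ y, f y ∂(κ x)) :
    Measurable κ := by
  refine Measure.measurable_of_measurable_coe _ fun s hs => ?_
  simpa [lintegral_indicator hs] using h (s.indicator 1) (measurable_one.indicator hs)

theorem measurable_bind_family {Z : Type*} [MeasurableSpace Z] {κ : X → Measure Y}
    (hκ : Measurable κ) (hp : ∀ x, IsProbabilityMeasure (κ x)) {η : X → Y → Measure Z}
    (hη : Measurable (Function.uncurry η)) : Measurable fun x => (κ x).bind (η x) := by
  refine measurable_of_measurable_lintegral fun f hf => ?_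
  have : ∀ x, ∫⁻ z, f z ∂((κ x).bind (η x)) = ∫⁻ y, ∫⁻ z, f z ∂(η x y) ∂(κ x) := fun x =>
    Measure.lintegral_bind (hη.comp measurable_prodMk_left).aemeasurable hf.aemeasurable
  simp_rw [this]
  exact measurable_lintegral_family hκ hp ((Measure.measurable_lintegral hf).comp hη)

theorem measurable_map_family {Z : Type*} [MeasurableSpace Z] {κ : X → Measure Y}
    (hκ : Measurable κ) (hp : ∀ x, IsProbabilityMeasure (κ x)) {g : X → Y → Z}
    (hg : Measurable (Function.uncurry g)) : Measurable fun x => (κ x).map (g x) := by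
  refine measurable_of_measurable_lintegral fun f hf => ?_
  have : ∀ x, ∫⁻ z, f z ∂((κ x).map (g x)) = ∫⁻ y, f (g x y) ∂(κ x) := fun x =>
    lintegral_map hf (hg.comp measurable_prodMk_left)
  simp_rw [this]
  exact measurable_lintegral_family hκ hp (hf.comp hg)

theorem isProbabilityMeasure_bind {μ : Measure X} [IsProbabilityMeasure μ] {κ : X → Measure Y}
    (hκ : Measurable κ) (hp : ∀ x, IsProbabilityMeasure (κ x)) :
    IsProbabilityMeasure (μ.bind κ) := by
  refine ⟨?_⟩
  rw [Measure.bind_apply MeasurableSet.univ hκ.aemeasurable]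
  simp

theorem measurable_bayes {prior : X → Measure Y} (hprior : Measurable prior)
    (hp : ∀ x, IsProbabilityMeasure (prior x)) {L : X → Y → ℝ≥0∞}
    (hL : Measurable (Function.uncurry L)) : Measurable fun x => bayes (prior x) (L x) := by
  refine Measure.measurable_of_measurable_coe _ fun s hs => ?_
  simp only [bayes, Measure.smul_apply, smul_eq_mul, withDensity_apply _ hs]
  simp_rw [← lintegral_indicator hs]
  refine (measurable_lintegral_family hprior hp hL).inv.mul
    (measurable_lintegral_family hprior hp ?_)
  have : Function.uncurry (fun x => s.indicator (L x))
      = (Set.univ ×ˢ s).indicator (Function.uncurry L) := by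
    ext ⟨x, y⟩
    by_cases hy : y ∈ s <;> simp [hy]
  rw [this]
  exact hL.indicator (MeasurableSet.univ.prod hs)

/-- Bayes' rule as a disintegration of the joint law: weighting by the likelihood amounts to
averaging over the posterior and weighting by the evidence. -/
theorem lintegral_mul_eq_bayes {prior : Measure Y} {L : Y → ℝ≥0∞} (hL : Measurable L)
    (h0 : ∫⁻ θ, L θ ∂prior ≠ 0) (h1 : ∫⁻ θ, L θ ∂prior ≠ ∞) {f : Y → ℝ≥0∞} (hf : Measurable f) :
    ∫⁻ θ, L θ * f θ ∂prior = (∫⁻ θ, L θ ∂prior) * ∫⁻ θ, f θ ∂(bayes prior L) := by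
  rw [bayes, lintegral_smul_measure, lintegral_withDensity_eq_lintegral_mul _ hL hf, smul_eq_mul,
    ← mul_assoc, ENNReal.mul_inv_cancel h0 h1, one_mul]
  rfl

theorem measurable_eval_at {K : ℕ} {θ : X → Fin K → ℝ} {i : X → Fin K} (hθ : Measurable θ)
    (hi : Measurable i) : Measurable fun x => θ x (i x) := by
  have : Measurable (fun p : Fin K × (Fin K → ℝ) => p.2 p.1) :=
    measurable_from_prod_countable_right fun i => measurable_pi_apply i
  exact this.comp (hi.prodMk hθ)

end Kernels

theorem argmax_spec {K : ℕ} [NeZero K] (θ : Fin K → ℝ) (j : Fin K) : θ j ≤ θ (argmax θ) := by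
  have h := Finset.min'_mem (Finset.univ.filter fun i => ∀ j, θ j ≤ θ i) (by
    obtain ⟨i, hi⟩ := Finite.exists_max θ
    exact ⟨i, by simpa using hi⟩)
  exact (Finset.mem_filter.1 h).2 j

theorem argmax_eq_iff {K : ℕ} [NeZero K] (θ : Fin K → ℝ) (i : Fin K) :
    argmax θ = i ↔ (∀ j, θ j ≤ θ i) ∧ ∀ k, (∀ j, θ j ≤ θ k) → i ≤ k := by
  constructor
  · rintro rfl
    exact ⟨argmax_spec θ, fun k hk => Finset.min'_le _ _ (by simpa using hk)⟩
  · rintro ⟨h1, h2⟩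
    exact le_antisymm (Finset.min'_le _ _ (by simpa using h1)) (h2 _ (argmax_spec θ))

theorem measurable_argmax {K : ℕ} [NeZero K] : Measurable (argmax : (Fin K → ℝ) → Fin K) := by
  refine measurable_to_countable' fun i => ?_
  have : argmax ⁻¹' {i} = {θ : Fin K → ℝ | ∀ j, θ j ≤ θ i} ∩
      ⋂ k, {θ : Fin K → ℝ | (∀ j, θ j ≤ θ k) → i ≤ k} := by
    ext θ; simp [argmax_eq_iff]
  rw [this]
  have hm : ∀ k : Fin K, MeasurableSet {θ : Fin K → ℝ | ∀ j, θ j ≤ θ k} := fun k => by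
    rw [Set.ofPred_forall]
    exact MeasurableSet.iInter fun j =>
      measurableSet_le (measurable_pi_apply j) (measurable_pi_apply k)
  refine (hm i).inter (MeasurableSet.iInter fun k => ?_)
  by_cases hik : i ≤ k
  · simp [hik]
  · simpa [hik, Set.compl_def] using (hm k).compl

theorem measurable_gauss {K : ℕ} (s : ℝ≥0) : Measurable fun μ : Fin K → ℝ => gauss μ s := by
  refine Measurable.measure_of_isPiSystem_of_isProbabilityMeasure generateFrom_pi.symm
    isPiSystem_pi ?_
  rintro _ ⟨t, ht, rfl⟩
  simp only [gauss, Measure.pi_pi]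
  refine Finset.measurable_prod _ fun i _ => ?_
  have h := measurable_gaussianReal.comp
    ((measurable_pi_apply i : Measurable fun μ : Fin K → ℝ => μ i).prodMk
      (measurable_const (a := s ^ 2)))
  exact (Measure.measurable_coe (show MeasurableSet (t i) from ht i (Set.mem_univ i))).comp h

theorem measurable_lik {X : Type*} [MeasurableSpace X] {K t : ℕ} (σ : ℝ≥0) {h : X → Hist K t}
    {θ : X → Fin K → ℝ} (hh : Measurable h) (hθ : Measurable θ) :
    Measurable fun x => lik σ (h x) (θ x) := by
  unfold lik
  refine Finset.measurable_prod _ fun j _ => ?_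
  have hj : Measurable fun x => h x j := (measurable_pi_apply j).comp hh
  have h1 : Measurable fun x => θ x (h x j).1 := measurable_eval_at hθ hj.fst
  have h2 : Measurable fun x => (h x j).2 := hj.snd
  exact measurable_uncurry_gaussianPDF.comp (h1.prodMk (measurable_const.prodMk h2))

section Policies

variable {K : ℕ} {σq σ₀ σ : ℝ≥0}

theorem isProbabilityMeasure_bayes_lik (hσ₀ : 0 < σ₀) (hσ : 0 < σ) (ν : Fin K → ℝ) {t : ℕ}
    (h : Hist K t) : IsProbabilityMeasure (bayes (gauss ν σ₀) (lik σ h)) := by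
  rw [bayes_lik hσ₀ hσ]; infer_instance

theorem isProbabilityMeasure_thompson [NeZero K] (hσ₀ : 0 < σ₀) (hσ : 0 < σ) (ν : Fin K → ℝ)
    {t : ℕ} (h : Hist K t) : IsProbabilityMeasure (thompson σ₀ σ ν h) := by
  have := isProbabilityMeasure_bayes_lik hσ₀ hσ ν h
  exact Measure.isProbabilityMeasure_map measurable_argmax.aemeasurable

theorem isProbabilityMeasure_policy [NeZero K] (hσ₀ : 0 < σ₀) (hσ : 0 < σ) (n : ℕ)
    (ν : Fin K → ℝ) (t : ℕ) (h : Hist K t) : IsProbabilityMeasure (policy σ₀ σ n ν t h) := by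
  unfold policy
  split_ifs
  · exact isProbabilityMeasure_thompson hσ₀ hσ ν h
  · infer_instance

theorem measurable_bayes_lik (σ₀ σ : ℝ≥0) (t : ℕ) :
    Measurable fun p : (Fin K → ℝ) × Hist K t => bayes (gauss p.1 σ₀) (lik σ p.2) := by
  refine measurable_bayes (prior := fun p : (Fin K → ℝ) × Hist K t => gauss p.1 σ₀)
    (L := fun p => lik σ p.2)
    ((measurable_gauss σ₀).comp measurable_fst) (fun _ => inferInstance) ?_
  have h : Measurable fun q : ((Fin K → ℝ) × Hist K t) × (Fin K → ℝ) => lik σ q.1.2 q.2 :=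
    measurable_lik σ measurable_fst.snd measurable_snd
  exact h

theorem measurable_policy [NeZero K] (σ₀ σ : ℝ≥0) (n t : ℕ) :
    Measurable fun p : (Fin K → ℝ) × Hist K t => policy σ₀ σ n p.1 t p.2 := by
  unfold policy thompson
  split_ifs
  · exact (Measure.measurable_map _ measurable_argmax).comp (measurable_bayes_lik σ₀ σ t)
  · exact measurable_const

theorem measurable_margLik {X : Type*} [MeasurableSpace X] {n : ℕ} (σ₀ σ : ℝ≥0)
    {h : X → Hist K n} {μ : X → Fin K → ℝ} (hh : Measurable h) (hμ : Measurable μ) :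
    Measurable fun x => margLik σ₀ σ (h x) (μ x) := by
  unfold margLik
  have hl : Measurable fun q : X × (Fin K → ℝ) => lik σ (h q.1) q.2 :=
    measurable_lik σ (hh.comp measurable_fst) measurable_snd
  exact measurable_lintegral_family (κ := fun x => gauss (μ x) σ₀) (f := fun x θ => lik σ (h x) θ)
    ((measurable_gauss σ₀).comp hμ) (fun _ => inferInstance) hl

theorem measurable_prod_margLik {X : Type*} [MeasurableSpace X] {n s : ℕ} (σ₀ σ : ℝ≥0)
    {H : X → Fin s → Hist K n} {μ : X → Fin K → ℝ} (hH : Measurable H) (hμ : Measurable μ) :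
    Measurable fun x => ∏ l, margLik σ₀ σ (H x l) (μ x) :=
  Finset.measurable_prod Finset.univ fun l _ =>
    measurable_margLik σ₀ σ ((measurable_pi_apply l).comp hH) hμ

theorem measurable_metaPosterior {n s : ℕ} (σq σ₀ σ : ℝ≥0) :
    Measurable fun H : Fin s → Hist K n => metaPosterior σq σ₀ σ H := by
  have h : Measurable fun q : (Fin s → Hist K n) × (Fin K → ℝ) =>
      ∏ l, margLik σ₀ σ (q.1 l) q.2 := measurable_prod_margLik σ₀ σ measurable_fst measurable_snd
  exact measurable_bayes (prior := fun _ : Fin s → Hist K n => gauss 0 σq)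
    (L := fun H μ => ∏ l, margLik σ₀ σ (H l) μ) measurable_const (fun _ => inferInstance) h

theorem isProbabilityMeasure_metaPosterior (hσq : 0 < σq) (hσ₀ : 0 < σ₀) (hσ : 0 < σ) {n s : ℕ}
    (H : Fin s → Hist K n) : IsProbabilityMeasure (metaPosterior σq σ₀ σ H) := by
  obtain ⟨m, v, h, -⟩ := exists_metaPosterior_eq hσq hσ₀ hσ H
  rw [h]; infer_instance

end Policies

/-! ### The law of the interaction -/

section Interaction

variable {K : ℕ}

theorem measurable_snoc {A : Type*} [MeasurableSpace A] {t : ℕ} :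
    Measurable fun p : (Fin t → A) × A => (Fin.snoc p.1 p.2 : Fin (t + 1) → A) := by
  refine measurable_pi_iff.2 fun i => ?_
  refine Fin.lastCases ?_ (fun j => ?_) i
  · simpa using measurable_snd
  · simp only [Fin.snoc_castSucc]
    exact (measurable_pi_apply j).comp measurable_fst

theorem measurable_init {A : Type*} [MeasurableSpace A] {t : ℕ} :
    Measurable fun h : Fin (t + 1) → A => (Fin.init h : Fin t → A) :=
  measurable_pi_iff.2 fun j => measurable_pi_apply j.castSucc

/-- The law of the extension of the history `h` by one round in which an arm from the law `π` is
pulled. -/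
noncomputable def stepLaw {t : ℕ} (σ : ℝ≥0) (π : Measure (Fin K)) (θ : Fin K → ℝ) (h : Hist K t) :
    Measure (Hist K (t + 1)) :=
  π.bind fun a => (gaussianReal (θ a) (σ ^ 2)).map fun y => (Fin.snoc h (a, y) : Hist K (t + 1))

theorem measurable_snoc_round {t : ℕ} (h : Hist K t) (a : Fin K) :
    Measurable fun y : ℝ => (Fin.snoc h (a, y) : Hist K (t + 1)) :=
  (measurable_snoc (A := Fin K × ℝ)).comp
    (measurable_const.prodMk (measurable_const.prodMk measurable_id))

theorem lintegral_stepLaw {t : ℕ} (σ : ℝ≥0) (π : Measure (Fin K)) (θ : Fin K → ℝ) (h : Hist K t)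
    {f : Hist K (t + 1) → ℝ≥0∞} (hf : Measurable f) :
    ∫⁻ h', f h' ∂(stepLaw σ π θ h)
      = ∫⁻ a, ∫⁻ y, f (Fin.snoc h (a, y)) ∂(gaussianReal (θ a) (σ ^ 2)) ∂π := by
  rw [stepLaw, Measure.lintegral_bind (measurable_of_finite _).aemeasurable hf.aemeasurable]
  refine lintegral_congr fun a => ?_
  rw [lintegral_map hf (measurable_snoc_round h a)]

theorem measurable_lintegral_reward {t : ℕ} (σ : ℝ≥0) (θ : Fin K → ℝ) (a : Fin K)
    {f : Hist K (t + 1) → ℝ≥0∞} (hf : Measurable f) :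
    Measurable fun h : Hist K t =>
      ∫⁻ y, f (Fin.snoc h (a, y)) ∂(gaussianReal (θ a) (σ ^ 2)) := by
  have h1 : Measurable fun p : Hist K t × ℝ => f (Fin.snoc p.1 (a, p.2)) :=
    hf.comp ((measurable_snoc (A := Fin K × ℝ)).comp
      (measurable_fst.prodMk (measurable_const.prodMk measurable_snd)))
  exact h1.lintegral_prod_right'

theorem isProbabilityMeasure_stepLaw {t : ℕ} (σ : ℝ≥0) (π : Measure (Fin K))
    [IsProbabilityMeasure π] (θ : Fin K → ℝ) (h : Hist K t) :
    IsProbabilityMeasure (stepLaw σ π θ h) :=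
  isProbabilityMeasure_bind (measurable_of_finite _) fun a =>
    Measure.isProbabilityMeasure_map (measurable_snoc_round h a).aemeasurable

theorem measurable_stepLaw {t : ℕ} (σ : ℝ≥0) {π : Hist K t → Measure (Fin K)} (hπ : Measurable π)
    (θ : Fin K → ℝ) : Measurable fun h => stepLaw σ (π h) θ h := by
  refine measurable_of_measurable_lintegral fun f hf => ?_
  simp_rw [lintegral_stepLaw σ _ θ _ hf, lintegral_fintype]
  exact Finset.measurable_sum _ fun a _ => (measurable_lintegral_reward σ θ a hf).mul
    ((Measure.measurable_coe (measurableSet_singleton a)).comp hπ)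

variable {π : (t : ℕ) → Hist K t → Measure (Fin K)}

theorem interact_succ (σ : ℝ≥0) (π : (t : ℕ) → Hist K t → Measure (Fin K)) (θ : Fin K → ℝ)
    (t : ℕ) : interact σ π θ (t + 1) = (interact σ π θ t).bind fun h => stepLaw σ (π t h) θ h :=
  rfl

theorem isProbabilityMeasure_interact (σ : ℝ≥0) (hπ : ∀ t, Measurable (π t))
    (hp : ∀ t h, IsProbabilityMeasure (π t h)) (θ : Fin K → ℝ) (t : ℕ) :
    IsProbabilityMeasure (interact σ π θ t) := by
  induction t with
  | zero => rw [interact]; infer_instance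
  | succ t ih =>
    rw [interact_succ]
    exact isProbabilityMeasure_bind (measurable_stepLaw σ (hπ t) θ) fun h =>
      have := hp t h
      isProbabilityMeasure_stepLaw σ _ θ h

theorem lintegral_interact_succ (σ : ℝ≥0) (hπ : ∀ t, Measurable (π t)) (θ : Fin K → ℝ) (t : ℕ)
    {f : Hist K (t + 1) → ℝ≥0∞} (hf : Measurable f) :
    ∫⁻ h, f h ∂(interact σ π θ (t + 1)) = ∫⁻ h, ∫⁻ a, ∫⁻ y, f (Fin.snoc h (a, y))
      ∂(gaussianReal (θ a) (σ ^ 2)) ∂(π t h) ∂(interact σ π θ t) := by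
  rw [interact_succ, Measure.lintegral_bind (measurable_stepLaw σ (hπ t) θ).aemeasurable
    hf.aemeasurable]
  exact lintegral_congr fun h => lintegral_stepLaw σ _ θ h hf

/-- The reference measure on histories: the product of the counting measure on the arms and the
Lebesgue measure on the rewards, over the rounds. -/
noncomputable def refMeasure (K : ℕ) : (t : ℕ) → Measure (Hist K t)
  | 0 => Measure.dirac Fin.elim0
  | t + 1 => ((refMeasure K t).prod ((Measure.count : Measure (Fin K)).prod
      (volume : Measure ℝ))).map fun p => Fin.snoc p.1 p.2

instance (t : ℕ) : SFinite (refMeasure K t) := by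
  induction t with
  | zero => rw [refMeasure]; infer_instance
  | succ t ih => rw [refMeasure]; infer_instance

theorem lintegral_refMeasure_succ (t : ℕ) {f : Hist K (t + 1) → ℝ≥0∞} (hf : Measurable f) :
    ∫⁻ h, f h ∂(refMeasure K (t + 1))
      = ∫⁻ h, ∑ a, (∫⁻ y, f (Fin.snoc h (a, y))) ∂(refMeasure K t) := by
  have h1 : Measurable fun p : Hist K t × (Fin K × ℝ) => f (Fin.snoc p.1 p.2) :=
    hf.comp (measurable_snoc (A := Fin K × ℝ) (t := t))
  rw [refMeasure, lintegral_map hf measurable_snoc, lintegral_prod _ h1.aemeasurable]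
  refine lintegral_congr fun h => ?_
  have h2 : Measurable fun x : Fin K × ℝ => f (Fin.snoc h x) := h1.comp measurable_prodMk_left
  rw [lintegral_prod _ h2.aemeasurable, lintegral_fintype]
  simp

/-- The product of the probabilities with which the policy pulls the arms in the history. -/
noncomputable def policyWeight (π : (t : ℕ) → Hist K t → Measure (Fin K)) :
    (t : ℕ) → Hist K t → ℝ≥0∞
  | 0, _ => 1
  | t + 1, h => policyWeight π t (Fin.init h) * π t (Fin.init h) {(h (Fin.last t)).1}

theorem policyWeight_snoc (t : ℕ) (h : Hist K t) (x : Fin K × ℝ) :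
    policyWeight π (t + 1) (Fin.snoc h x) = policyWeight π t h * π t h {x.1} := by
  simp [policyWeight]

theorem measurable_policyWeight_family {X : Type*} [MeasurableSpace X]
    {π : X → (t : ℕ) → Hist K t → Measure (Fin K)}
    (hπ : ∀ t, Measurable fun p : X × Hist K t => π p.1 t p.2) (t : ℕ) :
    Measurable fun p : X × Hist K t => policyWeight (π p.1) t p.2 := by
  induction t with
  | zero => simp [policyWeight]
  | succ t ih =>
    have h1 : Measurable fun p : X × Hist K (t + 1) => (p.1, (Fin.init p.2 : Hist K t)) :=
      measurable_fst.prodMk (measurable_init.comp measurable_snd)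
    have h2 : Measurable fun p : Fin K × (X × Hist K t) => π p.2.1 t p.2.2 {p.1} :=
      measurable_from_prod_countable_right fun a =>
        (Measure.measurable_coe (measurableSet_singleton a)).comp (hπ t)
    have h3 : Measurable fun p : X × Hist K (t + 1) => (p.2 (Fin.last t)).1 :=
      ((measurable_pi_apply (Fin.last t)).comp measurable_snd).fst
    exact (ih.comp h1).mul (h2.comp (h3.prodMk h1))

theorem measurable_policyWeight (hπ : ∀ t, Measurable (π t)) (t : ℕ) :
    Measurable (policyWeight π t) :=
  (measurable_policyWeight_family (X := Unit) (π := fun _ => π)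
    (fun t => (hπ t).comp measurable_snd) t).comp
    (measurable_const.prodMk measurable_id : Measurable fun h : Hist K t => ((), h))

theorem lik_snoc {t : ℕ} (σ : ℝ≥0) (h : Hist K t) (a : Fin K) (y : ℝ) (θ : Fin K → ℝ) :
    lik σ (Fin.snoc h (a, y) : Hist K (t + 1)) θ = lik σ h θ * gaussianPDF (θ a) (σ ^ 2) y := by
  simp [lik, Fin.prod_univ_castSucc]

/-- The density of the law of the history is the product of the policy's probabilities, which do not
depend on the instance, and the likelihood, which does not depend on the policy. -/
theorem lintegral_interact {σ : ℝ≥0} (hσ : 0 < σ) (hπ : ∀ t, Measurable (π t)) (θ : Fin K → ℝ)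
    (t : ℕ) {f : Hist K t → ℝ≥0∞} (hf : Measurable f) :
    ∫⁻ h, f h ∂(interact σ π θ t)
      = ∫⁻ h, policyWeight π t h * (lik σ h θ * f h) ∂(refMeasure K t) := by
  have hmeas : ∀ t, ∀ f : Hist K t → ℝ≥0∞, Measurable f →
      Measurable fun h => policyWeight π t h * (lik σ h θ * f h) := fun t f hf =>
    (measurable_policyWeight hπ t).mul ((measurable_lik σ measurable_id measurable_const).mul hf)
  induction t with
  | zero =>
    rw [interact, refMeasure, lintegral_dirac' _ hf, lintegral_dirac' _ (hmeas 0 f hf)]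
    simp [policyWeight, lik]
  | succ t ih =>
    have hv : σ ^ 2 ≠ 0 := by positivity
    have hr := fun a => measurable_lintegral_reward σ θ a hf
    have hsum : ∀ h : Hist K t, ∫⁻ a, ∫⁻ y, f (Fin.snoc h (a, y)) ∂(gaussianReal (θ a) (σ ^ 2))
        ∂(π t h)
        = ∑ a, (∫⁻ y, f (Fin.snoc h (a, y)) ∂(gaussianReal (θ a) (σ ^ 2))) * π t h {a} := fun h =>
      lintegral_fintype _
    rw [lintegral_interact_succ σ hπ θ t hf, lintegral_refMeasure_succ _ (hmeas _ f hf)]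
    have hm : Measurable fun h : Hist K t =>
        ∑ a, (∫⁻ y, f (Fin.snoc h (a, y)) ∂(gaussianReal (θ a) (σ ^ 2))) * π t h {a} :=
      Finset.measurable_sum _ fun a _ => (hr a).mul
        ((Measure.measurable_coe (measurableSet_singleton a)).comp (hπ t))
    simp_rw [hsum]
    rw [ih hm]
    refine lintegral_congr fun h => ?_
    rw [Finset.mul_sum, Finset.mul_sum]
    refine Finset.sum_congr rfl fun a _ => ?_
    simp_rw [policyWeight_snoc, lik_snoc]
    have hfa : Measurable fun y => f (Fin.snoc h (a, y)) := hf.comp (measurable_snoc_round h a)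
    have hg : Measurable fun y => gaussianPDF (θ a) (σ ^ 2) y * f (Fin.snoc h (a, y)) :=
      (measurable_gaussianPDF _ _).mul hfa
    rw [gaussianReal_of_var_ne_zero _ hv,
      lintegral_withDensity_eq_lintegral_mul _ (measurable_gaussianPDF _ _) hfa]
    simp_rw [mul_assoc]
    rw [lintegral_const_mul _ ((hg.const_mul _).const_mul _),
      lintegral_const_mul _ (hg.const_mul _), lintegral_const_mul _ hg]
    simp only [Pi.mul_apply]
    ring

theorem measurable_interact_family {X : Type*} [MeasurableSpace X] {σ : ℝ≥0} (hσ : 0 < σ)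
    {π : X → (t : ℕ) → Hist K t → Measure (Fin K)}
    (hπ : ∀ t, Measurable fun p : X × Hist K t => π p.1 t p.2) (t : ℕ) :
    Measurable fun p : X × (Fin K → ℝ) => interact σ (π p.1) p.2 t := by
  refine measurable_of_measurable_lintegral fun f hf => ?_
  have hπ' : ∀ x t, Measurable (π x t) := fun x t => (hπ t).comp measurable_prodMk_left
  simp_rw [lintegral_interact hσ (hπ' _) _ t hf]
  have h1 : Measurable fun q : (X × (Fin K → ℝ)) × Hist K t =>
      policyWeight (π q.1.1) t q.2 * (lik σ q.2 q.1.2 * f q.2) :=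
    ((measurable_policyWeight_family hπ t).comp (measurable_fst.fst.prodMk measurable_snd)).mul
      ((measurable_lik σ measurable_snd measurable_fst.snd).mul (hf.comp measurable_snd))
  exact h1.lintegral_prod_right'

theorem exists_ne_zero_of_policyWeight_ne_zero {t : ℕ} {h : Hist K t}
    (hw : policyWeight π t h ≠ 0) (j : Fin t) :
    ∃ h' : Hist K j, π j h' {(h j).1} ≠ 0 := by
  induction t with
  | zero => exact j.elim0
  | succ t ih =>
    rw [policyWeight] at hw
    refine Fin.lastCases ?_ (fun i => ?_) j
    · exact ⟨Fin.init h, right_ne_zero_of_mul hw⟩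
    · exact ih (h := Fin.init h) (left_ne_zero_of_mul hw) i

end Interaction

/-- Because of the last `K` rounds, every arm is pulled in every task. -/
theorem exists_pulled_of_policyWeight_ne_zero {K n : ℕ} [NeZero K] (hKn : K ≤ n) {σ₀ σ : ℝ≥0}
    {ν : Fin K → ℝ} {h : Hist K n} (hw : policyWeight (policy σ₀ σ n ν) n h ≠ 0) (i : Fin K) :
    ∃ j, (h j).1 = i := by
  have hi := i.2
  have hlt : n - K + i < n := by omega
  refine ⟨⟨n - K + i, hlt⟩, ?_⟩
  obtain ⟨h', hh⟩ := exists_ne_zero_of_policyWeight_ne_zero hw ⟨n - K + i, hlt⟩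
  have hnot : ¬ (n - K + (i : ℕ) + K < n) := by omega
  simp only [policy, hnot, if_false] at hh
  have hofNat : Fin.ofNat K (n - K + (i : ℕ) + K - n) = i := by
    ext
    simp only [Fin.ofNat]
    rw [show n - K + (i : ℕ) + K - n = i by omega, Nat.mod_eq_of_lt hi]
  rw [hofNat, Measure.dirac_apply' _ (measurableSet_singleton _)] at hh
  by_contra hne
  exact hh (by simp [Set.indicator, Ne.symm hne])

/-! ### Misspecified priors -/

/-- The likelihood ratio of `N(m + d, v)` and `N(m, v)`. -/
noncomputable def shiftRatio (m d : ℝ) (v : ℝ≥0) (x : ℝ) : ℝ :=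
  Real.exp (d * (x - m) / v - d ^ 2 / (2 * v))

theorem gaussianReal_withDensity_shiftRatio {v : ℝ≥0} (hv : 0 < v) (m d : ℝ) :
    (gaussianReal m v).withDensity (fun x => ENNReal.ofReal (shiftRatio m d v x))
      = gaussianReal (m + d) v := by
  rw [gaussianReal_of_var_ne_zero _ hv.ne', gaussianReal_of_var_ne_zero _ hv.ne',
    ← withDensity_mul _ (measurable_gaussianPDF _ _) (by unfold shiftRatio; fun_prop)]
  congr 1
  funext x
  have hv' : (0 : ℝ) < v := hv
  simp only [Pi.mul_apply, gaussianPDF]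
  rw [← ENNReal.ofReal_mul (gaussianPDFReal_nonneg _ _ _)]
  unfold gaussianPDFReal shiftRatio
  rw [mul_assoc, ← Real.exp_add]
  congr 3
  field_simp
  ring

theorem lintegral_shiftRatio_sq {v : ℝ≥0} (hv : 0 < v) (m d : ℝ) :
    ∫⁻ x, ENNReal.ofReal (shiftRatio m d v x) ^ 2 ∂(gaussianReal m v)
      = ENNReal.ofReal (Real.exp (d ^ 2 / v)) := by
  have hv' : (0 : ℝ) < v := hv
  have h1 : ∀ x, ENNReal.ofReal (shiftRatio m d v x) ^ 2
      = ENNReal.ofReal (Real.exp (d ^ 2 / v)) * ENNReal.ofReal (shiftRatio m (2 * d) v x) := by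
    intro x
    unfold shiftRatio
    rw [← ENNReal.ofReal_pow (Real.exp_pos _).le, ← ENNReal.ofReal_mul (Real.exp_pos _).le]
    rw [← Real.exp_nat_mul, ← Real.exp_add]
    congr 2
    push_cast
    field_simp
    ring
  simp_rw [h1]
  rw [lintegral_const_mul _ (by unfold shiftRatio; fun_prop), ← setLIntegral_univ,
    ← withDensity_apply _ MeasurableSet.univ, gaussianReal_withDensity_shiftRatio hv]
  simp

/-- A bound on the positive part of `r - 1` that is quadratic in `r`, so that it can be integrated
exactly; all terms are arranged so that no subtraction occurs. -/
theorem mul_add_le_of_sq {g r M η : ℝ} (hgM : g ≤ M) (hg : 0 ≤ g) (hη : 0 < η) :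
    g * r + M * ((1 - η) / (2 * η)) * r ≤ g + M * ((r ^ 2 + (1 - η) ^ 2) / (4 * η)) := by
  have h1 : M * ((r ^ 2 + (1 - η) ^ 2) / (4 * η)) - M * ((1 - η) / (2 * η)) * r
      = M * ((r - 1 + η) ^ 2 / (4 * η)) := by
    field_simp; ring
  have h2 : (r - 1) * (4 * η) ≤ (r - 1 + η) ^ 2 := by nlinarith [sq_nonneg (r - 1 - η)]
  have h3 : r - 1 ≤ (r - 1 + η) ^ 2 / (4 * η) := by rw [le_div_iff₀ (by positivity)]; exact h2
  have h4 : 0 ≤ (r - 1 + η) ^ 2 / (4 * η) := by positivity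
  have h5 : g * (r - 1) ≤ M * ((r - 1 + η) ^ 2 / (4 * η)) :=
    (mul_le_mul_of_nonneg_left h3 hg).trans (mul_le_mul_of_nonneg_right hgM h4)
  nlinarith

theorem exp_le_one_add_two_mul {x : ℝ} (h0 : 0 ≤ x) (h1 : x ≤ 1) : Real.exp x ≤ 1 + 2 * x := by
  have := Real.abs_exp_sub_one_sub_id_le (x := x) (by rw [abs_of_nonneg h0]; exact h1)
  have := abs_le.1 this
  nlinarith

/-- The total variation distance of two Gaussians with the same diagonal covariance is at most the
Mahalanobis distance `η` of their means. It follows from the `χ²`-divergence `exp (η²) - 1`. -/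
theorem lintegral_gaussian_shift_le {K : ℕ} {m m' : Fin K → ℝ} {v : Fin K → ℝ≥0}
    (hv : ∀ i, 0 < v i) {η : ℝ} (hη : 0 ≤ η) (hd : ∑ i, (m' i - m i) ^ 2 / (v i : ℝ) ≤ η ^ 2)
    {g : (Fin K → ℝ) → ℝ≥0∞} (hg : Measurable g) {M : ℝ≥0∞} (hgM : ∀ x, g x ≤ M) :
    ∫⁻ x, g x ∂(Measure.pi fun i => gaussianReal (m' i) (v i))
      ≤ ∫⁻ x, g x ∂(Measure.pi fun i => gaussianReal (m i) (v i)) + ENNReal.ofReal η * M := by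
  have hvr : ∀ i, (0 : ℝ) < v i := hv
  rcases hη.eq_or_lt with rfl | hη0
  · have hm : m' = m := by
      funext i
      have h1 : (m' i - m i) ^ 2 / (v i : ℝ) ≤ ∑ i, (m' i - m i) ^ 2 / (v i : ℝ) :=
        Finset.single_le_sum (f := fun i => (m' i - m i) ^ 2 / (v i : ℝ))
          (fun i _ => div_nonneg (sq_nonneg _) (hvr i).le) (Finset.mem_univ i)
      have h2 : (m' i - m i) ^ 2 / (v i : ℝ) ≤ 0 := by nlinarith
      rw [div_le_iff₀ (hvr i), zero_mul] at h2
      have := pow_eq_zero_iff (two_ne_zero) |>.1 (le_antisymm h2 (sq_nonneg _))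
      linarith
    simp [hm]
  by_cases hMtop : M = ∞
  · rw [hMtop, ENNReal.mul_top (by simpa using hη0), add_top]
    exact le_top
  by_cases hη1 : 1 < η
  · calc ∫⁻ x, g x ∂(Measure.pi fun i => gaussianReal (m' i) (v i))
        ≤ ∫⁻ _, M ∂(Measure.pi fun i => gaussianReal (m' i) (v i)) := lintegral_mono hgM
      _ = 1 * M := by simp
      _ ≤ ENNReal.ofReal η * M := by
          gcongr
          rw [← ENNReal.ofReal_one]
          exact ENNReal.ofReal_le_ofReal hη1.le
      _ ≤ _ := le_add_self
  push Not at hη1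
  set P := Measure.pi fun i => gaussianReal (m i) (v i) with hP
  set r : (Fin K → ℝ) → ℝ := fun x => ∏ i, shiftRatio (m i) (m' i - m i) (v i) (x i) with hr
  have hr0 : ∀ x, 0 ≤ r x := fun x => Finset.prod_nonneg fun i _ => (Real.exp_pos _).le
  have hrm : Measurable r := by simp only [hr]; unfold shiftRatio; fun_prop
  have hreq : ∀ x, ENNReal.ofReal (r x)
      = ∏ i, ENNReal.ofReal (shiftRatio (m i) (m' i - m i) (v i) (x i)) := fun x =>
    ENNReal.ofReal_prod_of_nonneg fun i _ => (Real.exp_pos _).le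
  have hQ : P.withDensity (fun x => ENNReal.ofReal (r x))
      = Measure.pi fun i => gaussianReal (m' i) (v i) := by
    simp_rw [hreq]
    have := pi_withDensity_prod (fun i => gaussianReal (m i) (v i))
      (fun i => gaussianReal (m' i) (v i))
      (f := fun i x => ENNReal.ofReal (shiftRatio (m i) (m' i - m i) (v i) x))
      (fun i => by unfold shiftRatio; fun_prop) (c := fun _ => 1) (fun _ => one_ne_zero)
      (fun _ => ENNReal.one_ne_top) (fun i => by
        rw [gaussianReal_withDensity_shiftRatio (hv i), one_smul, add_sub_cancel])
    simpa using this
  have hone : ∫⁻ x, ENNReal.ofReal (r x) ∂P = 1 := by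
    rw [← setLIntegral_univ, ← withDensity_apply _ MeasurableSet.univ, hQ]
    exact measure_univ
  have hsq : ∫⁻ x, ENNReal.ofReal (r x) ^ 2 ∂P ≤ ENNReal.ofReal (1 + 2 * η ^ 2) := by
    simp_rw [hreq, ← Finset.prod_pow]
    rw [hP, lintegral_pi_prod _ (f := fun i x =>
      ENNReal.ofReal (shiftRatio (m i) (m' i - m i) (v i) x) ^ 2)
      (fun i => by unfold shiftRatio; fun_prop)]
    simp_rw [lintegral_shiftRatio_sq (hv _)]
    rw [← ENNReal.ofReal_prod_of_nonneg fun _ _ => (Real.exp_pos _).le, ← Real.exp_sum]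
    refine ENNReal.ofReal_le_ofReal ((Real.exp_le_exp.2 hd).trans ?_)
    exact exp_le_one_add_two_mul (by positivity) (by nlinarith)
  lift M to ℝ≥0 using hMtop
  set A : ℝ := M * ((1 - η) / (2 * η)) with hA
  have hA0 : 0 ≤ A := mul_nonneg M.coe_nonneg (div_nonneg (by linarith) (by positivity))
  set B : ℝ := M / (4 * η) with hB
  have hB0 : 0 ≤ B := div_nonneg M.coe_nonneg (by positivity)
  have hpt : ∀ x, ENNReal.ofReal (r x) * g x + ENNReal.ofReal A * ENNReal.ofReal (r x)
      ≤ g x + (ENNReal.ofReal B * ENNReal.ofReal (r x) ^ 2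
        + ENNReal.ofReal (B * (1 - η) ^ 2)) := by
    intro x
    have hgx : g x ≠ ∞ := ne_top_of_le_ne_top ENNReal.coe_ne_top (hgM x)
    have hgr : (g x).toReal ≤ M := ENNReal.toReal_le_coe_of_le_coe (hgM x)
    rw [← ENNReal.ofReal_toReal hgx, ← ENNReal.ofReal_mul (hr0 x), ← ENNReal.ofReal_mul hA0,
      ← ENNReal.ofReal_pow (hr0 x), ← ENNReal.ofReal_mul hB0,
      ← ENNReal.ofReal_add (mul_nonneg (hr0 x) ENNReal.toReal_nonneg) (mul_nonneg hA0 (hr0 x)),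
      ← ENNReal.ofReal_add (mul_nonneg hB0 (by positivity)) (mul_nonneg hB0 (by positivity)),
      ← ENNReal.ofReal_add ENNReal.toReal_nonneg
        (add_nonneg (mul_nonneg hB0 (by positivity)) (mul_nonneg hB0 (by positivity)))]
    refine ENNReal.ofReal_le_ofReal ?_
    have := mul_add_le_of_sq (r := r x) hgr ENNReal.toReal_nonneg hη0
    calc r x * (g x).toReal + A * r x = (g x).toReal * r x + M * ((1 - η) / (2 * η)) * r x := by
          rw [hA]; ring
      _ ≤ _ := this
      _ = _ := by rw [hB]; ring
  have hint := lintegral_mono (μ := P) hpt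
  have hor : Measurable fun x => ENNReal.ofReal (r x) := hrm.ennreal_ofReal
  rw [lintegral_add_left (f := fun x => ENNReal.ofReal (r x) * g x) (hor.mul hg),
    lintegral_const_mul _ hor, hone, mul_one,
    lintegral_add_left hg, lintegral_add_right _ measurable_const,
    lintegral_const_mul _ (hor.pow_const 2), lintegral_const, measure_univ, mul_one] at hint
  have hgQ : ∫⁻ x, ENNReal.ofReal (r x) * g x ∂P
      = ∫⁻ x, g x ∂(Measure.pi fun i => gaussianReal (m' i) (v i)) := by
    rw [← hQ, lintegral_withDensity_eq_lintegral_mul _ hor hg]; rfl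
  rw [hgQ] at hint
  have hfin : ENNReal.ofReal B * ∫⁻ x, ENNReal.ofReal (r x) ^ 2 ∂P
      + ENNReal.ofReal (B * (1 - η) ^ 2) ≤ ENNReal.ofReal η * M + ENNReal.ofReal A := by
    calc _ ≤ ENNReal.ofReal B * ENNReal.ofReal (1 + 2 * η ^ 2)
          + ENNReal.ofReal (B * (1 - η) ^ 2) := by gcongr
      _ = ENNReal.ofReal (B * (1 + 2 * η ^ 2) + B * (1 - η) ^ 2) := by
          rw [← ENNReal.ofReal_mul hB0, ENNReal.ofReal_add (mul_nonneg hB0 (by positivity))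
            (mul_nonneg hB0 (by positivity))]
      _ ≤ ENNReal.ofReal (η * M + A) := by
          refine ENNReal.ofReal_le_ofReal ?_
          have : B * (1 + 2 * η ^ 2) + B * (1 - η) ^ 2 = 3 / 4 * (η * M) + A := by
            rw [hB, hA]; field_simp; ring
          have : 0 ≤ η * (M : ℝ) := mul_nonneg hη M.coe_nonneg
          linarith
      _ = _ := by
          rw [ENNReal.ofReal_add (mul_nonneg hη M.coe_nonneg) hA0, ENNReal.ofReal_mul hη,
            ENNReal.ofReal_coe_nnreal]
  have h := hint.trans (add_le_add_right hfin _)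
  rw [← add_assoc] at h
  exact (ENNReal.add_le_add_iff_right ENNReal.ofReal_ne_top).1 h

section Misspecified

variable {K : ℕ} [NeZero K] {σ₀ σ : ℝ≥0}

theorem postVar_le {w : ℝ≥0} (hw : 0 < w) (a : ℝ≥0) : postVar w a ≤ w := by
  unfold postVar
  rw [inv_le_comm₀ (by positivity) hw]
  exact le_self_add

/-- Whatever the history, the law of the arm pulled by Thompson sampling changes in total variation
by at most `√K ‖μ - ν‖ / σ₀` (where the norm is the sup norm) if the prior mean is changed from `μ`
to `ν`. The posteriors have the same variances, and the shift of the posterior mean of an arm is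
the shift of its prior mean, times the ratio of the posterior variance and the prior variance. -/
theorem lintegral_thompson_le (hσ₀ : 0 < σ₀) (hσ : 0 < σ) (μ ν : Fin K → ℝ) {t : ℕ} (h : Hist K t)
    (g : Fin K → ℝ≥0∞) {M : ℝ≥0∞} (hgM : ∀ a, g a ≤ M) :
    ∫⁻ a, g a ∂(thompson σ₀ σ ν h) ≤ ∫⁻ a, g a ∂(thompson σ₀ σ μ h)
      + ENNReal.ofReal (√K * ‖μ - ν‖ / σ₀) * M := by
  have hg : Measurable g := measurable_of_finite g
  have h0 : (0 : ℝ) < σ₀ := hσ₀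
  unfold thompson
  rw [lintegral_map hg measurable_argmax, lintegral_map hg measurable_argmax,
    bayes_lik hσ₀ hσ, bayes_lik hσ₀ hσ]
  have hv : ∀ i, 0 < tsVar σ₀ σ h i := fun i => postVar_pos (by positivity) _
  refine lintegral_gaussian_shift_le hv (by positivity) ?_ (hg.comp measurable_argmax)
    fun x => hgM _
  have hterm : ∀ i, (tsMean σ₀ σ ν h i - tsMean σ₀ σ μ h i) ^ 2 / (tsVar σ₀ σ h i : ℝ)
      ≤ ‖μ - ν‖ ^ 2 / (σ₀ : ℝ) ^ 2 := by
    intro i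
    have hvi : (0 : ℝ) < tsVar σ₀ σ h i := hv i
    have hvle : (tsVar σ₀ σ h i : ℝ) ≤ (σ₀ : ℝ) ^ 2 := by
      exact_mod_cast postVar_le (show 0 < σ₀ ^ 2 by positivity) (obsPrec σ h i)
    have hdiff : tsMean σ₀ σ ν h i - tsMean σ₀ σ μ h i
        = tsVar σ₀ σ h i * ((ν i - μ i) / (σ₀ : ℝ) ^ 2) := by
      simp only [tsMean, postMean, tsVar]; push_cast; ring
    have hnorm : (ν i - μ i) ^ 2 ≤ ‖μ - ν‖ ^ 2 := by
      have := norm_le_pi_norm (μ - ν) i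
      rw [Pi.sub_apply, Real.norm_eq_abs] at this
      rw [← sq_abs, abs_sub_comm]
      gcongr
    rw [hdiff, div_le_div_iff₀ hvi (by positivity)]
    calc (tsVar σ₀ σ h i * ((ν i - μ i) / (σ₀ : ℝ) ^ 2)) ^ 2 * (σ₀ : ℝ) ^ 2
        = (ν i - μ i) ^ 2 * (tsVar σ₀ σ h i * (tsVar σ₀ σ h i / (σ₀ : ℝ) ^ 2)) := by
          field_simp
      _ ≤ ‖μ - ν‖ ^ 2 * (tsVar σ₀ σ h i * 1) := by
          gcongr
          rw [div_le_one (by positivity)]; exact hvle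
      _ = _ := by ring
  calc ∑ i, (tsMean σ₀ σ ν h i - tsMean σ₀ σ μ h i) ^ 2 / (tsVar σ₀ σ h i : ℝ)
      ≤ ∑ _i : Fin K, ‖μ - ν‖ ^ 2 / (σ₀ : ℝ) ^ 2 := Finset.sum_le_sum fun i _ => hterm i
    _ = (√K * ‖μ - ν‖ / σ₀) ^ 2 := by
        rw [div_pow, mul_pow, Real.sq_sqrt (by positivity)]; simp; ring

theorem lintegral_policy_le (hσ₀ : 0 < σ₀) (hσ : 0 < σ) (n : ℕ) (μ ν : Fin K → ℝ) (t : ℕ)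
    (h : Hist K t) (g : Fin K → ℝ≥0∞) {M : ℝ≥0∞} (hgM : ∀ a, g a ≤ M) :
    ∫⁻ a, g a ∂(policy σ₀ σ n ν t h) ≤ ∫⁻ a, g a ∂(policy σ₀ σ n μ t h)
      + ENNReal.ofReal (√K * ‖μ - ν‖ / σ₀) * M := by
  unfold policy
  split_ifs
  · exact lintegral_thompson_le hσ₀ hσ μ ν h g hgM
  · exact le_self_add

theorem measurable_policy_right (σ₀ σ : ℝ≥0) (n : ℕ) (ν : Fin K → ℝ) (t : ℕ) :
    Measurable (policy σ₀ σ n ν t) := by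
  have h := (measurable_policy σ₀ σ n t).comp
    (measurable_const.prodMk measurable_id : Measurable fun h : Hist K t => (ν, h))
  exact h

theorem measurable_lintegral_policy (σ₀ σ : ℝ≥0) (n : ℕ) (ν : Fin K → ℝ) (t : ℕ)
    {F : Fin K → Hist K t → ℝ≥0∞} (hF : ∀ a, Measurable (F a)) :
    Measurable fun h => ∫⁻ a, F a h ∂(policy σ₀ σ n ν t h) := by
  simp_rw [lintegral_fintype]
  exact Finset.measurable_sum _ fun a _ => (hF a).mul
    ((Measure.measurable_coe (measurableSet_singleton a)).comp (measurable_policy_right σ₀ σ n ν t))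

theorem isProbabilityMeasure_interact_policy (hσ₀ : 0 < σ₀) (hσ : 0 < σ) (n : ℕ) (ν : Fin K → ℝ)
    (θ : Fin K → ℝ) (t : ℕ) : IsProbabilityMeasure (interact σ (policy σ₀ σ n ν) θ t) :=
  isProbabilityMeasure_interact σ (measurable_policy_right σ₀ σ n ν)
    (isProbabilityMeasure_policy hσ₀ hσ n ν) θ t

/-- The total variation distances of the laws of the pulled arms add up over the rounds. -/
theorem lintegral_interact_le (hσ₀ : 0 < σ₀) (hσ : 0 < σ) (n : ℕ) (μ ν θ : Fin K → ℝ) (t : ℕ)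
    {f : Hist K t → ℝ≥0∞} (hf : Measurable f) {M : ℝ≥0∞} (hfM : ∀ h, f h ≤ M) :
    ∫⁻ h, f h ∂(interact σ (policy σ₀ σ n ν) θ t) ≤ ∫⁻ h, f h ∂(interact σ (policy σ₀ σ n μ) θ t)
      + t * (ENNReal.ofReal (√K * ‖μ - ν‖ / σ₀) * M) := by
  induction t with
  | zero => simp [interact]
  | succ t ih =>
    rw [lintegral_interact_succ σ (measurable_policy_right σ₀ σ n ν) θ t hf,
      lintegral_interact_succ σ (measurable_policy_right σ₀ σ n μ) θ t hf]
    set e := ENNReal.ofReal (√K * ‖μ - ν‖ / σ₀) * M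
    set F : Fin K → Hist K t → ℝ≥0∞ := fun a h =>
      ∫⁻ y, f (Fin.snoc h (a, y)) ∂(gaussianReal (θ a) (σ ^ 2)) with hF
    have hFm : ∀ a, Measurable (F a) := fun a => measurable_lintegral_reward σ θ a hf
    have hFM : ∀ h a, F a h ≤ M := fun h a =>
      (lintegral_mono fun y => hfM _).trans (by simp)
    have hGm := measurable_lintegral_policy σ₀ σ n μ t hFm
    have hprob := isProbabilityMeasure_interact_policy hσ₀ hσ n ν θ t
    calc ∫⁻ h, ∫⁻ a, F a h ∂(policy σ₀ σ n ν t h) ∂(interact σ (policy σ₀ σ n ν) θ t)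
        ≤ ∫⁻ h, (∫⁻ a, F a h ∂(policy σ₀ σ n μ t h) + e) ∂(interact σ (policy σ₀ σ n ν) θ t) :=
          lintegral_mono fun h => lintegral_policy_le hσ₀ hσ n μ ν t h (fun a => F a h) (hFM h)
      _ = ∫⁻ h, ∫⁻ a, F a h ∂(policy σ₀ σ n μ t h) ∂(interact σ (policy σ₀ σ n ν) θ t) + e := by
          rw [lintegral_add_right _ measurable_const, lintegral_const, measure_univ, mul_one]
      _ ≤ (∫⁻ h, ∫⁻ a, F a h ∂(policy σ₀ σ n μ t h) ∂(interact σ (policy σ₀ σ n μ) θ t)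
            + t * e) + e := by
          refine add_le_add_left (ih hGm fun h => ?_) _
          have := isProbabilityMeasure_policy hσ₀ hσ n μ t h
          exact (lintegral_mono fun a => hFM h a).trans (by simp)
      _ = _ := by push_cast; ring

/-- The gap between the best and the worst arm, in `[0, ∞]`. -/
noncomputable def width (θ : Fin K → ℝ) : ℝ≥0∞ := ⨆ a, ENNReal.ofReal (θ (argmax θ) - θ a)

theorem measurable_gap {X : Type*} [MeasurableSpace X] {θ : X → Fin K → ℝ} {a : X → Fin K}
    (hθ : Measurable θ) (ha : Measurable a) :
    Measurable fun x => ENNReal.ofReal (θ x (argmax (θ x)) - θ x (a x)) :=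
  ((measurable_eval_at hθ (measurable_argmax.comp hθ)).sub
    (measurable_eval_at hθ ha)).ennreal_ofReal

theorem measurable_width : Measurable (width : (Fin K → ℝ) → ℝ≥0∞) :=
  Measurable.iSup fun _ => measurable_gap measurable_id measurable_const

theorem ofReal_regret {t : ℕ} (θ : Fin K → ℝ) (h : Hist K t) :
    ENNReal.ofReal (regret θ h) = ∑ j, ENNReal.ofReal (θ (argmax θ) - θ (h j).1) :=
  ENNReal.ofReal_sum_of_nonneg fun _ _ => sub_nonneg.2 (argmax_spec θ _)

theorem ofReal_regret_le {t : ℕ} (θ : Fin K → ℝ) (h : Hist K t) :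
    ENNReal.ofReal (regret θ h) ≤ t * width θ := by
  rw [ofReal_regret]
  calc _ ≤ ∑ _j : Fin t, width θ := Finset.sum_le_sum fun j _ =>
        le_iSup (fun a => ENNReal.ofReal (θ (argmax θ) - θ a)) (h j).1
    _ = _ := by simp

theorem measurable_ofReal_regret {X : Type*} [MeasurableSpace X] {t : ℕ} {θ : X → Fin K → ℝ}
    {h : X → Hist K t} (hθ : Measurable θ) (hh : Measurable h) :
    Measurable fun x => ENNReal.ofReal (regret (θ x) (h x)) := by
  simp_rw [ofReal_regret]
  exact Finset.measurable_sum _ fun j _ =>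
    measurable_gap hθ ((measurable_pi_apply j).comp hh).fst

/-- The trivial bound, which does not depend on the meta-posterior sample. -/
theorem taskBayesRegret_le_width (hσ₀ : 0 < σ₀) (hσ : 0 < σ) (n : ℕ) (μ ν : Fin K → ℝ) :
    taskBayesRegret σ₀ σ n μ ν ≤ n * ∫⁻ θ, width θ ∂(gauss μ σ₀) := by
  rw [← lintegral_const_mul _ measurable_width]
  refine lintegral_mono fun θ => ?_
  have := isProbabilityMeasure_interact_policy hσ₀ hσ n ν θ n
  exact (lintegral_mono fun h => ofReal_regret_le θ h).trans (by simp)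

/-- The price of a misspecified prior mean. -/
theorem taskBayesRegret_le_add (hσ₀ : 0 < σ₀) (hσ : 0 < σ) (n : ℕ) (μ ν : Fin K → ℝ) :
    taskBayesRegret σ₀ σ n μ ν ≤ taskBayesRegret σ₀ σ n μ μ
      + n ^ 2 * ENNReal.ofReal (√K * ‖μ - ν‖ / σ₀) * ∫⁻ θ, width θ ∂(gauss μ σ₀) := by
  rw [← lintegral_const_mul _ measurable_width, taskBayesRegret, taskBayesRegret,
    ← lintegral_add_right _ (measurable_width.const_mul _)]
  refine lintegral_mono fun θ => ?_
  refine (lintegral_interact_le hσ₀ hσ n μ ν θ n (measurable_ofReal_regret measurable_const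
    measurable_id') (ofReal_regret_le θ)).trans_eq ?_
  ring

end Misspecified

/-! ### Exponential moments of Gaussians -/

theorem lintegral_exp_gaussianReal {v : ℝ≥0} (hv : 0 < v) (m c : ℝ) :
    ∫⁻ x, ENNReal.ofReal (Real.exp (c * (x - m))) ∂(gaussianReal m v)
      = ENNReal.ofReal (Real.exp (c ^ 2 * v / 2)) := by
  have hv' : (0 : ℝ) < v := hv
  have h1 : ∀ x, ENNReal.ofReal (Real.exp (c * (x - m)))
      = ENNReal.ofReal (Real.exp (c ^ 2 * v / 2)) * ENNReal.ofReal (shiftRatio m (c * v) v x) := by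
    intro x
    unfold shiftRatio
    rw [← ENNReal.ofReal_mul (Real.exp_pos _).le, ← Real.exp_add]
    congr 2
    field_simp
    ring
  simp_rw [h1]
  rw [lintegral_const_mul _ (by unfold shiftRatio; fun_prop), ← setLIntegral_univ,
    ← withDensity_apply _ MeasurableSet.univ, gaussianReal_withDensity_shiftRatio hv]
  simp

theorem lintegral_exp_sq_gaussianReal_le {v : ℝ≥0} (hv : 0 < v) (m : ℝ) {V : ℝ} (hV : v ≤ V) :
    ∫⁻ x, ENNReal.ofReal (Real.exp ((x - m) ^ 2 / (4 * V))) ∂(gaussianReal m v)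
      ≤ ENNReal.ofReal √2 := by
  have hv' : (0 : ℝ) < v := hv
  have h1 : ∀ x, gaussianPDF m v x * ENNReal.ofReal (Real.exp ((x - m) ^ 2 / (4 * v)))
      = ENNReal.ofReal √2 * gaussianPDF m (2 * v) x := by
    intro x
    rw [gaussianPDF, gaussianPDF, ← ENNReal.ofReal_mul (gaussianPDFReal_nonneg _ _ _),
      ← ENNReal.ofReal_mul (by positivity)]
    congr 1
    unfold gaussianPDFReal
    push_cast
    have hs : √(2 * Real.pi * (2 * v)) = √2 * √(2 * Real.pi * v) := by
      rw [← Real.sqrt_mul (by positivity)]; congr 1; ring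
    have h2 : (0 : ℝ) < √2 := by positivity
    rw [hs, mul_assoc, ← Real.exp_add, mul_inv, ← mul_assoc, ← mul_assoc,
      mul_inv_cancel₀ h2.ne', one_mul]
    congr 2
    field_simp
    ring
  calc ∫⁻ x, ENNReal.ofReal (Real.exp ((x - m) ^ 2 / (4 * V))) ∂(gaussianReal m v)
      ≤ ∫⁻ x, ENNReal.ofReal (Real.exp ((x - m) ^ 2 / (4 * v))) ∂(gaussianReal m v) := by
        refine lintegral_mono fun x => ENNReal.ofReal_le_ofReal (Real.exp_le_exp.2 ?_)
        gcongr
    _ = ENNReal.ofReal √2 := by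
        rw [gaussianReal_of_var_ne_zero _ hv.ne',
          lintegral_withDensity_eq_lintegral_mul _ (measurable_gaussianPDF _ _) (by fun_prop)]
        simp only [Pi.mul_apply]
        simp_rw [h1]
        rw [lintegral_const_mul _ (measurable_gaussianPDF _ _),
          lintegral_gaussianPDF_eq_one _ (by positivity), mul_one]

theorem lintegral_exp_eval_gauss {K : ℕ} {s : ℝ≥0} (hs : 0 < s) (μ : Fin K → ℝ) (c : ℝ)
    (i : Fin K) : ∫⁻ θ, ENNReal.ofReal (Real.exp (c * (θ i - μ i))) ∂(gauss μ s)
      = ENNReal.ofReal (Real.exp (c ^ 2 * s ^ 2 / 2)) := by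
  have hf : Measurable fun x : ℝ => ENNReal.ofReal (Real.exp (c * (x - μ i))) := by fun_prop
  rw [gauss, (measurePreserving_eval (fun i => gaussianReal (μ i) (s ^ 2)) i).lintegral_comp hf,
    lintegral_exp_gaussianReal (by positivity)]
  simp

/-- The Chernoff bound for the sup norm: a coordinate exceeds `b` in absolute value with probability
at most twice the Gaussian tail. -/
theorem gauss_norm_tail_le {K : ℕ} {s : ℝ≥0} (hs : 0 < s) {b : ℝ} (hb : 0 ≤ b) :
    gauss (0 : Fin K → ℝ) s {μ | b < ‖μ‖}
      ≤ ENNReal.ofReal (2 * K * Real.exp (-(b ^ 2 / (2 * (s : ℝ) ^ 2)))) := by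
  have hs' : (0 : ℝ) < s := hs
  set c : ℝ := b / (s : ℝ) ^ 2 with hc
  have hc0 : 0 ≤ c := by positivity
  set F : (Fin K → ℝ) → ℝ≥0∞ := fun μ => ∑ i,
    (ENNReal.ofReal (Real.exp (c * (μ i - (0 : Fin K → ℝ) i)))
    + ENNReal.ofReal (Real.exp (-c * (μ i - (0 : Fin K → ℝ) i)))) with hF
  have hFm : Measurable F := by fun_prop
  have hFint : ∫⁻ μ, F μ ∂(gauss (0 : Fin K → ℝ) s)
      = ENNReal.ofReal (2 * K * Real.exp (c ^ 2 * (s : ℝ) ^ 2 / 2)) := by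
    rw [hF, lintegral_finsetSum _ (fun i _ => by fun_prop)]
    have : ∀ i : Fin K, ∫⁻ μ, (ENNReal.ofReal (Real.exp (c * (μ i - (0 : Fin K → ℝ) i)))
        + ENNReal.ofReal (Real.exp (-c * (μ i - (0 : Fin K → ℝ) i)))) ∂(gauss (0 : Fin K → ℝ) s)
        = ENNReal.ofReal (2 * Real.exp (c ^ 2 * (s : ℝ) ^ 2 / 2)) := by
      intro i
      rw [lintegral_add_left (by fun_prop), lintegral_exp_eval_gauss hs,
        lintegral_exp_eval_gauss hs, neg_sq, ← ENNReal.ofReal_add (Real.exp_pos _).le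
        (Real.exp_pos _).le, two_mul]
    simp_rw [this]
    rw [Finset.sum_const, Finset.card_univ, Fintype.card_fin, nsmul_eq_mul,
      ← ENNReal.ofReal_natCast, ← ENNReal.ofReal_mul (by positivity)]
    congr 1
    ring
  have hsub : {μ : Fin K → ℝ | b < ‖μ‖} ⊆ {μ | ENNReal.ofReal (Real.exp (c * b)) ≤ F μ} := by
    intro μ hμ
    have hμ' : ∃ i, b < |μ i| := by
      by_contra hcon
      push Not at hcon
      exact absurd ((pi_norm_le_iff_of_nonneg hb).2 hcon) (not_le.2 hμ)
    obtain ⟨i, hi⟩ := hμ'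
    refine le_trans ?_ (Finset.single_le_sum (f := fun i =>
      ENNReal.ofReal (Real.exp (c * (μ i - (0 : Fin K → ℝ) i)))
        + ENNReal.ofReal (Real.exp (-c * (μ i - (0 : Fin K → ℝ) i))))
      (fun i _ => zero_le) (Finset.mem_univ i))
    rcases le_total 0 (μ i) with h0 | h0
    · rw [abs_of_nonneg h0] at hi
      refine le_trans (ENNReal.ofReal_le_ofReal (Real.exp_le_exp.2 ?_)) le_self_add
      simp only [Pi.zero_apply, sub_zero]
      gcongr
    · rw [abs_of_nonpos h0] at hi
      refine le_trans (ENNReal.ofReal_le_ofReal (Real.exp_le_exp.2 ?_)) le_add_self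
      simp only [Pi.zero_apply, sub_zero]
      nlinarith
  refine (measure_mono hsub).trans ((meas_ge_le_lintegral_div hFm.aemeasurable
    (by simpa using Real.exp_pos _) ENNReal.ofReal_ne_top).trans_eq ?_)
  rw [hFint, ← ENNReal.ofReal_div_of_pos (Real.exp_pos _)]
  congr 1
  rw [mul_div_assoc, ← Real.exp_sub]
  congr 2
  rw [hc]
  field_simp
  ring

section Width

variable {K : ℕ} [NeZero K]

/-- The expected width is at most twice the maximal absolute mean plus twice the usual bound
`s √(2 log n)` on the expected maximum of `n` centred Gaussians. -/
theorem lintegral_width_le {s : ℝ≥0} (hs : 0 < s) (μ : Fin K → ℝ) {n : ℕ} (hKn : K ≤ n)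
    (hn : 2 ≤ n) : ∫⁻ θ, width θ ∂(gauss μ s)
      ≤ ENNReal.ofReal (2 * ‖μ‖ + 2 * √(2 * (s : ℝ) ^ 2 * Real.log n)) := by
  have hs' : (0 : ℝ) < s := hs
  have hn' : (0 : ℝ) < n := by positivity
  have hlog : 0 < Real.log n := Real.log_pos (by exact_mod_cast hn)
  set α : ℝ := √(2 * (s : ℝ) ^ 2 * Real.log n) with hα
  have hα0 : 0 < α := Real.sqrt_pos.2 (by positivity)
  have hα2 : α ^ 2 = 2 * (s : ℝ) ^ 2 * Real.log n := Real.sq_sqrt (by positivity)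
  set c : ℝ := α / (s : ℝ) ^ 2 with hc
  have hc0 : 0 < c := by positivity
  have hcα : c * α = 2 * Real.log n := by
    rw [hc, div_mul_eq_mul_div, ← sq, hα2]; field_simp
  have hcs : c ^ 2 * (s : ℝ) ^ 2 / 2 = Real.log n := by
    rw [hc, div_pow, hα2]; field_simp
  -- a tangent line of the exponential, at `z = α`
  have hz : ∀ z : ℝ, z ≤ α - 1 / c + Real.exp (-(c * α)) / c * Real.exp (c * z) := by
    intro z
    have h1 := Real.add_one_le_exp (c * z - c * α)
    rw [sub_eq_add_neg, Real.exp_add] at h1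
    have h2 : z = (c * z) / c := by field_simp
    rw [h2, show α - 1 / c + Real.exp (-(c * α)) / c * Real.exp (c * ((c * z) / c))
      = (c * α - 1 + Real.exp (c * z) * Real.exp (-(c * α))) / c by field_simp]
    gcongr
    linarith
  set E : ℝ := Real.exp (-(c * α)) / c with hE
  have hE0 : 0 < E := by positivity
  set F : (Fin K → ℝ) → ℝ≥0∞ := fun θ => ∑ k, (ENNReal.ofReal (Real.exp (c * (θ k - μ k)))
    + ENNReal.ofReal (Real.exp (-c * (θ k - μ k)))) with hF
  have hFm : Measurable F := by fun_prop
  have hFint : ∫⁻ θ, F θ ∂(gauss μ s) = ENNReal.ofReal (2 * K * n) := by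
    rw [hF, lintegral_finsetSum _ (fun i _ => by fun_prop)]
    have : ∀ i : Fin K, ∫⁻ θ, (ENNReal.ofReal (Real.exp (c * (θ i - μ i)))
        + ENNReal.ofReal (Real.exp (-c * (θ i - μ i)))) ∂(gauss μ s)
        = ENNReal.ofReal (2 * n) := by
      intro i
      rw [lintegral_add_left (by fun_prop), lintegral_exp_eval_gauss hs,
        lintegral_exp_eval_gauss hs, neg_sq, hcs, Real.exp_log hn',
        ← ENNReal.ofReal_add hn'.le hn'.le, two_mul]
    simp_rw [this]
    rw [Finset.sum_const, Finset.card_univ, Fintype.card_fin, nsmul_eq_mul,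
      ← ENNReal.ofReal_natCast, ← ENNReal.ofReal_mul (by positivity)]
    congr 1
    ring
  have hpt : ∀ θ, width θ + ENNReal.ofReal (2 / c)
      ≤ ENNReal.ofReal (2 * ‖μ‖ + 2 * α) + ENNReal.ofReal E * F θ := by
    intro θ
    have hFr : F θ = ENNReal.ofReal (∑ k, (Real.exp (c * (θ k - μ k))
        + Real.exp (-c * (θ k - μ k)))) := by
      rw [ENNReal.ofReal_sum_of_nonneg fun _ _ => by positivity]
      refine Finset.sum_congr rfl fun k _ => ?_
      rw [ENNReal.ofReal_add (Real.exp_pos _).le (Real.exp_pos _).le]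
    have hsum0 : 0 ≤ ∑ k, (Real.exp (c * (θ k - μ k)) + Real.exp (-c * (θ k - μ k))) :=
      Finset.sum_nonneg fun _ _ => by positivity
    have hα2' : 0 ≤ 2 * ‖μ‖ + 2 * α := by positivity
    rw [hFr, ← ENNReal.ofReal_mul hE0.le, ← ENNReal.ofReal_add hα2' (mul_nonneg hE0.le hsum0)]
    have hgap : ∀ a, θ (argmax θ) - θ a ≤ 2 * ‖μ‖ + 2 * α
        + E * ∑ k, (Real.exp (c * (θ k - μ k)) + Real.exp (-c * (θ k - μ k))) - 2 / c := by
      intro a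
      have hsing : ∀ {f : Fin K → ℝ}, (∀ k, 0 ≤ f k) → ∀ i, f i ≤ ∑ k, f k := fun hf i =>
        Finset.single_le_sum (fun k _ => hf k) (Finset.mem_univ i)
      have h1 := hz (θ (argmax θ) - μ (argmax θ))
      have h2 := hz (-(θ a - μ a))
      rw [mul_neg, ← neg_mul] at h2
      have h3 := hsing (f := fun k => Real.exp (c * (θ k - μ k)))
        (fun _ => (Real.exp_pos _).le) (argmax θ)
      have h4 := hsing (f := fun k => Real.exp (-c * (θ k - μ k)))
        (fun _ => (Real.exp_pos _).le) a
      have h5 := abs_le.1 ((Real.norm_eq_abs _).symm.trans_le (norm_le_pi_norm μ (argmax θ)))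
      have h6 := abs_le.1 ((Real.norm_eq_abs _).symm.trans_le (norm_le_pi_norm μ a))
      have h9 := mul_le_mul_of_nonneg_left h3 hE0.le
      have h10 := mul_le_mul_of_nonneg_left h4 hE0.le
      rw [Finset.sum_add_distrib, mul_add]
      have h11 : 2 / c = 1 / c + 1 / c := by ring
      linarith
    have h0 := hgap (argmax θ)
    rw [sub_self] at h0
    calc width θ + ENNReal.ofReal (2 / c) ≤ _ :=
          add_le_add_left (iSup_le fun a => ENNReal.ofReal_le_ofReal (hgap a)) _
      _ = _ := by rw [← ENNReal.ofReal_add h0 (by positivity)]; congr 1; ring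
  have hint := lintegral_mono (μ := gauss μ s) hpt
  rw [lintegral_add_left measurable_width, lintegral_const, measure_univ, mul_one,
    lintegral_add_left measurable_const, lintegral_const, measure_univ, mul_one,
    lintegral_const_mul _ hFm, hFint, ← ENNReal.ofReal_mul hE0.le] at hint
  have hle : E * (2 * K * n) ≤ 2 / c := by
    rw [hE, hcα, show -(2 * Real.log n) = -Real.log n + -Real.log n by ring, Real.exp_add,
      Real.exp_neg, Real.exp_log hn', div_mul_eq_mul_div]
    gcongr
    rw [show ((n : ℝ)⁻¹ * (n : ℝ)⁻¹) * (2 * K * n) = 2 * (K / n) by field_simp]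
    have : (K : ℝ) / n ≤ 1 := by rw [div_le_one hn']; exact_mod_cast hKn
    linarith
  have h := hint.trans (add_le_add_right (ENNReal.ofReal_le_ofReal hle) _)
  exact (ENNReal.add_le_add_iff_right ENNReal.ofReal_ne_top).1 h

end Width

/-! ### Thompson sampling with the correct prior -/

section Thompson

variable {K : ℕ} [NeZero K] {σ₀ σ : ℝ≥0}

theorem lintegral_ofReal_fintype {A : Type*} [Fintype A] [MeasurableSpace A]
    [MeasurableSingletonClass A] (q : Measure A) [IsFiniteMeasure q] {g : A → ℝ}
    (hg : ∀ a, 0 ≤ g a) :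
    ∫⁻ a, ENNReal.ofReal (g a) ∂q = ENNReal.ofReal (∑ a, q.real {a} * g a) := by
  rw [← ofReal_integral_eq_lintegral_ofReal Integrable.of_finite (ae_of_all _ hg),
    integral_fintype Integrable.of_finite]
  rfl

theorem integrable_exp_gaussianReal (m c : ℝ) (v : ℝ≥0) :
    Integrable (fun x => Real.exp (c * (x - m))) (gaussianReal m v) := by
  have : (fun x => Real.exp (c * (x - m))) = fun x => Real.exp (c * x) * Real.exp (-(c * m)) := by
    funext x; rw [← Real.exp_add]; congr 1; ring
  rw [this]
  exact (integrable_exp_mul_gaussianReal c).mul_const _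

theorem integral_exp_gaussianReal {v : ℝ≥0} (hv : 0 < v) (m c : ℝ) :
    ∫ x, Real.exp (c * (x - m)) ∂(gaussianReal m v) = Real.exp (c ^ 2 * v / 2) := by
  rw [integral_eq_lintegral_of_nonneg_ae (ae_of_all _ fun x => (Real.exp_pos _).le)
    (by fun_prop), lintegral_exp_gaussianReal hv, ENNReal.toReal_ofReal (Real.exp_pos _).le]

/-- The regret of one round of Thompson sampling. Under the posterior `P`, the instance `θ` and the
sampled arm are independent, and the sampled arm has the law of the optimal one; so in expectation
`θ (argmax θ) - θ a` equals `θ (argmax θ) - m (argmax θ)`, which exceeds `√(2 log n)` standard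
deviations of the arm by little. -/
theorem lintegral_gap_le {m : Fin K → ℝ} {v : Fin K → ℝ≥0} (hv : ∀ i, 0 < v i) {s : ℝ≥0}
    (hvs : ∀ i, v i ≤ s ^ 2) {n : ℕ} (hn : 2 ≤ n) {P : Measure (Fin K → ℝ)}
    (hP : P = Measure.pi fun i => gaussianReal (m i) (v i)) :
    ∫⁻ θ, ∫⁻ a, ENNReal.ofReal (θ (argmax θ) - θ a) ∂(P.map argmax) ∂P
      ≤ ∫⁻ a, ENNReal.ofReal (√(2 * Real.log n) * √(v a)) ∂(P.map argmax)
        + ENNReal.ofReal (K * s / n) := by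
  have hprob : IsProbabilityMeasure P := by rw [hP]; infer_instance
  have hq : IsProbabilityMeasure (P.map argmax) :=
    Measure.isProbabilityMeasure_map measurable_argmax.aemeasurable
  set q := P.map argmax with hqdef
  set L : ℝ := √(2 * Real.log n) with hL
  have hn' : (0 : ℝ) < n := by positivity
  have hlog : 1 / 2 ≤ Real.log n := by
    have h2 : Real.log 2 ≤ Real.log n := Real.log_le_log (by norm_num) (by exact_mod_cast hn)
    have := Real.log_two_gt_d9
    linarith
  have hL1 : 1 ≤ L := by
    rw [hL]; apply Real.one_le_sqrt.2; linarith
  have hLpos : 0 < L := by linarith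
  have hL2 : L ^ 2 = 2 * Real.log n := Real.sq_sqrt (by linarith)
  have hvr : ∀ i, (0 : ℝ) < √(v i) := fun i => Real.sqrt_pos.2 (hv i)
  have hvs' : ∀ i, √(v i : ℝ) ≤ s := fun i => by
    rw [Real.sqrt_le_left s.coe_nonneg]; exact_mod_cast hvs i
  set c : Fin K → ℝ := fun i => L / √(v i) with hc
  have hc0 : ∀ i, 0 < c i := fun i => div_pos hLpos (hvr i)
  have hsum1 : ∑ a, q.real {a} = 1 := by
    simp
  -- integrability and integrals of the coordinates and their exponentials
  have hcoord : ∀ a, Integrable (fun θ : Fin K → ℝ => θ a) P := fun a => by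
    rw [hP]
    exact integrable_comp_eval (X := fun _ => ℝ) (μ := fun i => gaussianReal (m i) (v i))
      (i := a) (f := fun x : ℝ => x)
      (memLp_id_gaussianReal 1 |>.integrable le_rfl)
  have hcoordint : ∀ a, ∫ θ, θ a ∂P = m a := fun a => by
    rw [hP, integral_comp_eval (X := fun _ => ℝ) (μ := fun i => gaussianReal (m i) (v i))
      (i := a) (f := fun x : ℝ => x) (by fun_prop)]
    exact integral_id_gaussianReal
  have hexp : ∀ i, Integrable (fun θ : Fin K → ℝ => Real.exp (c i * (θ i - m i))) P := fun i => by
    rw [hP]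
    exact integrable_comp_eval (X := fun _ => ℝ)
      (μ := fun i => gaussianReal (m i) (v i)) (i := i)
      (f := fun x : ℝ => Real.exp (c i * (x - m i)))
      (integrable_exp_gaussianReal _ _ _)
  have hexpint : ∀ i, ∫ θ, Real.exp (c i * (θ i - m i)) ∂P = n := fun i => by
    rw [hP, integral_comp_eval (X := fun _ => ℝ)
      (μ := fun i => gaussianReal (m i) (v i)) (i := i)
      (f := fun x : ℝ => Real.exp (c i * (x - m i)))
      (by fun_prop), integral_exp_gaussianReal (hv i)]
    rw [hc]
    simp only
    rw [div_pow, Real.sq_sqrt (v i).coe_nonneg, hL2]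
    have := (NNReal.coe_pos.2 (hv i))
    rw [show 2 * Real.log n / (v i : ℝ) * v i / 2 = Real.log n by field_simp, Real.exp_log hn']
  have hcomp : ∀ g : Fin K → ℝ, Integrable (fun θ => g (argmax θ)) P := fun g =>
    (integrable_map_measure (measurable_of_finite g).aestronglyMeasurable
      measurable_argmax.aemeasurable).1 Integrable.of_finite
  have hcompint : ∀ g : Fin K → ℝ, ∫ θ, g (argmax θ) ∂P = ∑ a, q.real {a} * g a := fun g => by
    rw [← integral_map measurable_argmax.aemeasurable
      (measurable_of_finite g).aestronglyMeasurable, integral_fintype Integrable.of_finite]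
    rfl
  -- `U` bounds the gap averaged over the sampled arm: the second summand bounds the excess of the
  -- optimal arm over `m + L √v`, by the tangent line of an exponential with moment `n`
  set U : (Fin K → ℝ) → ℝ := fun θ => (m (argmax θ) + L * √(v (argmax θ)))
    + ∑ i, Real.exp (-L ^ 2) / c i * Real.exp (c i * (θ i - m i)) - ∑ a, q.real {a} * θ a with hU
  have hUint : Integrable U P := by
    refine ((hcomp fun a => m a + L * √(v a)).add
      (integrable_finsetSum _ fun i _ => (hexp i).const_mul _)).sub
      (integrable_finsetSum _ fun a _ => (hcoord a).const_mul _)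
  have hUval : ∫ θ, U θ ∂P = ∑ a, q.real {a} * (L * √(v a)) + ∑ i, √(v i) / (n * L) := by
    rw [hU, integral_sub, integral_add, hcompint fun a => m a + L * √(v a),
      integral_finsetSum _ fun i _ => (hexp i).const_mul _,
      integral_finsetSum _ fun a _ => (hcoord a).const_mul _]
    · simp_rw [integral_const_mul, hexpint, hcoordint, mul_add, Finset.sum_add_distrib]
      have : ∀ i, Real.exp (-L ^ 2) / c i * n = √(v i) / (n * L) := by
        intro i
        rw [hL2, show -(2 * Real.log n) = -Real.log n + -Real.log n by ring, Real.exp_add,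
          Real.exp_neg, Real.exp_log hn', hc]
        have := hvr i
        field_simp
      simp_rw [this]
      ring
    · exact hcomp fun a => m a + L * √(v a)
    · exact integrable_finsetSum _ fun i _ => (hexp i).const_mul _
    · exact (hcomp fun a => m a + L * √(v a)).add
        (integrable_finsetSum _ fun i _ => (hexp i).const_mul _)
    · exact integrable_finsetSum _ fun a _ => (hcoord a).const_mul _
  have hpt : ∀ θ, ∑ a, q.real {a} * (θ (argmax θ) - θ a) ≤ U θ := by
    intro θ
    simp_rw [mul_sub, Finset.sum_sub_distrib, ← Finset.sum_mul, hsum1, one_mul, hU]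
    refine sub_le_sub_right ?_ _
    set i := argmax θ
    have h1 : Real.exp (-L ^ 2) / c i * Real.exp (c i * (θ i - m i))
        ≤ ∑ i, Real.exp (-L ^ 2) / c i * Real.exp (c i * (θ i - m i)) :=
      Finset.single_le_sum (f := fun i => Real.exp (-L ^ 2) / c i * Real.exp (c i * (θ i - m i)))
        (fun i _ => by have := hc0 i; positivity) (Finset.mem_univ i)
    have h2 : (θ i - m i) - L * √(v i)
        ≤ Real.exp (-L ^ 2) / c i * Real.exp (c i * (θ i - m i)) := by
      have h3 := Real.add_one_le_exp (-L ^ 2 + c i * (θ i - m i))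
      have h4 : L ^ 2 = c i * (L * √(v i)) := by
        rw [hc]; have := hvr i; field_simp
      rw [div_mul_eq_mul_div, ← Real.exp_add, le_div_iff₀ (hc0 i)]
      nlinarith
    linarith
  have hgap0 : ∀ θ : Fin K → ℝ, ∀ a, 0 ≤ θ (argmax θ) - θ a := fun θ a =>
    sub_nonneg.2 (argmax_spec θ a)
  calc ∫⁻ θ, ∫⁻ a, ENNReal.ofReal (θ (argmax θ) - θ a) ∂q ∂P
      = ∫⁻ θ, ENNReal.ofReal (∑ a, q.real {a} * (θ (argmax θ) - θ a)) ∂P :=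
        lintegral_congr fun θ => lintegral_ofReal_fintype q (hgap0 θ)
    _ ≤ ∫⁻ θ, ENNReal.ofReal (U θ) ∂P :=
        lintegral_mono fun θ => ENNReal.ofReal_le_ofReal (hpt θ)
    _ = ENNReal.ofReal (∫ θ, U θ ∂P) := by
        refine (ofReal_integral_eq_lintegral_ofReal hUint (ae_of_all _ fun θ => ?_)).symm
        exact (Finset.sum_nonneg fun a _ =>
          mul_nonneg measureReal_nonneg (hgap0 θ a)).trans (hpt θ)
    _ ≤ ENNReal.ofReal (∑ a, q.real {a} * (L * √(v a)) + K * s / n) := by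
        rw [hUval]
        refine ENNReal.ofReal_le_ofReal (add_le_add_right ?_ _)
        calc ∑ i, √(v i : ℝ) / (n * L) ≤ ∑ _i : Fin K, (s : ℝ) / n := by
              refine Finset.sum_le_sum fun i _ => ?_
              gcongr
              · exact hvs' i
              · nlinarith
          _ = K * s / n := by simp; ring
    _ = _ := by
        rw [ENNReal.ofReal_add (Finset.sum_nonneg fun a _ => mul_nonneg measureReal_nonneg
          (by positivity)) (by positivity),
          lintegral_ofReal_fintype q fun a => by positivity]

end Thompson

section BayesRegret

variable {K : ℕ} {σ₀ σ : ℝ≥0}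

theorem margLik_ne_zero (hσ₀ : 0 < σ₀) (hσ : 0 < σ) {t : ℕ} (h : Hist K t) (μ : Fin K → ℝ) :
    margLik σ₀ σ h μ ≠ 0 := by
  obtain ⟨c, hc0, -, b, hb⟩ := exists_margLik_eq hσ₀ hσ h
  rw [hb, quadLik_eq_exp_sum]
  exact mul_ne_zero hc0 (by simpa using Real.exp_pos _)

theorem margLik_ne_top (hσ₀ : 0 < σ₀) (hσ : 0 < σ) {t : ℕ} (h : Hist K t) (μ : Fin K → ℝ) :
    margLik σ₀ σ h μ ≠ ∞ := by
  obtain ⟨c, -, hc, b, hb⟩ := exists_margLik_eq hσ₀ hσ h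
  rw [hb, quadLik_eq_exp_sum]
  exact ENNReal.mul_ne_top hc ENNReal.ofReal_ne_top

/-- Within a task, the instance given the history has the posterior law of Bayes' rule, because the
policy does not look at the instance. -/
theorem lintegral_interact_eq_bayes (hσ₀ : 0 < σ₀) (hσ : 0 < σ)
    {π : (t : ℕ) → Hist K t → Measure (Fin K)} (hπ : ∀ t, Measurable (π t)) (μ : Fin K → ℝ) (t : ℕ)
    {F : (Fin K → ℝ) → Hist K t → ℝ≥0∞} (hF : Measurable (Function.uncurry F)) :
    ∫⁻ θ, ∫⁻ h, F θ h ∂(interact σ π θ t) ∂(gauss μ σ₀)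
      = ∫⁻ h, policyWeight π t h * (margLik σ₀ σ h μ *
        ∫⁻ θ, F θ h ∂(bayes (gauss μ σ₀) (lik σ h))) ∂(refMeasure K t) := by
  have hFθ : ∀ θ, Measurable (F θ) := fun θ => hF.comp measurable_prodMk_left
  have hFh : ∀ h, Measurable fun θ => F θ h := fun h => hF.comp measurable_prodMk_right
  have hL : ∀ h : Hist K t, Measurable (lik σ h) := fun h =>
    measurable_lik σ measurable_const measurable_id
  simp_rw [fun θ => lintegral_interact hσ hπ θ t (hFθ θ)]
  have hW : Measurable fun p : (Fin K → ℝ) × Hist K t =>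
      policyWeight π t p.2 * (lik σ p.2 p.1 * F p.1 p.2) :=
    ((measurable_policyWeight hπ t).comp measurable_snd).mul
      ((measurable_lik σ measurable_snd measurable_fst).mul hF)
  rw [lintegral_lintegral_swap hW.aemeasurable]
  refine lintegral_congr fun h => ?_
  have hLF : Measurable fun θ => lik σ h θ * F θ h := (hL h).mul (hFh h)
  rw [lintegral_const_mul _ hLF, lintegral_mul_eq_bayes (hL h)
    (margLik_ne_zero hσ₀ hσ h μ) (margLik_ne_top hσ₀ hσ h μ) (hFh h)]
  rfl

/-- The expectation of a quantity that is additive over the rounds. -/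
theorem lintegral_interact_add (σ : ℝ≥0) {π : (t : ℕ) → Hist K t → Measure (Fin K)}
    (hπ : ∀ t, Measurable (π t)) (hp : ∀ t h, IsProbabilityMeasure (π t h)) (θ : Fin K → ℝ) (t : ℕ)
    {f : Hist K t → ℝ≥0∞} (hf : Measurable f) {g : Hist K t → Fin K → ℝ≥0∞}
    (hg : ∀ a, Measurable fun h => g h a) :
    ∫⁻ h, (f (Fin.init h) + g (Fin.init h) (h (Fin.last t)).1) ∂(interact σ π θ (t + 1))
      = ∫⁻ h, f h ∂(interact σ π θ t) + ∫⁻ h, ∫⁻ a, g h a ∂(π t h) ∂(interact σ π θ t) := by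
  have hg' : Measurable fun p : Hist K t × Fin K => g p.1 p.2 :=
    measurable_from_prod_countable_left fun a => hg a
  have hm : Measurable fun h : Hist K (t + 1) =>
      f (Fin.init h) + g (Fin.init h) (h (Fin.last t)).1 :=
    (hf.comp measurable_init).add (hg'.comp (measurable_init.prodMk
      (measurable_pi_apply (Fin.last t)).fst))
  rw [lintegral_interact_succ σ hπ θ t hm, ← lintegral_add_left hf]
  refine lintegral_congr fun h => ?_
  have := hp t h
  simp only [Fin.init_snoc, Fin.snoc_last, lintegral_const, measure_univ, mul_one]
  rw [lintegral_add_left measurable_const, lintegral_const, measure_univ, mul_one]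

/-- The sum over the rounds of the posterior standard deviations of the pulled arms. -/
noncomputable def sdSum (σ₀ σ : ℝ≥0) : (t : ℕ) → Hist K t → ℝ
  | 0, _ => 0
  | t + 1, h => sdSum σ₀ σ t (Fin.init h) + √(tsVar σ₀ σ (Fin.init h : Hist K t) (h (Fin.last t)).1)

theorem sdSum_nonneg (σ₀ σ : ℝ≥0) (t : ℕ) (h : Hist K t) : 0 ≤ sdSum σ₀ σ t h := by
  induction t with
  | zero => exact le_rfl
  | succ t ih => exact add_nonneg (ih _) (Real.sqrt_nonneg _)

theorem measurable_tsVar (σ₀ σ : ℝ≥0) {t : ℕ} (i : Fin K) :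
    Measurable fun h : Hist K t => tsVar σ₀ σ h i := by
  have : Measurable fun h : Hist K t => obsPrec σ h i :=
    Finset.measurable_sum _ fun j _ => Measurable.ite
      ((measurable_pi_apply j).fst (measurableSet_singleton i)) measurable_const measurable_const
  exact (measurable_const.add this).inv

theorem measurable_sdSum (σ₀ σ : ℝ≥0) (t : ℕ) :
    Measurable (sdSum σ₀ σ t : Hist K t → ℝ) := by
  induction t with
  | zero => exact measurable_const
  | succ t ih =>
    have h1 : Measurable fun p : Hist K t × Fin K => tsVar σ₀ σ p.1 p.2 :=
      measurable_from_prod_countable_left fun a => measurable_tsVar σ₀ σ a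
    have h2 : Measurable fun h : Hist K (t + 1) =>
        ((Fin.init h : Hist K t), (h (Fin.last t)).1) :=
      measurable_init.prodMk (measurable_pi_apply (Fin.last t)).fst
    exact (ih.comp measurable_init).add (h1.comp h2).coe_nnreal_real.sqrt

/-- The number of pulls of arm `i`. -/
noncomputable def pulls {t : ℕ} (h : Hist K t) (i : Fin K) : ℝ := ∑ j, if (h j).1 = i then 1 else 0

theorem sum_pulls {t : ℕ} (h : Hist K t) : ∑ i, pulls h i = t := by
  unfold pulls
  rw [Finset.sum_comm]
  simp

theorem pulls_nonneg {t : ℕ} (h : Hist K t) (i : Fin K) : 0 ≤ pulls h i :=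
  Finset.sum_nonneg fun j _ => by split_ifs <;> norm_num

theorem sqrt_tsVar (hσ₀ : 0 < σ₀) (hσ : 0 < σ) {t : ℕ} (h : Hist K t) (i : Fin K) :
    √(tsVar σ₀ σ h i : ℝ) = σ / √((σ : ℝ) ^ 2 / (σ₀ : ℝ) ^ 2 + pulls h i) := by
  have h0 : (0 : ℝ) < σ₀ := hσ₀
  have h1 : (0 : ℝ) < σ := hσ
  have hobs : (obsPrec σ h i : ℝ) = pulls h i / (σ : ℝ) ^ 2 := by
    unfold obsPrec pulls
    push_cast
    rw [Finset.sum_div]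
    refine Finset.sum_congr rfl fun j _ => ?_
    split_ifs <;> simp
  have hp := pulls_nonneg h i
  rw [← Real.sqrt_sq h1.le, ← Real.sqrt_div (by positivity), Real.sq_sqrt (by positivity)]
  congr 1
  unfold tsVar postVar
  push_cast
  rw [hobs]
  field_simp

/-- A discrete antiderivative that dominates `1 / √x`. -/
noncomputable def sqrtPotential (x : ℝ) : ℝ := 2 * √x - 1 / √x

theorem one_div_sqrt_le {x : ℝ} (hx : 0 < x) :
    1 / √x ≤ sqrtPotential (x + 1) - sqrtPotential x := by
  have h1 : 0 < √x := Real.sqrt_pos.2 hx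
  have h2 : 0 < √(x + 1) := Real.sqrt_pos.2 (by linarith)
  have h3 : √x ≤ √(x + 1) := Real.sqrt_le_sqrt (by linarith)
  have h4 : (√(x + 1) - √x) * (√(x + 1) + √x) = 1 := by
    ring_nf
    rw [Real.sq_sqrt (by linarith), Real.sq_sqrt hx.le]; ring
  have h5 : 1 / √(x + 1) ≤ 2 * (√(x + 1) - √x) := by
    rw [div_le_iff₀ h2]; nlinarith
  unfold sqrtPotential
  linarith

theorem pulls_eq_init {t : ℕ} (h : Hist K (t + 1)) (i : Fin K) :
    pulls h i = pulls (Fin.init h : Hist K t) i + if (h (Fin.last t)).1 = i then 1 else 0 := by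
  simp only [pulls, Fin.sum_univ_castSucc, Fin.init]
  rfl

theorem sdSum_le_potential (hσ₀ : 0 < σ₀) (hσ : 0 < σ) (t : ℕ) (h : Hist K t) :
    sdSum σ₀ σ t h ≤ σ * ∑ i, (sqrtPotential ((σ : ℝ) ^ 2 / (σ₀ : ℝ) ^ 2 + pulls h i)
      - sqrtPotential ((σ : ℝ) ^ 2 / (σ₀ : ℝ) ^ 2)) := by
  have h0 : (0 : ℝ) < σ₀ := hσ₀
  have h1 : (0 : ℝ) < σ := hσ
  set c : ℝ := (σ : ℝ) ^ 2 / (σ₀ : ℝ) ^ 2 with hc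
  have hc0 : 0 < c := by positivity
  induction t with
  | zero => simp [sdSum, pulls]
  | succ t ih =>
    set a := (h (Fin.last t)).1 with ha
    set h' : Hist K t := Fin.init h with hh'
    have hstep : ∑ i, (sqrtPotential (c + pulls h' i) - sqrtPotential c)
        + 1 / √(c + pulls h' a) ≤ ∑ i, (sqrtPotential (c + pulls h i) - sqrtPotential c) := by
      rw [← Finset.add_sum_erase _ _ (Finset.mem_univ a),
        ← Finset.add_sum_erase (f := fun i => sqrtPotential (c + pulls h i) - sqrtPotential c) _
          (Finset.mem_univ a)]
      have h2 : ∑ i ∈ Finset.univ.erase a, (sqrtPotential (c + pulls h i) - sqrtPotential c)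
          = ∑ i ∈ Finset.univ.erase a, (sqrtPotential (c + pulls h' i) - sqrtPotential c) := by
        refine Finset.sum_congr rfl fun i hi => ?_
        rw [pulls_eq_init, if_neg (Finset.ne_of_mem_erase hi).symm, add_zero]
      have h3 := one_div_sqrt_le (x := c + pulls h' a) (by have := pulls_nonneg h' a; linarith)
      rw [h2, pulls_eq_init h a, if_pos ha.symm, ← add_assoc]
      linarith
    calc sdSum σ₀ σ (t + 1) h = sdSum σ₀ σ t h' + √(tsVar σ₀ σ h' a) := rfl
      _ ≤ σ * ∑ i, (sqrtPotential (c + pulls h' i) - sqrtPotential c)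
          + σ / √(c + pulls h' a) := add_le_add (ih h') (sqrt_tsVar hσ₀ hσ h' a).le
      _ = σ * (∑ i, (sqrtPotential (c + pulls h' i) - sqrtPotential c)
          + 1 / √(c + pulls h' a)) := by ring
      _ ≤ _ := mul_le_mul_of_nonneg_left hstep h1.le

theorem sdSum_le (hσ₀ : 0 < σ₀) (hσ : 0 < σ) (t : ℕ) (h : Hist K t) :
    sdSum σ₀ σ t h ≤ 2 * σ * (√K * (√(t + (σ : ℝ) ^ 2 / (σ₀ : ℝ) ^ 2 * K)
      - √((σ : ℝ) ^ 2 / (σ₀ : ℝ) ^ 2 * K))) + K * σ₀ := by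
  have h0 : (0 : ℝ) < σ₀ := hσ₀
  have h1 : (0 : ℝ) < σ := hσ
  refine (sdSum_le_potential hσ₀ hσ t h).trans ?_
  set c : ℝ := (σ : ℝ) ^ 2 / (σ₀ : ℝ) ^ 2 with hc
  have hc0 : 0 < c := by positivity
  have hsc : σ / √c = σ₀ := by
    rw [hc, Real.sqrt_div (by positivity), Real.sqrt_sq h1.le, Real.sqrt_sq h0.le]; field_simp
  have hterm : ∀ i, sqrtPotential (c + pulls h i) - sqrtPotential c
      ≤ 2 * √(c + pulls h i) - 2 * √c + 1 / √c := by
    intro i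
    have : 0 ≤ 1 / √(c + pulls h i) := by positivity
    unfold sqrtPotential
    linarith
  have hcs : ∑ i, √(c + pulls h i) ≤ √K * √(t + c * K) := by
    rw [← Real.sqrt_mul (by positivity)]
    refine Real.le_sqrt_of_sq_le ?_
    have := sq_sum_le_card_mul_sum_sq (s := Finset.univ) (f := fun i => √(c + pulls h i))
    simp_rw [fun i => Real.sq_sqrt (add_nonneg hc0.le (pulls_nonneg h i))] at this
    rw [Finset.sum_add_distrib, sum_pulls] at this
    simp only [Finset.card_univ, Fintype.card_fin, Finset.sum_const, nsmul_eq_mul] at this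
    linarith
  have hKc : √K * √(c * K) = K * √c := by
    rw [Real.sqrt_mul hc0.le, mul_left_comm, Real.mul_self_sqrt (by positivity), mul_comm]
  calc σ * ∑ i, (sqrtPotential (c + pulls h i) - sqrtPotential c)
      ≤ σ * ∑ i, (2 * √(c + pulls h i) - 2 * √c + 1 / √c) :=
        mul_le_mul_of_nonneg_left (Finset.sum_le_sum fun i _ => hterm i) h1.le
    _ = 2 * σ * (∑ i, √(c + pulls h i) - K * √c) + K * (σ / √c) := by
        rw [Finset.sum_add_distrib, Finset.sum_sub_distrib, ← Finset.mul_sum]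
        simp only [Finset.card_univ, Fintype.card_fin, Finset.sum_const, nsmul_eq_mul]
        ring
    _ ≤ _ := by
        rw [hsc, ← hKc]
        gcongr
        linarith

variable [NeZero K]

theorem ofReal_regret_eq_init {t : ℕ} (θ : Fin K → ℝ) (h : Hist K (t + 1)) :
    ENNReal.ofReal (regret θ h) = ENNReal.ofReal (regret θ (Fin.init h : Hist K t))
      + ENNReal.ofReal (θ (argmax θ) - θ (h (Fin.last t)).1) := by
  simp [ofReal_regret, Fin.sum_univ_castSucc, Fin.init]

theorem lintegral_regret_succ (hσ₀ : 0 < σ₀) (hσ : 0 < σ) (n : ℕ) (ν θ : Fin K → ℝ) (t : ℕ) :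
    ∫⁻ h, ENNReal.ofReal (regret θ h) ∂(interact σ (policy σ₀ σ n ν) θ (t + 1))
      = ∫⁻ h, ENNReal.ofReal (regret θ h) ∂(interact σ (policy σ₀ σ n ν) θ t)
        + ∫⁻ h, ∫⁻ a, ENNReal.ofReal (θ (argmax θ) - θ a) ∂(policy σ₀ σ n ν t h)
          ∂(interact σ (policy σ₀ σ n ν) θ t) := by
  simp_rw [ofReal_regret_eq_init]
  exact lintegral_interact_add σ (measurable_policy_right σ₀ σ n ν)
    (isProbabilityMeasure_policy hσ₀ hσ n ν) θ t
    (f := fun h => ENNReal.ofReal (regret θ h))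
    (measurable_ofReal_regret measurable_const measurable_id')
    (g := fun _ a => ENNReal.ofReal (θ (argmax θ) - θ a)) fun a => measurable_const

theorem measurable_interact_policy (hσ : 0 < σ) (n : ℕ) (t : ℕ) :
    Measurable fun p : (Fin K → ℝ) × (Fin K → ℝ) => interact σ (policy σ₀ σ n p.1) p.2 t :=
  measurable_interact_family hσ (π := fun ν => policy σ₀ σ n ν)
    (fun t => measurable_policy σ₀ σ n t) t

theorem measurable_lintegral_interact_policy (hσ₀ : 0 < σ₀) (hσ : 0 < σ) (n : ℕ) (ν : Fin K → ℝ)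
    (t : ℕ) {F : (Fin K → ℝ) → Hist K t → ℝ≥0∞} (hF : Measurable (Function.uncurry F)) :
    Measurable fun θ => ∫⁻ h, F θ h ∂(interact σ (policy σ₀ σ n ν) θ t) := by
  have h1 : Measurable fun θ => interact σ (policy σ₀ σ n ν) θ t := by
    have h2 := (measurable_interact_policy (σ₀ := σ₀) hσ n t).comp
      (measurable_const.prodMk measurable_id : Measurable fun θ : Fin K → ℝ => (ν, θ))
    exact h2
  exact measurable_lintegral_family h1
    (fun θ => isProbabilityMeasure_interact_policy hσ₀ hσ n ν θ t) hF

theorem measurable_lintegral_gap_policy (σ₀ σ : ℝ≥0) (n : ℕ) (ν : Fin K → ℝ) (t : ℕ) :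
    Measurable (Function.uncurry fun (θ : Fin K → ℝ) (h : Hist K t) =>
      ∫⁻ a, ENNReal.ofReal (θ (argmax θ) - θ a) ∂(policy σ₀ σ n ν t h)) := by
  simp_rw [lintegral_fintype]
  refine Finset.measurable_sum _ fun a _ => ?_
  exact (measurable_gap (X := (Fin K → ℝ) × Hist K t) measurable_fst measurable_const).mul
    (((Measure.measurable_coe (measurableSet_singleton a)).comp
      (measurable_policy_right σ₀ σ n ν t)).comp measurable_snd)

/-- The expected regret of one round of Thompson sampling with the correct prior. -/
theorem lintegral_round_le (hσ₀ : 0 < σ₀) (hσ : 0 < σ) {n : ℕ} (hn : 2 ≤ n) (μ : Fin K → ℝ) {t : ℕ}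
    (ht : t + K < n) :
    ∫⁻ θ, ∫⁻ h, ∫⁻ a, ENNReal.ofReal (θ (argmax θ) - θ a) ∂(policy σ₀ σ n μ t h)
        ∂(interact σ (policy σ₀ σ n μ) θ t) ∂(gauss μ σ₀)
      ≤ ∫⁻ θ, ∫⁻ h, ∫⁻ a, ENNReal.ofReal (√(2 * Real.log n) * √(tsVar σ₀ σ h a))
        ∂(policy σ₀ σ n μ t h) ∂(interact σ (policy σ₀ σ n μ) θ t) ∂(gauss μ σ₀)
        + ENNReal.ofReal (K * σ₀ / n) := by
  have hπ := measurable_policy_right (K := K) σ₀ σ n μ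
  have hG : Measurable fun h : Hist K t =>
      ∫⁻ a, ENNReal.ofReal (√(2 * Real.log n) * √(tsVar σ₀ σ h a)) ∂(policy σ₀ σ n μ t h) :=
    measurable_lintegral_policy σ₀ σ n μ t fun a =>
      ((measurable_tsVar σ₀ σ a).coe_nnreal_real.sqrt.const_mul _).ennreal_ofReal
  have hconst : ∫⁻ θ, ∫⁻ _h, ENNReal.ofReal (K * σ₀ / n)
      ∂(interact σ (policy σ₀ σ n μ) θ t) ∂(gauss μ σ₀) = ENNReal.ofReal (K * σ₀ / n) := by
    have := fun θ => isProbabilityMeasure_interact_policy hσ₀ hσ n μ θ t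
    simp
  have hGc : Measurable (Function.uncurry fun (_ : Fin K → ℝ) (h : Hist K t) =>
      ∫⁻ a, ENNReal.ofReal (√(2 * Real.log n) * √(tsVar σ₀ σ h a)) ∂(policy σ₀ σ n μ t h)) :=
    hG.comp measurable_snd
  rw [← hconst, ← lintegral_add_left (measurable_lintegral_interact_policy hσ₀ hσ n μ t hGc)]
  simp_rw [← lintegral_add_left hG]
  rw [lintegral_interact_eq_bayes hσ₀ hσ hπ μ t (measurable_lintegral_gap_policy σ₀ σ n μ t),
    lintegral_interact_eq_bayes hσ₀ hσ hπ μ t (F := fun _ h =>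
      ∫⁻ a, ENNReal.ofReal (√(2 * Real.log n) * √(tsVar σ₀ σ h a)) ∂(policy σ₀ σ n μ t h)
        + ENNReal.ofReal (K * σ₀ / n)) ((hG.add measurable_const).comp measurable_snd)]
  refine lintegral_mono fun h => ?_
  have hpr := isProbabilityMeasure_bayes_lik hσ₀ hσ μ h
  have hpol : policy σ₀ σ n μ t h = (bayes (gauss μ σ₀) (lik σ h)).map argmax := by
    rw [policy, if_pos ht, thompson]
  simp only [hpol]
  refine mul_le_mul_right (mul_le_mul_right ?_ _) _
  rw [lintegral_const, measure_univ, mul_one]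
  exact lintegral_gap_le (fun i => postVar_pos (by positivity) _)
    (fun i => postVar_le (by positivity) _) hn (bayes_lik hσ₀ hσ μ h)

theorem lintegral_regret_le_sdSum (hσ₀ : 0 < σ₀) (hσ : 0 < σ) {n : ℕ} (hn : 2 ≤ n)
    (μ : Fin K → ℝ) {t : ℕ} (ht : t + K ≤ n) :
    ∫⁻ θ, ∫⁻ h, ENNReal.ofReal (regret θ h) ∂(interact σ (policy σ₀ σ n μ) θ t) ∂(gauss μ σ₀)
      ≤ ∫⁻ θ, ∫⁻ h, ENNReal.ofReal (√(2 * Real.log n) * sdSum σ₀ σ t h)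
        ∂(interact σ (policy σ₀ σ n μ) θ t) ∂(gauss μ σ₀) + t * ENNReal.ofReal (K * σ₀ / n) := by
  induction t with
  | zero => simp [interact, regret]
  | succ t ih =>
    have hm1 : Measurable fun θ : Fin K → ℝ =>
        ∫⁻ h, ENNReal.ofReal (regret θ h) ∂(interact σ (policy σ₀ σ n μ) θ t) :=
      measurable_lintegral_interact_policy hσ₀ hσ n μ t
        (measurable_ofReal_regret measurable_fst measurable_snd)
    have hs : Measurable fun h : Hist K t =>
        ENNReal.ofReal (√(2 * Real.log n) * sdSum σ₀ σ t h) :=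
      ((measurable_sdSum σ₀ σ t).const_mul _).ennreal_ofReal
    have hm2 : Measurable fun θ : Fin K → ℝ =>
        ∫⁻ h, ENNReal.ofReal (√(2 * Real.log n) * sdSum σ₀ σ t h)
          ∂(interact σ (policy σ₀ σ n μ) θ t) :=
      measurable_lintegral_interact_policy hσ₀ hσ n μ t (F := fun _ h =>
        ENNReal.ofReal (√(2 * Real.log n) * sdSum σ₀ σ t h)) (hs.comp measurable_snd)
    have hsplit : ∀ h : Hist K (t + 1), ENNReal.ofReal (√(2 * Real.log n) * sdSum σ₀ σ (t + 1) h)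
        = ENNReal.ofReal (√(2 * Real.log n) * sdSum σ₀ σ t (Fin.init h))
          + ENNReal.ofReal (√(2 * Real.log n) *
            √(tsVar σ₀ σ (Fin.init h : Hist K t) (h (Fin.last t)).1)) := fun h => by
      rw [sdSum, mul_add, ENNReal.ofReal_add (mul_nonneg (Real.sqrt_nonneg _)
        (sdSum_nonneg _ _ _ _)) (by positivity)]
    simp_rw [lintegral_regret_succ hσ₀ hσ n μ _ t, hsplit]
    simp_rw [fun θ => lintegral_interact_add σ (measurable_policy_right σ₀ σ n μ)
      (isProbabilityMeasure_policy hσ₀ hσ n μ) θ t hs (g := fun h a =>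
        ENNReal.ofReal (√(2 * Real.log n) * √(tsVar σ₀ σ h a)))
      fun a => ((measurable_tsVar σ₀ σ a).coe_nnreal_real.sqrt.const_mul _).ennreal_ofReal]
    rw [lintegral_add_left hm1, lintegral_add_left hm2]
    refine (add_le_add (ih (by omega)) (lintegral_round_le hσ₀ hσ hn μ (by omega))).trans_eq ?_
    push_cast
    ring

theorem lintegral_regret_add_le (hσ₀ : 0 < σ₀) (hσ : 0 < σ) (n : ℕ) (μ : Fin K → ℝ) (t k : ℕ) :
    ∫⁻ θ, ∫⁻ h, ENNReal.ofReal (regret θ h) ∂(interact σ (policy σ₀ σ n μ) θ (t + k)) ∂(gauss μ σ₀)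
      ≤ ∫⁻ θ, ∫⁻ h, ENNReal.ofReal (regret θ h) ∂(interact σ (policy σ₀ σ n μ) θ t) ∂(gauss μ σ₀)
        + k * ∫⁻ θ, width θ ∂(gauss μ σ₀) := by
  induction k with
  | zero => simp
  | succ k ih =>
    have hm1 : Measurable fun θ : Fin K → ℝ =>
        ∫⁻ h, ENNReal.ofReal (regret θ h) ∂(interact σ (policy σ₀ σ n μ) θ (t + k)) :=
      measurable_lintegral_interact_policy hσ₀ hσ n μ (t + k)
        (measurable_ofReal_regret measurable_fst measurable_snd)
    rw [← add_assoc]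
    simp_rw [lintegral_regret_succ hσ₀ hσ n μ _ (t + k)]
    rw [lintegral_add_left hm1]
    refine (add_le_add ih (lintegral_mono (g := width) fun θ => ?_)).trans_eq ?_
    · have hp1 := isProbabilityMeasure_interact_policy hσ₀ hσ n μ θ (t + k)
      have hp2 := isProbabilityMeasure_policy hσ₀ hσ n μ (t + k)
      calc _ ≤ ∫⁻ h, ∫⁻ _a, width θ ∂(policy σ₀ σ n μ (t + k) h)
            ∂(interact σ (policy σ₀ σ n μ) θ (t + k)) := by
            gcongr with h a
            exact le_iSup (fun a => ENNReal.ofReal (θ (argmax θ) - θ a)) a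
        _ = width θ := by simp
    · push_cast; ring

/-- The Bayes regret in a task of Thompson sampling with the correct prior. -/
theorem taskBayesRegret_self_le (hσ₀ : 0 < σ₀) (hσ : 0 < σ) {n : ℕ} (hKn : K ≤ n) (hn : 2 ≤ n)
    (μ : Fin K → ℝ) :
    taskBayesRegret σ₀ σ n μ μ ≤ ENNReal.ofReal (√(2 * Real.log n) *
        (2 * σ * (√K * (√(n + (σ : ℝ) ^ 2 / (σ₀ : ℝ) ^ 2 * K) - √((σ : ℝ) ^ 2 / (σ₀ : ℝ) ^ 2 * K)))
          + K * σ₀) + K * σ₀) + K * ∫⁻ θ, width θ ∂(gauss μ σ₀) := by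
  have h0 : (0 : ℝ) < σ₀ := hσ₀
  have hn' : (0 : ℝ) < n := by positivity
  obtain ⟨t, rfl⟩ : ∃ t, n = t + K := ⟨n - K, by omega⟩
  refine (lintegral_regret_add_le hσ₀ hσ (t + K) μ t K).trans (add_le_add_left ?_ _)
  refine (lintegral_regret_le_sdSum hσ₀ hσ hn μ le_rfl).trans ?_
  set D : ℝ := √(2 * Real.log (t + K : ℕ)) * (2 * σ * (√K *
    (√((t + K : ℕ) + (σ : ℝ) ^ 2 / (σ₀ : ℝ) ^ 2 * K) - √((σ : ℝ) ^ 2 / (σ₀ : ℝ) ^ 2 * K)))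
      + K * σ₀) with hD
  have hpath : ∀ h : Hist K t, √(2 * Real.log (t + K : ℕ)) * sdSum σ₀ σ t h ≤ D := by
    intro h
    refine mul_le_mul_of_nonneg_left ((sdSum_le hσ₀ hσ t h).trans ?_) (Real.sqrt_nonneg _)
    gcongr
    have : (0 : ℝ) ≤ K := by positivity
    linarith
  have hD0 : 0 ≤ D := (mul_nonneg (Real.sqrt_nonneg _) (sdSum_nonneg σ₀ σ t fun _ => (0, 0))).trans
    (hpath fun _ => (0, 0))
  rw [ENNReal.ofReal_add hD0 (by positivity)]
  refine add_le_add ?_ ?_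
  · calc _ ≤ ∫⁻ θ, ∫⁻ _h, ENNReal.ofReal D ∂(interact σ (policy σ₀ σ (t + K) μ) θ t)
          ∂(gauss μ σ₀) := by
          gcongr with θ h
          exact hpath h
      _ = ENNReal.ofReal D := by
          have := fun θ => isProbabilityMeasure_interact_policy hσ₀ hσ (t + K) μ θ t
          simp
  · rw [← ENNReal.ofReal_natCast, ← ENNReal.ofReal_mul (by positivity)]
    refine ENNReal.ofReal_le_ofReal ?_
    rw [mul_div_assoc', div_le_iff₀ hn', mul_comm]
    gcongr
    omega

end BayesRegret

/-! ### The law of the tasks -/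

section Tasks

variable {K n : ℕ}

theorem measurable_taskRecord_fields : Measurable fun r : TaskRecord K n =>
    (r.inst, r.sample, r.hist) := comap_measurable _

theorem measurable_taskRecord_inst : Measurable (TaskRecord.inst : TaskRecord K n → Fin K → ℝ) :=
  measurable_taskRecord_fields.fst

theorem measurable_taskRecord_sample :
    Measurable (TaskRecord.sample : TaskRecord K n → Fin K → ℝ) :=
  measurable_taskRecord_fields.snd.fst

theorem measurable_taskRecord_hist : Measurable (TaskRecord.hist : TaskRecord K n → Hist K n) :=
  measurable_taskRecord_fields.snd.snd

theorem measurable_taskRecord_mk {X : Type*} [MeasurableSpace X] {θ ν : X → Fin K → ℝ}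
    {h : X → Hist K n} (hθ : Measurable θ) (hν : Measurable ν) (hh : Measurable h) :
    Measurable fun x => (⟨θ x, ν x, h x⟩ : TaskRecord K n) :=
  measurable_comap_iff.2 (hθ.prodMk (hν.prodMk hh))

/-- The histories of the tasks. -/
def hists {s : ℕ} (ω : Fin s → TaskRecord K n) : Fin s → Hist K n := fun l => (ω l).hist

theorem measurable_hists {s : ℕ} : Measurable (hists : (Fin s → TaskRecord K n) → _) :=
  measurable_pi_iff.2 fun l => measurable_taskRecord_hist.comp (measurable_pi_apply l)

theorem measurable_snoc_record {s : ℕ} {X : Type*} [MeasurableSpace X]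
    {ω : X → Fin s → TaskRecord K n} {ν θ : X → Fin K → ℝ} {h : X → Hist K n}
    (hω : Measurable ω) (hν : Measurable ν) (hθ : Measurable θ) (hh : Measurable h) :
    Measurable fun x => (Fin.snoc (ω x) ⟨θ x, ν x, h x⟩ : Fin (s + 1) → TaskRecord K n) :=
  (measurable_snoc (A := TaskRecord K n)).comp (hω.prodMk (measurable_taskRecord_mk hθ hν hh))

theorem measurable_metaPosterior_hists {s : ℕ} (σq σ₀ σ : ℝ≥0) :
    Measurable fun ω : Fin s → TaskRecord K n => metaPosterior σq σ₀ σ (hists ω) :=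
  (measurable_metaPosterior σq σ₀ σ).comp measurable_hists

variable [NeZero K] {σq σ₀ σ : ℝ≥0}

/-- The law of the records of one more task, given the records `ω`, the meta-posterior sample `ν`
and the instance `θ`. -/
noncomputable def extendByHist (σ₀ σ : ℝ≥0) {s : ℕ} (ω : Fin s → TaskRecord K n)
    (ν θ : Fin K → ℝ) : Measure (Fin (s + 1) → TaskRecord K n) :=
  (interact σ (policy σ₀ σ n ν) θ n).map fun h =>
    (Fin.snoc ω ⟨θ, ν, h⟩ : Fin (s + 1) → TaskRecord K n)

/-- The law of the records of one more task, given the records `ω` and the meta-posterior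
sample `ν`. -/
noncomputable def extendByInst (σ₀ σ : ℝ≥0) {s : ℕ} (μ : Fin K → ℝ) (ω : Fin s → TaskRecord K n)
    (ν : Fin K → ℝ) : Measure (Fin (s + 1) → TaskRecord K n) :=
  (gauss μ σ₀).bind fun θ => extendByHist σ₀ σ ω ν θ

/-- The law of the records of one more task, given the records `ω`. -/
noncomputable def extendByTask (σq σ₀ σ : ℝ≥0) {s : ℕ} (μ : Fin K → ℝ)
    (ω : Fin s → TaskRecord K n) : Measure (Fin (s + 1) → TaskRecord K n) :=
  (metaPosterior σq σ₀ σ (hists ω)).bind fun ν => extendByInst σ₀ σ μ ω ν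

theorem tasksLaw_succ (μ : Fin K → ℝ) (s : ℕ) : tasksLaw σq σ₀ σ n μ (s + 1)
    = (tasksLaw σq σ₀ σ n μ s).bind fun ω => extendByTask σq σ₀ σ μ ω := rfl

theorem measurable_extendByHist (hσ₀ : 0 < σ₀) (hσ : 0 < σ) {s : ℕ} {X : Type*} [MeasurableSpace X]
    {ω : X → Fin s → TaskRecord K n} {ν θ : X → Fin K → ℝ}
    (hω : Measurable ω) (hν : Measurable ν) (hθ : Measurable θ) :
    Measurable fun x => extendByHist σ₀ σ (ω x) (ν x) (θ x) := by
  have h1 : Measurable fun x => interact σ (policy σ₀ σ n (ν x)) (θ x) n := by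
    have h := (measurable_interact_policy (σ₀ := σ₀) hσ n n).comp (hν.prodMk hθ)
    exact h
  have h2 : Measurable fun p : X × Hist K n =>
      (Fin.snoc (ω p.1) ⟨θ p.1, ν p.1, p.2⟩ : Fin (s + 1) → TaskRecord K n) :=
    measurable_snoc_record (hω.comp measurable_fst) (hν.comp measurable_fst)
      (hθ.comp measurable_fst) measurable_snd
  exact measurable_map_family h1
    (fun x => isProbabilityMeasure_interact_policy hσ₀ hσ n (ν x) (θ x) n) h2

theorem isProbabilityMeasure_extendByHist (hσ₀ : 0 < σ₀) (hσ : 0 < σ) {s : ℕ}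
    (ω : Fin s → TaskRecord K n) (ν θ : Fin K → ℝ) :
    IsProbabilityMeasure (extendByHist σ₀ σ ω ν θ) :=
  have := isProbabilityMeasure_interact_policy hσ₀ hσ n ν θ n
  Measure.isProbabilityMeasure_map
    (measurable_snoc_record measurable_const measurable_const measurable_const
      measurable_id').aemeasurable

theorem measurable_extendByInst (hσ₀ : 0 < σ₀) (hσ : 0 < σ) {s : ℕ} {X : Type*} [MeasurableSpace X]
    {ω : X → Fin s → TaskRecord K n} {μ ν : X → Fin K → ℝ}
    (hμ : Measurable μ) (hω : Measurable ω) (hν : Measurable ν) :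
    Measurable fun x => extendByInst σ₀ σ (μ x) (ω x) (ν x) := by
  have h : Measurable fun p : X × (Fin K → ℝ) => extendByHist σ₀ σ (ω p.1) (ν p.1) p.2 :=
    measurable_extendByHist hσ₀ hσ (hω.comp measurable_fst) (hν.comp measurable_fst) measurable_snd
  exact measurable_bind_family (κ := fun x => gauss (μ x) σ₀) ((measurable_gauss σ₀).comp hμ)
    (fun _ => inferInstance) h

theorem isProbabilityMeasure_extendByInst (hσ₀ : 0 < σ₀) (hσ : 0 < σ) {s : ℕ} (μ : Fin K → ℝ)
    (ω : Fin s → TaskRecord K n) (ν : Fin K → ℝ) :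
    IsProbabilityMeasure (extendByInst σ₀ σ μ ω ν) :=
  isProbabilityMeasure_bind
    (measurable_extendByHist hσ₀ hσ measurable_const measurable_const measurable_id')
    fun θ => isProbabilityMeasure_extendByHist hσ₀ hσ ω ν θ

theorem measurable_extendByTask (hσq : 0 < σq) (hσ₀ : 0 < σ₀) (hσ : 0 < σ) {s : ℕ} {X : Type*}
    [MeasurableSpace X] {ω : X → Fin s → TaskRecord K n} {μ : X → Fin K → ℝ}
    (hμ : Measurable μ) (hω : Measurable ω) :
    Measurable fun x => extendByTask σq σ₀ σ (μ x) (ω x) := by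
  have h : Measurable fun p : X × (Fin K → ℝ) => extendByInst σ₀ σ (μ p.1) (ω p.1) p.2 :=
    measurable_extendByInst hσ₀ hσ (hμ.comp measurable_fst) (hω.comp measurable_fst) measurable_snd
  have h1 : Measurable fun x => metaPosterior σq σ₀ σ (hists (ω x)) :=
    (measurable_metaPosterior σq σ₀ σ).comp (measurable_hists.comp hω)
  exact measurable_bind_family h1
    (fun _ => isProbabilityMeasure_metaPosterior hσq hσ₀ hσ _) h

theorem isProbabilityMeasure_extendByTask (hσq : 0 < σq) (hσ₀ : 0 < σ₀) (hσ : 0 < σ) {s : ℕ}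
    (μ : Fin K → ℝ) (ω : Fin s → TaskRecord K n) :
    IsProbabilityMeasure (extendByTask σq σ₀ σ μ ω) :=
  have := isProbabilityMeasure_metaPosterior hσq hσ₀ hσ (hists ω)
  isProbabilityMeasure_bind
    (measurable_extendByInst hσ₀ hσ measurable_const measurable_const measurable_id')
    fun ν => isProbabilityMeasure_extendByInst hσ₀ hσ μ ω ν

theorem isProbabilityMeasure_tasksLaw (hσq : 0 < σq) (hσ₀ : 0 < σ₀) (hσ : 0 < σ) (μ : Fin K → ℝ)
    (s : ℕ) : IsProbabilityMeasure (tasksLaw σq σ₀ σ n μ s) := by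
  induction s with
  | zero => rw [tasksLaw]; infer_instance
  | succ s ih =>
    rw [tasksLaw_succ]
    exact isProbabilityMeasure_bind
      (measurable_extendByTask hσq hσ₀ hσ measurable_const measurable_id')
      fun ω => isProbabilityMeasure_extendByTask hσq hσ₀ hσ μ ω

theorem measurable_tasksLaw (hσq : 0 < σq) (hσ₀ : 0 < σ₀) (hσ : 0 < σ) (s : ℕ) :
    Measurable fun μ : Fin K → ℝ => tasksLaw σq σ₀ σ n μ s := by
  induction s with
  | zero => simp only [tasksLaw]; exact measurable_const
  | succ s ih =>
    simp only [tasksLaw_succ]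
    have h : Measurable fun p : (Fin K → ℝ) × (Fin s → TaskRecord K n) =>
        extendByTask σq σ₀ σ p.1 p.2 :=
      measurable_extendByTask hσq hσ₀ hσ measurable_fst measurable_snd
    exact measurable_bind_family ih (fun μ => isProbabilityMeasure_tasksLaw hσq hσ₀ hσ μ s) h

theorem lintegral_tasksLaw_succ (hσq : 0 < σq) (hσ₀ : 0 < σ₀) (hσ : 0 < σ) (μ : Fin K → ℝ) (s : ℕ)
    {f : (Fin (s + 1) → TaskRecord K n) → ℝ≥0∞} (hf : Measurable f) :
    ∫⁻ ω, f ω ∂(tasksLaw σq σ₀ σ n μ (s + 1))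
      = ∫⁻ ω, ∫⁻ ν, ∫⁻ θ, ∫⁻ h, f (Fin.snoc ω ⟨θ, ν, h⟩) ∂(interact σ (policy σ₀ σ n ν) θ n)
        ∂(gauss μ σ₀) ∂(metaPosterior σq σ₀ σ (hists ω)) ∂(tasksLaw σq σ₀ σ n μ s) := by
  rw [tasksLaw_succ, Measure.lintegral_bind
    (measurable_extendByTask hσq hσ₀ hσ measurable_const measurable_id').aemeasurable
    hf.aemeasurable]
  refine lintegral_congr fun ω => ?_
  rw [extendByTask, Measure.lintegral_bind
    (measurable_extendByInst hσ₀ hσ measurable_const measurable_const measurable_id').aemeasurable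
    hf.aemeasurable]
  refine lintegral_congr fun ν => ?_
  rw [extendByInst, Measure.lintegral_bind
    (measurable_extendByHist hσ₀ hσ measurable_const measurable_const measurable_id').aemeasurable
    hf.aemeasurable]
  refine lintegral_congr fun θ => ?_
  rw [extendByHist, lintegral_map hf
    (measurable_snoc_record measurable_const measurable_const measurable_const measurable_id')]

/-- The conditional law, given the mean `μ` of the instance prior, of the meta-posterior sample in
the task that follows the first `s` tasks. -/
noncomputable def sampleLaw (σq σ₀ σ : ℝ≥0) (n : ℕ) (μ : Fin K → ℝ) (s : ℕ) :
    Measure (Fin K → ℝ) :=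
  (tasksLaw σq σ₀ σ n μ s).bind fun ω => metaPosterior σq σ₀ σ (hists ω)

theorem isProbabilityMeasure_sampleLaw (hσq : 0 < σq) (hσ₀ : 0 < σ₀) (hσ : 0 < σ) (μ : Fin K → ℝ)
    (s : ℕ) : IsProbabilityMeasure (sampleLaw σq σ₀ σ n μ s) :=
  have := isProbabilityMeasure_tasksLaw (n := n) hσq hσ₀ hσ μ s
  isProbabilityMeasure_bind (measurable_metaPosterior_hists σq σ₀ σ)
    fun _ => isProbabilityMeasure_metaPosterior hσq hσ₀ hσ _

theorem measurable_sampleLaw (hσq : 0 < σq) (hσ₀ : 0 < σ₀) (hσ : 0 < σ) (s : ℕ) :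
    Measurable fun μ : Fin K → ℝ => sampleLaw σq σ₀ σ n μ s := by
  have h : Measurable fun p : (Fin K → ℝ) × (Fin s → TaskRecord K n) =>
      metaPosterior σq σ₀ σ (hists p.2) :=
    (measurable_metaPosterior_hists σq σ₀ σ).comp measurable_snd
  exact measurable_bind_family (measurable_tasksLaw hσq hσ₀ hσ s)
    (fun μ => isProbabilityMeasure_tasksLaw hσq hσ₀ hσ μ s) h

/-- The law of the record of a single task. -/
theorem lintegral_tasksLaw_eval (hσq : 0 < σq) (hσ₀ : 0 < σ₀) (hσ : 0 < σ) (μ : Fin K → ℝ) {m : ℕ}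
    (s : Fin m) {F : TaskRecord K n → ℝ≥0∞} (hF : Measurable F) :
    ∫⁻ ω, F (ω s) ∂(tasksLaw σq σ₀ σ n μ m)
      = ∫⁻ ν, ∫⁻ θ, ∫⁻ h, F ⟨θ, ν, h⟩ ∂(interact σ (policy σ₀ σ n ν) θ n)
        ∂(gauss μ σ₀) ∂(sampleLaw σq σ₀ σ n μ s) := by
  induction m with
  | zero => exact s.elim0
  | succ m ih =>
    rw [lintegral_tasksLaw_succ hσq hσ₀ hσ μ m (f := fun ω => F (ω s))
      (hF.comp (measurable_pi_apply s))]
    refine Fin.lastCases ?_ (fun i => ?_) s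
    · simp only [Fin.snoc_last, Fin.val_last]
      have h1 : Measurable fun p : (Fin K → ℝ) × (Fin K → ℝ) =>
          interact σ (policy σ₀ σ n p.1) p.2 n := measurable_interact_policy hσ n n
      have h2 : Measurable fun p : ((Fin K → ℝ) × (Fin K → ℝ)) × Hist K n =>
          F ⟨p.1.2, p.1.1, p.2⟩ :=
        hF.comp (measurable_taskRecord_mk measurable_fst.snd measurable_fst.fst measurable_snd)
      have h3 : Measurable fun p : (Fin K → ℝ) × (Fin K → ℝ) =>
          ∫⁻ h, F ⟨p.2, p.1, h⟩ ∂(interact σ (policy σ₀ σ n p.1) p.2 n) :=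
        measurable_lintegral_family h1
          (fun p => isProbabilityMeasure_interact_policy hσ₀ hσ n p.1 p.2 n) h2
      have h4 : Measurable fun ν : Fin K → ℝ => ∫⁻ θ, ∫⁻ h, F ⟨θ, ν, h⟩
          ∂(interact σ (policy σ₀ σ n ν) θ n) ∂(gauss μ σ₀) := h3.lintegral_prod_right'
      rw [sampleLaw, Measure.lintegral_bind (measurable_metaPosterior_hists σq σ₀ σ).aemeasurable
        h4.aemeasurable]
    · simp only [Fin.snoc_castSucc, Fin.val_castSucc]
      rw [← ih i]
      refine lintegral_congr fun ω => ?_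
      have h1 := fun ν θ => isProbabilityMeasure_interact_policy (K := K) hσ₀ hσ n ν θ n
      have h2 := isProbabilityMeasure_metaPosterior hσq hσ₀ hσ (hists ω)
      simp

theorem bayesRegret_eq (hσq : 0 < σq) (hσ₀ : 0 < σ₀) (hσ : 0 < σ) (m : ℕ) (μ : Fin K → ℝ) :
    bayesRegret σq σ₀ σ m n μ
      = ∑ s : Fin m, ∫⁻ ν, taskBayesRegret σ₀ σ n μ ν ∂(sampleLaw σq σ₀ σ n μ s) := by
  have hF : Measurable fun r : TaskRecord K n => ENNReal.ofReal (regret r.inst r.hist) :=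
    measurable_ofReal_regret measurable_taskRecord_inst measurable_taskRecord_hist
  exact Finset.sum_congr rfl fun s _ => lintegral_tasksLaw_eval hσq hσ₀ hσ μ s hF

theorem lintegral_jointLaw (hσq : 0 < σq) (hσ₀ : 0 < σ₀) (hσ : 0 < σ) (m : ℕ)
    {f : (Fin K → ℝ) × (Fin m → TaskRecord K n) → ℝ≥0∞} (hf : Measurable f) :
    ∫⁻ x, f x ∂(jointLaw σq σ₀ σ K m n)
      = ∫⁻ μ, ∫⁻ ω, f (μ, ω) ∂(tasksLaw σq σ₀ σ n μ m) ∂(gauss 0 σq) := by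
  have h1 : Measurable fun μ : Fin K → ℝ => (tasksLaw σq σ₀ σ n μ m).map fun ω => (μ, ω) :=
    measurable_map_family (measurable_tasksLaw hσq hσ₀ hσ m)
      (fun μ => isProbabilityMeasure_tasksLaw hσq hσ₀ hσ μ m) measurable_id
  rw [jointLaw, Measure.lintegral_bind h1.aemeasurable hf.aemeasurable]
  exact lintegral_congr fun μ => lintegral_map hf measurable_prodMk_left

theorem isProbabilityMeasure_jointLaw (hσq : 0 < σq) (hσ₀ : 0 < σ₀) (hσ : 0 < σ) (m : ℕ) :
    IsProbabilityMeasure (jointLaw σq σ₀ σ K m n) := by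
  refine ⟨?_⟩
  have h1 := fun μ => isProbabilityMeasure_tasksLaw (K := K) (n := n) hσq hσ₀ hσ μ m
  rw [← lintegral_one, lintegral_jointLaw hσq hσ₀ hσ m measurable_const]
  simp

theorem lintegral_jointLaw_fst (hσq : 0 < σq) (hσ₀ : 0 < σ₀) (hσ : 0 < σ) (m : ℕ)
    {f : (Fin K → ℝ) → ℝ≥0∞} (hf : Measurable f) :
    ∫⁻ x, f x.1 ∂(jointLaw σq σ₀ σ K m n) = ∫⁻ μ, f μ ∂(gauss 0 σq) := by
  have h1 := fun μ => isProbabilityMeasure_tasksLaw (K := K) (n := n) hσq hσ₀ hσ μ m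
  rw [lintegral_jointLaw hσq hσ₀ hσ m (f := fun x => f x.1) (hf.comp measurable_fst)]
  simp

theorem lintegral_jointLaw_sample (hσq : 0 < σq) (hσ₀ : 0 < σ₀) (hσ : 0 < σ) {m : ℕ} (s : Fin m)
    {f : (Fin K → ℝ) → (Fin K → ℝ) → ℝ≥0∞} (hf : Measurable (Function.uncurry f)) :
    ∫⁻ x, f x.1 (x.2 s).sample ∂(jointLaw σq σ₀ σ K m n)
      = ∫⁻ μ, ∫⁻ ν, f μ ν ∂(sampleLaw σq σ₀ σ n μ s) ∂(gauss 0 σq) := by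
  rw [lintegral_jointLaw hσq hσ₀ hσ m (f := fun x => f x.1 (x.2 s).sample)
    (hf.comp (measurable_fst.prodMk (measurable_taskRecord_sample.comp
      ((measurable_pi_apply s).comp measurable_snd))))]
  refine lintegral_congr fun μ => ?_
  have hfμ : Measurable (f μ) := hf.comp measurable_prodMk_left
  rw [lintegral_tasksLaw_eval hσq hσ₀ hσ μ s (F := fun r => f μ r.sample)
    (hfμ.comp measurable_taskRecord_sample)]
  have h1 := fun ν θ => isProbabilityMeasure_interact_policy (K := K) hσ₀ hσ n ν θ n
  simp

/-- Given the mean `μ` of the instance prior, the law of the histories of the tasks has a density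
with respect to a measure that does not depend on `μ`, and the density is the likelihood that
defines the meta-posterior. Every arm is pulled in every task. -/
theorem exists_lintegral_hists (hσq : 0 < σq) (hσ₀ : 0 < σ₀) (hσ : 0 < σ) (hKn : K ≤ n) (s : ℕ) :
    ∃ ρ : Measure (Fin s → Hist K n), SFinite ρ ∧ (∀ᵐ H ∂ρ, ∀ l i, ∃ j, (H l j).1 = i) ∧
      ∀ (μ : Fin K → ℝ) (f : (Fin s → Hist K n) → ℝ≥0∞), Measurable f →
        ∫⁻ ω, f (hists ω) ∂(tasksLaw σq σ₀ σ n μ s)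
          = ∫⁻ H, (∏ l, margLik σ₀ σ (H l) μ) * f H ∂ρ := by
  induction s with
  | zero =>
    refine ⟨Measure.dirac Fin.elim0, inferInstance, ae_of_all _ fun H l => l.elim0,
      fun μ f hf => ?_⟩
    have hf' : Measurable fun ω : Fin 0 → TaskRecord K n => f (hists ω) :=
      hf.comp measurable_hists
    rw [tasksLaw, lintegral_dirac' _ hf']
    simp only [Finset.univ_eq_empty, Finset.prod_empty, one_mul]
    rw [lintegral_dirac' _ hf]
    congr 1
    exact Subsingleton.elim _ _
  | succ s ih =>
    obtain ⟨ρ, hρ, hexp, hint⟩ := ih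
    -- the policy's share of the density of the next history, averaged over the meta-posterior
    -- sample; the meta-posterior depends on the earlier histories only, not on `μ`
    set w : (Fin s → Hist K n) × Hist K n → ℝ≥0∞ := fun p =>
      ∫⁻ ν, policyWeight (policy σ₀ σ n ν) n p.2 ∂(metaPosterior σq σ₀ σ p.1) with hw
    have hpw : Measurable fun p : (Fin K → ℝ) × Hist K n =>
        policyWeight (policy σ₀ σ n p.1) n p.2 :=
      measurable_policyWeight_family (π := fun ν => policy σ₀ σ n ν)
        (fun t => measurable_policy σ₀ σ n t) n
    have hwm : Measurable w := by
      have h1 : Measurable fun p : (Fin s → Hist K n) × Hist K n => metaPosterior σq σ₀ σ p.1 :=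
        (measurable_metaPosterior σq σ₀ σ).comp measurable_fst
      have h2 : Measurable fun q : ((Fin s → Hist K n) × Hist K n) × (Fin K → ℝ) =>
          policyWeight (policy σ₀ σ n q.2) n q.1.2 := by
        have h3 := hpw.comp (measurable_snd.prodMk measurable_fst.snd :
          Measurable fun q : ((Fin s → Hist K n) × Hist K n) × (Fin K → ℝ) => (q.2, q.1.2))
        exact h3
      exact measurable_lintegral_family h1
        (f := fun p ν => policyWeight (policy σ₀ σ n ν) n p.2)
        (fun p => isProbabilityMeasure_metaPosterior hσq hσ₀ hσ p.1) h2
    have hsnoc : Measurable fun p : (Fin s → Hist K n) × Hist K n =>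
        (Fin.snoc p.1 p.2 : Fin (s + 1) → Hist K n) := measurable_snoc
    refine ⟨((ρ.prod (refMeasure K n)).withDensity w).map fun p => Fin.snoc p.1 p.2,
      inferInstance, ?_, fun μ f hf => ?_⟩
    · have hset : MeasurableSet {H : Fin (s + 1) → Hist K n | ∀ l i, ∃ j, (H l j).1 = i} := by
        have h1 : ∀ l i, MeasurableSet {H : Fin (s + 1) → Hist K n | ∃ j, (H l j).1 = i} := by
          intro l i
          have h2 : {H : Fin (s + 1) → Hist K n | ∃ j, (H l j).1 = i}
              = ⋃ j, (fun H : Fin (s + 1) → Hist K n => (H l j).1) ⁻¹' {i} := by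
            ext H; simp
          rw [h2]
          refine MeasurableSet.iUnion fun j => ?_
          have h3 : Measurable fun H : Fin (s + 1) → Hist K n => (H l j).1 :=
            ((measurable_pi_apply j).comp (measurable_pi_apply l)).fst
          exact h3 (measurableSet_singleton i)
        have h2 : {H : Fin (s + 1) → Hist K n | ∀ l i, ∃ j, (H l j).1 = i}
            = ⋂ l, ⋂ i, {H : Fin (s + 1) → Hist K n | ∃ j, (H l j).1 = i} := by
          ext H; simp
        rw [h2]
        exact MeasurableSet.iInter fun l => MeasurableSet.iInter fun i => h1 l i
      rw [ae_map_iff hsnoc.aemeasurable hset, ae_withDensity_iff hwm]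
      have hfst : ∀ᵐ p ∂(ρ.prod (refMeasure K n)), ∀ l i, ∃ j, (p.1 l j).1 = i :=
        Measure.quasiMeasurePreserving_fst.ae hexp
      filter_upwards [hfst] with p hp hwp l
      refine Fin.lastCases (fun i => ?_) (fun l i => ?_) l
      · have : ∃ ν, policyWeight (policy σ₀ σ n ν) n p.2 ≠ 0 := by
          by_contra hcon
          push Not at hcon
          exact hwp (by simp [hw, hcon])
        obtain ⟨ν, hν⟩ := this
        simpa using exists_pulled_of_policyWeight_ne_zero hKn hν i
      · simpa using hp l i
    · have hfs : Measurable fun p : (Fin s → Hist K n) × Hist K n =>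
          f (Fin.snoc p.1 p.2) := hf.comp hsnoc
      have hmf : Measurable fun p : (Fin s → Hist K n) × Hist K n =>
          w p * (margLik σ₀ σ p.2 μ * f (Fin.snoc p.1 p.2)) :=
        hwm.mul ((measurable_margLik σ₀ σ measurable_snd measurable_const).mul hfs)
      set G : (Fin s → Hist K n) → ℝ≥0∞ := fun H =>
        ∫⁻ h, w (H, h) * (margLik σ₀ σ h μ * f (Fin.snoc H h)) ∂(refMeasure K n) with hG
      have hGm : Measurable G := hmf.lintegral_prod_right'
      have hleft : ∫⁻ ω, f (hists ω) ∂(tasksLaw σq σ₀ σ n μ (s + 1))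
          = ∫⁻ ω, G (hists ω) ∂(tasksLaw σq σ₀ σ n μ s) := by
        have hf' : Measurable fun ω : Fin (s + 1) → TaskRecord K n => f (hists ω) :=
          hf.comp measurable_hists
        rw [lintegral_tasksLaw_succ hσq hσ₀ hσ μ s hf']
        refine lintegral_congr fun ω => ?_
        have hh : ∀ θ ν (h : Hist K n), hists (Fin.snoc ω ⟨θ, ν, h⟩ : Fin (s + 1) → TaskRecord K n)
            = Fin.snoc (hists ω) h := by
          intro θ ν h
          funext l
          refine Fin.lastCases ?_ (fun l => ?_) l <;> simp [hists]
        simp_rw [hh]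
        have hfω : Measurable fun h : Hist K n => f (Fin.snoc (hists ω) h) :=
          hfs.comp measurable_prodMk_left
        have hprob := isProbabilityMeasure_metaPosterior hσq hσ₀ hσ (hists ω)
        calc _ = ∫⁻ ν, ∫⁻ h, policyWeight (policy σ₀ σ n ν) n h *
              (margLik σ₀ σ h μ * f (Fin.snoc (hists ω) h)) ∂(refMeasure K n)
              ∂(metaPosterior σq σ₀ σ (hists ω)) := by
              refine lintegral_congr fun ν => ?_
              rw [lintegral_interact_eq_bayes hσ₀ hσ (measurable_policy_right σ₀ σ n ν) μ n
                (F := fun _ h => f (Fin.snoc (hists ω) h)) (hfω.comp measurable_snd)]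
              refine lintegral_congr fun h => ?_
              have := isProbabilityMeasure_bayes_lik hσ₀ hσ μ h
              simp
          _ = ∫⁻ h, ∫⁻ ν, policyWeight (policy σ₀ σ n ν) n h *
              (margLik σ₀ σ h μ * f (Fin.snoc (hists ω) h))
              ∂(metaPosterior σq σ₀ σ (hists ω)) ∂(refMeasure K n) := by
              have hm : Measurable fun p : (Fin K → ℝ) × Hist K n =>
                  policyWeight (policy σ₀ σ n p.1) n p.2 *
                    (margLik σ₀ σ p.2 μ * f (Fin.snoc (hists ω) p.2)) :=
                hpw.mul ((measurable_margLik σ₀ σ measurable_snd measurable_const).mul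
                  (hfω.comp measurable_snd))
              exact lintegral_lintegral_swap hm.aemeasurable
          _ = G (hists ω) := by
              refine lintegral_congr fun h => ?_
              have hm : Measurable fun ν => policyWeight (policy σ₀ σ n ν) n h := by
                have h3 := hpw.comp (measurable_prodMk_right (y := h))
                exact h3
              rw [lintegral_mul_const _ hm]
      have hprodm : Measurable fun p : (Fin s → Hist K n) × Hist K n =>
          (∏ l, margLik σ₀ σ ((Fin.snoc p.1 p.2 : Fin (s + 1) → Hist K n) l) μ) *
            f (Fin.snoc p.1 p.2) :=
        (measurable_prod_margLik σ₀ σ hsnoc measurable_const).mul hfs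
      have hprodm' : Measurable fun H : Fin (s + 1) → Hist K n =>
          (∏ l, margLik σ₀ σ (H l) μ) * f H :=
        (measurable_prod_margLik σ₀ σ measurable_id' measurable_const).mul hf
      rw [hleft, hint μ G hGm, lintegral_map hprodm' hsnoc,
        lintegral_withDensity_eq_lintegral_mul _ hwm hprodm,
        lintegral_prod _ (hwm.mul hprodm).aemeasurable]
      refine lintegral_congr fun H => ?_
      have hmH : Measurable fun h => w (H, h) * (margLik σ₀ σ h μ * f (Fin.snoc H h)) :=
        hmf.comp measurable_prodMk_left
      rw [hG, ← lintegral_const_mul _ hmH]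
      refine lintegral_congr fun h => ?_
      simp only [Pi.mul_apply, Fin.prod_univ_castSucc, Fin.snoc_castSucc, Fin.snoc_last]
      ring

end Tasks

/-! ### Concentration of the meta-posterior samples -/

section Concentration

variable {K n : ℕ} {σq σ₀ σ : ℝ≥0}

/-- An exponential function of the squared distance, in the sup norm, of the mean `μ` of the
instance prior and of the meta-posterior sample `ν`. The scale `(σ₀² + σ²) / s` bounds the
variances of the meta-posterior after `s` tasks. -/
noncomputable def sampleError (σ₀ σ : ℝ≥0) (s : ℕ) (μ ν : Fin K → ℝ) : ℝ≥0∞ :=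
  ENNReal.ofReal (Real.exp (‖μ - ν‖ ^ 2 / (8 * (((σ₀ : ℝ) ^ 2 + (σ : ℝ) ^ 2) / s))))

theorem measurable_sampleError {X : Type*} [MeasurableSpace X] (σ₀ σ : ℝ≥0) (s : ℕ)
    {μ ν : X → Fin K → ℝ} (hμ : Measurable μ) (hν : Measurable ν) :
    Measurable fun x => sampleError σ₀ σ s (μ x) (ν x) := by
  unfold sampleError
  fun_prop

/-- An upper bound on `‖μ - ν‖` that holds when `sampleError σ₀ σ s μ ν ≤ T`. It is meaningful for
`0 < s` only. -/
noncomputable def errorBound (σ₀ σ : ℝ≥0) (s : ℕ) (T : ℝ) : ℝ :=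
  √(8 * (((σ₀ : ℝ) ^ 2 + (σ : ℝ) ^ 2) / s) * Real.log T)

theorem norm_le_errorBound (hσ₀ : 0 < σ₀) {s : ℕ} (hs : 0 < s) {T : ℝ} (hT : 1 < T)
    {μ ν : Fin K → ℝ} (h : sampleError σ₀ σ s μ ν ≤ ENNReal.ofReal T) :
    ‖μ - ν‖ ≤ errorBound σ₀ σ s T := by
  have hs' : (0 : ℝ) < s := by exact_mod_cast hs
  have h0 : (0 : ℝ) < σ₀ := hσ₀
  rw [sampleError, ENNReal.ofReal_le_ofReal_iff (by linarith), ← Real.le_log_iff_exp_le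
    (by linarith), div_le_iff₀ (by positivity)] at h
  exact Real.le_sqrt_of_sq_le (by linarith)

/-- Jensen's inequality for the convex function in `sampleError`, in the form of a tangent line. -/
theorem lintegral_norm_le_errorBound (hσ₀ : 0 < σ₀) {s : ℕ} (hs : 0 < s) {T : ℝ} (hT : 1 < T)
    {μ : Fin K → ℝ} {q : Measure (Fin K → ℝ)} [IsProbabilityMeasure q]
    (h : ∫⁻ ν, sampleError σ₀ σ s μ ν ∂q ≤ ENNReal.ofReal T) :
    ∫⁻ ν, ENNReal.ofReal ‖μ - ν‖ ∂q ≤ ENNReal.ofReal (errorBound σ₀ σ s T) := by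
  have hs' : (0 : ℝ) < s := by exact_mod_cast hs
  have h0 : (0 : ℝ) < σ₀ := hσ₀
  have hlog := Real.log_pos hT
  set V : ℝ := 8 * (((σ₀ : ℝ) ^ 2 + (σ : ℝ) ^ 2) / s) with hV
  have hV0 : 0 < V := by positivity
  set a := errorBound σ₀ σ s T with ha
  have ha0 : 0 < a := Real.sqrt_pos.2 (by positivity)
  have ha2 : a ^ 2 = V * Real.log T := Real.sq_sqrt (by positivity)
  have hT0 : 0 < T := by linarith
  set D : ℝ := V / (2 * a) with hD
  have hD0 : 0 < D := by positivity
  have hpt : ∀ ν, ENNReal.ofReal ‖μ - ν‖ + ENNReal.ofReal D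
      ≤ ENNReal.ofReal a + ENNReal.ofReal (D / T) * sampleError σ₀ σ s μ ν := by
    intro ν
    rw [sampleError, ← hV, ← ENNReal.ofReal_mul (by positivity),
      ← ENNReal.ofReal_add (norm_nonneg _) hD0.le, ← ENNReal.ofReal_add ha0.le (by positivity)]
    refine ENNReal.ofReal_le_ofReal ?_
    set x := ‖μ - ν‖
    have h1 : Real.exp (x ^ 2 / V) = T * Real.exp ((x ^ 2 - a ^ 2) / V) := by
      rw [ha2]
      conv_rhs => rw [← Real.exp_log hT0, Real.log_exp, ← Real.exp_add]
      congr 1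
      field_simp
      ring
    have h2 := Real.add_one_le_exp ((x ^ 2 - a ^ 2) / V)
    have h3 : 2 * a * (x - a) / V ≤ (x ^ 2 - a ^ 2) / V := by
      gcongr; nlinarith [sq_nonneg (x - a)]
    rw [h1, show D / T * (T * Real.exp ((x ^ 2 - a ^ 2) / V))
      = D * Real.exp ((x ^ 2 - a ^ 2) / V) by field_simp]
    have h4 : D * (2 * a * (x - a) / V + 1) ≤ D * Real.exp ((x ^ 2 - a ^ 2) / V) := by
      gcongr; linarith
    have h5 : D * (2 * a * (x - a) / V + 1) = x - a + D := by
      rw [hD]; field_simp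
    linarith
  have hψμ : Measurable (sampleError σ₀ σ s μ) :=
    measurable_sampleError σ₀ σ s measurable_const measurable_id'
  have hint := lintegral_mono (μ := q) hpt
  rw [lintegral_add_right _ measurable_const, lintegral_const, measure_univ, mul_one,
    lintegral_add_left measurable_const, lintegral_const, measure_univ, mul_one,
    lintegral_const_mul _ hψμ] at hint
  have hle : ENNReal.ofReal (D / T) * ∫⁻ ν, sampleError σ₀ σ s μ ν ∂q ≤ ENNReal.ofReal D := by
    refine (mul_le_mul_right h _).trans_eq ?_
    rw [← ENNReal.ofReal_mul (by positivity), div_mul_cancel₀ _ hT0.ne']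
  exact (ENNReal.add_le_add_iff_right ENNReal.ofReal_ne_top).1
    (hint.trans (add_le_add_right hle _))

variable [NeZero K]

/-- For two independent vectors with the same Gaussian law with small variances, the squared
distance has an exponential moment: `(x - y)² ≤ 2 (x - m)² + 2 (y - m)²` decouples the two. -/
theorem lintegral_exp_norm_sub_sq_le {m : Fin K → ℝ} {v : Fin K → ℝ≥0} (hv : ∀ i, 0 < v i) {V : ℝ}
    (hV : ∀ i, v i ≤ V) {Q : Measure (Fin K → ℝ)}
    (hQ : Q = Measure.pi fun i => gaussianReal (m i) (v i)) :
    ∫⁻ x, ∫⁻ y, ENNReal.ofReal (Real.exp (‖x - y‖ ^ 2 / (8 * V))) ∂Q ∂Q ≤ 2 * K := by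
  have hV0 : 0 < V := lt_of_lt_of_le (NNReal.coe_pos.2 (hv 0)) (hV 0)
  set e : Fin K → (Fin K → ℝ) → ℝ≥0∞ := fun i x =>
    ENNReal.ofReal (Real.exp ((x i - m i) ^ 2 / (4 * V))) with he
  have hem : ∀ i, Measurable (e i) := fun i => by simp only [he]; fun_prop
  have hei : ∀ i, ∫⁻ x, e i x ∂Q ≤ ENNReal.ofReal √2 := fun i => by
    have hf : Measurable fun x : ℝ => ENNReal.ofReal (Real.exp ((x - m i) ^ 2 / (4 * V))) := by
      fun_prop
    rw [hQ]
    exact ((measurePreserving_eval (fun i => gaussianReal (m i) (v i)) i).lintegral_comp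
      hf).trans_le (lintegral_exp_sq_gaussianReal_le (hv i) (m i) (hV i))
  have hpt : ∀ x y, ENNReal.ofReal (Real.exp (‖x - y‖ ^ 2 / (8 * V))) ≤ ∑ i, e i x * e i y := by
    intro x y
    obtain ⟨i, hi⟩ : ∃ i, ‖(x - y) i‖ = ‖x - y‖ := by
      obtain ⟨i, hi⟩ := Finite.exists_max fun i => ‖(x - y) i‖
      exact ⟨i, le_antisymm (norm_le_pi_norm _ i)
        ((pi_norm_le_iff_of_nonneg (norm_nonneg _)).2 hi)⟩
    refine le_trans ?_ (Finset.single_le_sum (f := fun i => e i x * e i y)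
      (fun i _ => zero_le) (Finset.mem_univ i))
    rw [he, ← ENNReal.ofReal_mul (Real.exp_pos _).le, ← Real.exp_add, ← hi, Real.norm_eq_abs,
      sq_abs, Pi.sub_apply]
    refine ENNReal.ofReal_le_ofReal (Real.exp_le_exp.2 ?_)
    rw [← add_div, div_le_div_iff₀ (by positivity) (by positivity)]
    nlinarith [sq_nonneg ((x i - m i) + (y i - m i))]
  calc ∫⁻ x, ∫⁻ y, ENNReal.ofReal (Real.exp (‖x - y‖ ^ 2 / (8 * V))) ∂Q ∂Q
      ≤ ∫⁻ x, ∫⁻ y, ∑ i, e i x * e i y ∂Q ∂Q := by gcongr with x y; exact hpt x y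
    _ = ∑ i, (∫⁻ x, e i x ∂Q) * ∫⁻ y, e i y ∂Q := by
        have h1 : ∀ x, ∫⁻ y, ∑ i, e i x * e i y ∂Q = ∑ i, e i x * ∫⁻ y, e i y ∂Q := fun x => by
          rw [lintegral_finsetSum _ fun i _ => (hem i).const_mul _]
          exact Finset.sum_congr rfl fun i _ => lintegral_const_mul _ (hem i)
        simp_rw [h1]
        rw [lintegral_finsetSum _ fun i _ => (hem i).mul_const _]
        exact Finset.sum_congr rfl fun i _ => lintegral_mul_const _ (hem i)
    _ ≤ ∑ _i : Fin K, ENNReal.ofReal √2 * ENNReal.ofReal √2 := by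
        gcongr with i <;> exact hei i
    _ = 2 * K := by
        rw [← ENNReal.ofReal_mul (by positivity), Real.mul_self_sqrt (by norm_num)]
        simp [mul_comm]

/-- The exponential moment of the sampling error is small because, given the histories, the mean of
the instance prior and the meta-posterior sample are independent with the same law, the
meta-posterior. -/
theorem lintegral_sampleError_le (hσq : 0 < σq) (hσ₀ : 0 < σ₀) (hσ : 0 < σ) (hKn : K ≤ n) {s : ℕ}
    (hs : 0 < s) :
    ∫⁻ μ, ∫⁻ ν, sampleError σ₀ σ s μ ν ∂(sampleLaw σq σ₀ σ n μ s) ∂(gauss (0 : Fin K → ℝ) σq)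
      ≤ 2 * K := by
  have hs' : (0 : ℝ) < s := by exact_mod_cast hs
  obtain ⟨ρ, hρ, hexp, hint⟩ := exists_lintegral_hists (n := n) hσq hσ₀ hσ hKn s
  set Φ : (Fin K → ℝ) → (Fin s → Hist K n) → ℝ≥0∞ := fun μ H =>
    ∫⁻ ν, sampleError σ₀ σ s μ ν ∂(metaPosterior σq σ₀ σ H) with hΦ
  have hΦm : Measurable (Function.uncurry Φ) := by
    have h1 : Measurable fun p : (Fin K → ℝ) × (Fin s → Hist K n) => metaPosterior σq σ₀ σ p.2 :=
      (measurable_metaPosterior σq σ₀ σ).comp measurable_snd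
    have h2 : Measurable fun q : ((Fin K → ℝ) × (Fin s → Hist K n)) × (Fin K → ℝ) =>
        sampleError σ₀ σ s q.1.1 q.2 :=
      measurable_sampleError σ₀ σ s measurable_fst.fst measurable_snd
    exact measurable_lintegral_family h1
      (fun p => isProbabilityMeasure_metaPosterior hσq hσ₀ hσ p.2) h2
  set L : (Fin s → Hist K n) → (Fin K → ℝ) → ℝ≥0∞ := fun H μ =>
    ∏ l, margLik σ₀ σ (H l) μ with hL
  have hLm : Measurable fun p : (Fin K → ℝ) × (Fin s → Hist K n) => L p.2 p.1 :=
    measurable_prod_margLik σ₀ σ measurable_snd measurable_fst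
  have hswap : ∀ f : (Fin K → ℝ) → (Fin s → Hist K n) → ℝ≥0∞, Measurable (Function.uncurry f) →
      ∫⁻ μ, ∫⁻ ω, f μ (hists ω) ∂(tasksLaw σq σ₀ σ n μ s) ∂(gauss (0 : Fin K → ℝ) σq)
        = ∫⁻ H, (∫⁻ μ, L H μ ∂(gauss (0 : Fin K → ℝ) σq)) *
            ∫⁻ μ, f μ H ∂(metaPosterior σq σ₀ σ H) ∂ρ := by
    intro f hf
    have hfμ : ∀ μ, Measurable (f μ) := fun μ => hf.comp measurable_prodMk_left
    have hLf : Measurable fun p : (Fin K → ℝ) × (Fin s → Hist K n) => L p.2 p.1 * f p.1 p.2 :=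
      hLm.mul hf
    simp_rw [fun μ => hint μ (f μ) (hfμ μ)]
    rw [lintegral_lintegral_swap hLf.aemeasurable]
    refine lintegral_congr fun H => ?_
    obtain ⟨c, hc0, hc, b, hb⟩ := exists_prod_margLik_eq hσ₀ hσ H
    have hLH : Measurable (L H) :=
      measurable_prod_margLik σ₀ σ measurable_const measurable_id'
    have hZ : ∫⁻ μ, L H μ ∂(gauss (0 : Fin K → ℝ) σq) ≠ 0
        ∧ ∫⁻ μ, L H μ ∂(gauss (0 : Fin K → ℝ) σq) ≠ ∞ := by
      simp only [hL, hb]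
      rw [lintegral_const_mul _ (measurable_quadLik _ _), lintegral_quadLik hσq]
      refine ⟨mul_ne_zero hc0 (Finset.prod_ne_zero_iff.2 fun i _ => ?_),
        ENNReal.mul_ne_top hc (ENNReal.prod_ne_top fun i _ => ENNReal.ofReal_ne_top)⟩
      simpa using evidence_pos (by positivity) _ _ _
    have hfH : Measurable fun μ => f μ H := hf.comp measurable_prodMk_right
    exact lintegral_mul_eq_bayes hLH hZ.1 hZ.2 hfH
  -- the constant function `1` shows that the evidence is a probability density of `ρ`
  have hone : ∫⁻ H, ∫⁻ μ, L H μ ∂(gauss (0 : Fin K → ℝ) σq) ∂ρ = 1 := by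
    have h1 := hswap (fun _ _ => 1) measurable_const
    have h2 := fun μ => isProbabilityMeasure_tasksLaw (K := K) (n := n) hσq hσ₀ hσ μ s
    have h3 := fun H : Fin s → Hist K n => isProbabilityMeasure_metaPosterior hσq hσ₀ hσ H
    simpa using h1.symm
  have hsample : ∀ μ, ∫⁻ ν, sampleError σ₀ σ s μ ν ∂(sampleLaw σq σ₀ σ n μ s)
      = ∫⁻ ω, Φ μ (hists ω) ∂(tasksLaw σq σ₀ σ n μ s) := fun μ => by
    have hψμ : Measurable (sampleError σ₀ σ s μ) :=
      measurable_sampleError σ₀ σ s measurable_const measurable_id'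
    rw [sampleLaw, Measure.lintegral_bind (measurable_metaPosterior_hists σq σ₀ σ).aemeasurable
      hψμ.aemeasurable]
  simp_rw [hsample]
  rw [hswap Φ hΦm]
  have hLZ : Measurable fun H => ∫⁻ μ, L H μ ∂(gauss (0 : Fin K → ℝ) σq) :=
    hLm.lintegral_prod_left'
  calc _ ≤ ∫⁻ H, (∫⁻ μ, L H μ ∂(gauss (0 : Fin K → ℝ) σq)) * (2 * K) ∂ρ := by
        refine lintegral_mono_ae ?_
        filter_upwards [hexp] with H hH
        refine mul_le_mul_right ?_ _
        obtain ⟨m, v, hQ, hv, hvle⟩ := exists_metaPosterior_eq hσq hσ₀ hσ H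
        refine lintegral_exp_norm_sub_sq_le hv (fun i => ?_) hQ
        rw [le_div_iff₀ hs']
        exact hvle hH i
    _ = 2 * K := by rw [lintegral_mul_const _ hLZ, hone, one_mul]

end Concentration

/-! ### The regret bound -/

section Regret

variable {K n : ℕ} {σq σ₀ σ : ℝ≥0}

theorem sum_one_div_sqrt_le (m : ℕ) : ∑ s : Fin m, 1 / √(s : ℝ) ≤ 2 * √m := by
  rw [Fin.sum_univ_eq_sum_range fun s => 1 / √(s : ℝ)]
  have key : ∀ m : ℕ, ∑ s ∈ Finset.range (m + 1), 1 / √(s : ℝ) ≤ 2 * √m := by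
    intro m
    induction m with
    | zero => simp
    | succ m ih =>
      rw [Finset.sum_range_succ]
      have h2 : 0 < √((m + 1 : ℕ) : ℝ) := Real.sqrt_pos.2 (by positivity)
      have h3 : √(m : ℝ) ≤ √((m + 1 : ℕ) : ℝ) := Real.sqrt_le_sqrt (by push_cast; linarith)
      have h4 : √((m + 1 : ℕ) : ℝ) ^ 2 = √(m : ℝ) ^ 2 + 1 := by
        rw [Real.sq_sqrt (by positivity), Real.sq_sqrt (by positivity)]; push_cast; ring
      have h5 : 1 / √((m + 1 : ℕ) : ℝ) ≤ 2 * (√((m + 1 : ℕ) : ℝ) - √(m : ℝ)) := by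
        rw [div_le_iff₀ h2]; nlinarith [Real.sqrt_nonneg (m : ℝ)]
      linarith
  cases m with
  | zero => simp
  | succ m =>
    refine (key m).trans ?_
    gcongr
    simp

/-- The bound on the regret, in a task, of the rounds of Thompson sampling with the correct prior.
-/
noncomputable def tsBound (σ₀ σ : ℝ≥0) (K n : ℕ) : ℝ :=
  √(2 * Real.log n) * (2 * σ * (√K * (√(n + (σ : ℝ) ^ 2 / (σ₀ : ℝ) ^ 2 * K)
    - √((σ : ℝ) ^ 2 / (σ₀ : ℝ) ^ 2 * K))) + K * σ₀) + K * σ₀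

theorem sqrt_add_sub_sqrt_nonneg (σ₀ σ : ℝ≥0) (K n : ℕ) :
    0 ≤ √(n + (σ : ℝ) ^ 2 / (σ₀ : ℝ) ^ 2 * K) - √((σ : ℝ) ^ 2 / (σ₀ : ℝ) ^ 2 * K) := by
  have : √((σ : ℝ) ^ 2 / (σ₀ : ℝ) ^ 2 * K) ≤ √(n + (σ : ℝ) ^ 2 / (σ₀ : ℝ) ^ 2 * K) :=
    Real.sqrt_le_sqrt (le_add_of_nonneg_left (by positivity))
  linarith

theorem tsBound_nonneg (σ₀ σ : ℝ≥0) (K n : ℕ) : 0 ≤ tsBound σ₀ σ K n := by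
  have := sqrt_add_sub_sqrt_nonneg σ₀ σ K n
  unfold tsBound; positivity

/-- The arithmetic of the final bound: summing the bounds of the tasks gives the claimed terms. -/
theorem sum_task_bounds_le (hσ₀ : 0 < σ₀) (hK : 2 ≤ K) (hKn : K ≤ n) (m : ℕ) {δ : ℝ} (hδ : 0 < δ)
    (hδ1 : δ < 1) :
    m * (tsBound σ₀ σ K n + K * c₂ σq σ₀ K n δ) + n * c₂ σq σ₀ K n δ
        + (n : ℝ) ^ 2 * (√K / σ₀) * c₂ σq σ₀ K n δ *
          (√(8 * ((σ₀ : ℝ) ^ 2 + (σ : ℝ) ^ 2) * Real.log (2 * K / δ)) * (2 * √m))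
      ≤ c₁ σ n * √K *
          (√(n + (σ : ℝ) ^ 2 / (σ₀ : ℝ) ^ 2 * K) - √((σ : ℝ) ^ 2 / (σ₀ : ℝ) ^ 2 * K)) * m
        + c₂ σq σ₀ K n δ * c₃ σ₀ σ K δ * K * (n : ℝ) ^ 2 * √m
        + (4 * σ₀ + 2 * σq) * (1 + Real.log (K * n / δ)) ^ 1 * (K * m + n) := by
  have h0 : (0 : ℝ) < σ₀ := hσ₀
  have hq : (0 : ℝ) ≤ σq := σq.coe_nonneg
  have h1 : (0 : ℝ) ≤ σ := σ.coe_nonneg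
  have hK' : (2 : ℝ) ≤ K := by exact_mod_cast hK
  have hn' : (2 : ℝ) ≤ n := by exact_mod_cast hK.trans hKn
  have hm : (0 : ℝ) ≤ m := by positivity
  set Δ : ℝ := √(n + (σ : ℝ) ^ 2 / (σ₀ : ℝ) ^ 2 * K) - √((σ : ℝ) ^ 2 / (σ₀ : ℝ) ^ 2 * K) with hΔ
  have hΔ0 : 0 ≤ Δ := sqrt_add_sub_sqrt_nonneg σ₀ σ K n
  set ℓ := Real.log (K * n / δ) with hℓ
  set g := c₂ σq σ₀ K n δ with hg
  have hlogn : Real.log n ≤ ℓ := by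
    refine Real.log_le_log (by linarith) ?_
    rw [le_div_iff₀ hδ]; nlinarith
  have hlogK : Real.log (2 * K / δ) ≤ ℓ := by
    refine Real.log_le_log (by positivity) ?_
    gcongr ?_ / _
    nlinarith
  have hlogn0 : 0 ≤ Real.log n := Real.log_nonneg (by linarith)
  have hlogK0 : 0 ≤ Real.log (2 * K / δ) := by
    refine Real.log_nonneg ?_
    rw [le_div_iff₀ hδ]; nlinarith
  have hℓ0 : 0 ≤ ℓ := hlogn0.trans hlogn
  have hsqrt : ∀ y, 0 ≤ y → y ≤ ℓ → √(2 * y) ≤ 1 + ℓ := by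
    intro y hy hyl
    rw [Real.sqrt_le_left (by linarith)]
    nlinarith
  have hscale : ∀ (τ : ℝ≥0) (y : ℝ), √(2 * (τ : ℝ) ^ 2 * y) = τ * √(2 * y) := by
    intro τ y
    rw [show 2 * (τ : ℝ) ^ 2 * y = (τ : ℝ) ^ 2 * (2 * y) by ring,
      Real.sqrt_mul (by positivity), Real.sqrt_sq τ.coe_nonneg]
  have hg0 : 0 ≤ g := by rw [hg, c₂]; positivity
  have hgle : g ≤ 2 * (σq + σ₀) * (1 + ℓ) := by
    rw [hg, c₂, hscale, hscale]
    have e1 := mul_le_mul_of_nonneg_left (hsqrt _ hlogK0 hlogK) hq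
    have e2 := mul_le_mul_of_nonneg_left (hsqrt _ hlogn0 hlogn) h0.le
    linarith
  -- the Thompson sampling term
  have hc1 : c₁ σ n = 4 * (σ * √(2 * Real.log n)) := by rw [c₁, hscale]
  have t1 : m * tsBound σ₀ σ K n ≤ c₁ σ n * √K * Δ * m + K * m * (2 * σ₀ * (1 + ℓ)) := by
    have e1 : 0 ≤ σ * √(2 * Real.log n) * √K * Δ * m := by positivity
    have e2 : K * m * (σ₀ * √(2 * Real.log n)) ≤ K * m * (σ₀ * (1 + ℓ)) := by
      gcongr; exact hsqrt _ hlogn0 hlogn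
    have e3 : 0 ≤ K * m * (σ₀ * ℓ) := by positivity
    calc m * tsBound σ₀ σ K n = 2 * (σ * √(2 * Real.log n) * √K * Δ * m)
          + K * m * (σ₀ * √(2 * Real.log n)) + K * m * σ₀ := by rw [tsBound, ← hΔ]; ring
      _ ≤ 4 * (σ * √(2 * Real.log n) * √K * Δ * m) + K * m * (σ₀ * (1 + ℓ))
          + K * m * (σ₀ * (1 + ℓ)) := by nlinarith
      _ = _ := by rw [hc1]; ring
  -- the price of learning the prior
  have t2 : √K / σ₀ * (√(8 * ((σ₀ : ℝ) ^ 2 + (σ : ℝ) ^ 2) * Real.log (2 * K / δ)) * 2)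
      ≤ c₃ σ₀ σ K δ * K := by
    have hlog4 : Real.log (2 * K / δ) ≤ Real.log (4 * K / δ) := by
      refine Real.log_le_log (by positivity) ?_
      gcongr; norm_num
    have hpi := Real.pi_lt_four
    have hpi0 := Real.pi_pos
    have hlog40 := hlogK0.trans hlog4
    -- squared, this is `log (2K/δ) ≤ (2K/π) log (4K/δ)`, which holds because `π < 4 ≤ 2K`
    rw [c₃]
    refine (sq_le_sq₀ (by positivity) (by positivity)).1 ?_
    rw [mul_pow, div_pow, mul_pow, Real.sq_sqrt (by positivity), Real.sq_sqrt (by positivity),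
      mul_pow, mul_pow, Real.sq_sqrt (by positivity)]
    rw [show (K : ℝ) / (σ₀ : ℝ) ^ 2 *
          (8 * ((σ₀ : ℝ) ^ 2 + (σ : ℝ) ^ 2) * Real.log (2 * K / δ) * 2 ^ 2)
        = (32 * K * ((σ₀ : ℝ) ^ 2 + (σ : ℝ) ^ 2) / (σ₀ : ℝ) ^ 2) * Real.log (2 * K / δ) by ring,
      show 8 ^ 2 * (((σ₀ : ℝ) ^ 2 + (σ : ℝ) ^ 2) * Real.log (4 * K / δ) / (Real.pi * (σ₀ : ℝ) ^ 2))
          * (K : ℝ) ^ 2 = (32 * K * ((σ₀ : ℝ) ^ 2 + (σ : ℝ) ^ 2) / (σ₀ : ℝ) ^ 2) *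
          (2 * K / Real.pi * Real.log (4 * K / δ)) by field_simp; ring]
    refine mul_le_mul_of_nonneg_left ?_ (by positivity)
    have e1 : 1 ≤ 2 * K / Real.pi := by rw [le_div_iff₀ hpi0]; linarith
    nlinarith
  have t3 : (n : ℝ) ^ 2 * (√K / σ₀) * g *
      (√(8 * ((σ₀ : ℝ) ^ 2 + (σ : ℝ) ^ 2) * Real.log (2 * K / δ)) * (2 * √m))
      ≤ g * c₃ σ₀ σ K δ * K * (n : ℝ) ^ 2 * √m := by
    calc _ = g * (n : ℝ) ^ 2 * √m * (√K / σ₀ *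
          (√(8 * ((σ₀ : ℝ) ^ 2 + (σ : ℝ) ^ 2) * Real.log (2 * K / δ)) * 2)) := by ring
      _ ≤ g * (n : ℝ) ^ 2 * √m * (c₃ σ₀ σ K δ * K) := by gcongr
      _ = _ := by ring
  have t4 : (m * K + n) * g ≤ (K * m + n) * (2 * (σq + σ₀) * (1 + ℓ)) := by
    rw [mul_comm (m : ℝ)]; gcongr
  have t5 : 0 ≤ n * (2 * σ₀ * (1 + ℓ)) := by positivity
  rw [pow_one]
  calc _ = m * tsBound σ₀ σ K n + (m * K + n) * g + (n : ℝ) ^ 2 * (√K / σ₀) * g *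
      (√(8 * ((σ₀ : ℝ) ^ 2 + (σ : ℝ) ^ 2) * Real.log (2 * K / δ)) * (2 * √m)) := by ring
    _ ≤ (c₁ σ n * √K * Δ * m + K * m * (2 * σ₀ * (1 + ℓ)))
        + (K * m + n) * (2 * (σq + σ₀) * (1 + ℓ)) + g * c₃ σ₀ σ K δ * K * (n : ℝ) ^ 2 * √m
        + n * (2 * σ₀ * (1 + ℓ)) := by linarith
    _ = _ := by ring

/-- Summation of task regrets that are small from the second task on. In the first task there is no
bound on the sampling error, and the trivial bound of the regret by `n` times the width is used. -/
theorem sum_le_of_task_le (hσ₀ : 0 < σ₀) (hK : 2 ≤ K) (hKn : K ≤ n) {m : ℕ} {δ : ℝ} (hδ : 0 < δ)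
    (hδ1 : δ < 1) {u : Fin m → ℝ≥0∞}
    (hzero : ∀ s : Fin m, (s : ℕ) = 0 → u s ≤ n * ENNReal.ofReal (c₂ σq σ₀ K n δ))
    (hpos : ∀ s : Fin m, 0 < (s : ℕ) → u s ≤ ENNReal.ofReal (tsBound σ₀ σ K n)
      + K * ENNReal.ofReal (c₂ σq σ₀ K n δ)
      + n ^ 2 * ENNReal.ofReal (√K / σ₀ * errorBound σ₀ σ s (2 * K / δ)) *
        ENNReal.ofReal (c₂ σq σ₀ K n δ)) :
    ∑ s, u s ≤ ENNReal.ofReal (c₁ σ n * √K *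
          (√(n + (σ : ℝ) ^ 2 / (σ₀ : ℝ) ^ 2 * K) - √((σ : ℝ) ^ 2 / (σ₀ : ℝ) ^ 2 * K)) * m
        + c₂ σq σ₀ K n δ * c₃ σ₀ σ K δ * K * (n : ℝ) ^ 2 * √m
        + (4 * σ₀ + 2 * σq) * (1 + Real.log (K * n / δ)) ^ 1 * (K * m + n)) := by
  set g := c₂ σq σ₀ K n δ with hg
  have hg0 : 0 ≤ g := by rw [hg, c₂]; positivity
  have hts := tsBound_nonneg σ₀ σ K n
  set E : ℝ := √(8 * ((σ₀ : ℝ) ^ 2 + (σ : ℝ) ^ 2) * Real.log (2 * K / δ)) with hE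
  have herr : ∀ s : ℕ, errorBound σ₀ σ s (2 * K / δ) = E * (1 / √(s : ℝ)) := by
    intro s
    rw [errorBound, hE, mul_one_div, ← Real.sqrt_div' _ (by positivity)]
    congr 1
    ring
  set b : Fin m → ℝ := fun s => tsBound σ₀ σ K n + K * g + (if (s : ℕ) = 0 then n * g else 0)
    + (n : ℝ) ^ 2 * (√K / σ₀) * g * (E * (1 / √((s : ℕ) : ℝ))) with hb
  have hnn : ∀ s : Fin m, 0 ≤ (n : ℝ) ^ 2 * (√K / σ₀) * g * (E * (1 / √((s : ℕ) : ℝ))) :=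
    fun s => by positivity
  have hif : ∀ s : Fin m, 0 ≤ (if (s : ℕ) = 0 then n * g else 0) := fun s => by
    split_ifs <;> positivity
  have hb0 : ∀ s, 0 ≤ b s := fun s => by
    have e1 := hnn s
    have e2 := hif s
    simp only [hb]; positivity
  have hub : ∀ s, u s ≤ ENNReal.ofReal (b s) := by
    intro s
    rcases Nat.eq_zero_or_pos (s : ℕ) with h | h
    -- for `s = 0` the last summand of `b s` vanishes, since `1 / √0 = 0`
    · refine (hzero s h).trans ?_
      rw [← ENNReal.ofReal_natCast, ← ENNReal.ofReal_mul (by positivity)]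
      refine ENNReal.ofReal_le_ofReal ?_
      have e1 := hnn s
      have e2 : 0 ≤ K * g := by positivity
      simp only [hb, if_pos h]
      linarith
    · refine (hpos s h).trans ?_
      have hee : 0 ≤ √K / σ₀ * errorBound σ₀ σ s (2 * K / δ) := by
        unfold errorBound; positivity
      rw [← ENNReal.ofReal_natCast, ← ENNReal.ofReal_natCast,
        ← ENNReal.ofReal_pow (by positivity), ← ENNReal.ofReal_mul (by positivity),
        ← ENNReal.ofReal_mul (by positivity), ← ENNReal.ofReal_mul (by positivity),
        ← ENNReal.ofReal_add hts (by positivity), ← ENNReal.ofReal_add (by positivity)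
        (by positivity)]
      refine ENNReal.ofReal_le_ofReal (le_of_eq ?_)
      simp only [hb, if_neg h.ne', herr]
      ring
  calc ∑ s, u s ≤ ∑ s, ENNReal.ofReal (b s) := Finset.sum_le_sum fun s _ => hub s
    _ = ENNReal.ofReal (∑ s, b s) := (ENNReal.ofReal_sum_of_nonneg fun s _ => hb0 s).symm
    _ ≤ _ := ENNReal.ofReal_le_ofReal ?_
  refine le_trans ?_ (sum_task_bounds_le (σq := σq) (σ := σ) hσ₀ hK hKn m hδ hδ1)
  rw [← hg, ← hE]
  simp only [hb, Finset.sum_add_distrib, Finset.sum_const, Finset.card_univ, Fintype.card_fin,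
    nsmul_eq_mul, ← Finset.mul_sum]
  have hsum1 : ∑ s : Fin m, (if (s : ℕ) = 0 then n * g else 0) ≤ n * g := by
    rw [Fin.sum_univ_eq_sum_range fun s => if s = 0 then n * g else 0, Finset.sum_ite_eq']
    split_ifs
    · exact le_rfl
    · positivity
  have hsum2 : (n : ℝ) ^ 2 * (√K / σ₀) * g * (E * ∑ s : Fin m, 1 / √((s : ℕ) : ℝ))
      ≤ (n : ℝ) ^ 2 * (√K / σ₀) * g * (E * (2 * √m)) := by
    gcongr
    exact sum_one_div_sqrt_le m
  linarith

variable [NeZero K]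

theorem taskBayesRegret_le (hσ₀ : 0 < σ₀) (hσ : 0 < σ) (hKn : K ≤ n) (hn : 2 ≤ n)
    (μ ν : Fin K → ℝ) {g : ℝ} (hg : ∫⁻ θ, width θ ∂(gauss μ σ₀) ≤ ENNReal.ofReal g) :
    taskBayesRegret σ₀ σ n μ ν ≤ ENNReal.ofReal (tsBound σ₀ σ K n) + K * ENNReal.ofReal g
      + n ^ 2 * (ENNReal.ofReal (√K / σ₀) * ENNReal.ofReal ‖μ - ν‖) * ENNReal.ofReal g := by
  refine (taskBayesRegret_le_add hσ₀ hσ n μ ν).trans ?_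
  rw [← ENNReal.ofReal_mul (by positivity), div_mul_eq_mul_div]
  exact add_le_add ((taskBayesRegret_self_le hσ₀ hσ hKn hn μ).trans
    (add_le_add le_rfl (mul_le_mul_right hg _))) (mul_le_mul_right hg _)

theorem lintegral_width_le_c₂ (hσ₀ : 0 < σ₀) (hKn : K ≤ n) (hn : 2 ≤ n) {δ : ℝ} {μ : Fin K → ℝ}
    (hμ : ‖μ‖ ≤ √(2 * (σq : ℝ) ^ 2 * Real.log (2 * K / δ))) :
    ∫⁻ θ, width θ ∂(gauss μ σ₀) ≤ ENNReal.ofReal (c₂ σq σ₀ K n δ) := by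
  refine (lintegral_width_le hσ₀ μ hKn hn).trans (ENNReal.ofReal_le_ofReal ?_)
  rw [c₂]
  linarith

theorem taskBayesRegret_eq_zero_of_one (hσ₀ : 0 < σ₀) (hσ : 0 < σ) (hK : K = 1)
    (μ ν : Fin K → ℝ) : taskBayesRegret σ₀ σ n μ ν = 0 := by
  subst hK
  have hw : ∀ θ : Fin 1 → ℝ, width θ = 0 := fun θ => by
    refine le_antisymm (iSup_le fun a => ?_) zero_le
    rw [Subsingleton.elim (argmax θ) a]
    simp
  refine le_antisymm ((taskBayesRegret_le_width hσ₀ hσ n μ ν).trans ?_) zero_le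
  simp [hw]

/-- The realizations for which the bound may fail: the mean of the instance prior is large, or in
some task after the first one the meta-posterior sample is far from it, either in the realization
or on average given the mean. -/
def badSet (σq σ₀ σ : ℝ≥0) (K n m : ℕ) [NeZero K] (δ : ℝ) :
    Set ((Fin K → ℝ) × (Fin m → TaskRecord K n)) :=
  {x | √(2 * (σq : ℝ) ^ 2 * Real.log (2 * K / δ)) < ‖x.1‖} ∪
    ⋃ s : Fin m, {x | 0 < (s : ℕ) ∧
        ENNReal.ofReal (2 * K / δ) ≤ sampleError σ₀ σ s x.1 (x.2 s).sample} ∪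
      {x | 0 < (s : ℕ) ∧ ENNReal.ofReal (2 * K / δ)
        ≤ ∫⁻ ν, sampleError σ₀ σ s x.1 ν ∂(sampleLaw σq σ₀ σ n x.1 s)}

/-- Gaussian tails for the mean, and Markov's inequality for the sampling error of each task, once
for the realized sample and once for its average given the mean. -/
theorem jointLaw_badSet_le (hσq : 0 < σq) (hσ₀ : 0 < σ₀) (hσ : 0 < σ) (hKn : K ≤ n) (m : ℕ) {δ : ℝ}
    (hδ : 0 < δ) (hδ1 : δ < 1) :
    jointLaw σq σ₀ σ K m n (badSet σq σ₀ σ K n m δ) ≤ ENNReal.ofReal ((2 * m + 1) * δ) := by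
  have hq : (0 : ℝ) < σq := hσq
  have hK : (1 : ℝ) ≤ K := by exact_mod_cast Nat.one_le_iff_ne_zero.2 (NeZero.ne K)
  set T : ℝ := 2 * K / δ with hT
  have hT0 : 0 < T := by positivity
  have hT1 : 1 ≤ T := by rw [hT, le_div_iff₀ hδ]; linarith
  set P := jointLaw σq σ₀ σ K m n with hP
  have hmean : P {x | √(2 * (σq : ℝ) ^ 2 * Real.log T) < ‖x.1‖} ≤ ENNReal.ofReal δ := by
    have hA : MeasurableSet {μ : Fin K → ℝ | √(2 * (σq : ℝ) ^ 2 * Real.log T) < ‖μ‖} :=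
      measurableSet_lt measurable_const measurable_norm
    have h1 := lintegral_jointLaw_fst (n := n) hσq hσ₀ hσ m
      ((measurable_one : Measurable (1 : (Fin K → ℝ) → ℝ≥0∞)).indicator hA)
    rw [lintegral_indicator_one hA] at h1
    have h2 : ∀ x : (Fin K → ℝ) × (Fin m → TaskRecord K n),
        {μ : Fin K → ℝ | √(2 * (σq : ℝ) ^ 2 * Real.log T) < ‖μ‖}.indicator 1 x.1
        = (Prod.fst ⁻¹' {μ : Fin K → ℝ | √(2 * (σq : ℝ) ^ 2 * Real.log T) < ‖μ‖}).indicator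
          (1 : (Fin K → ℝ) × (Fin m → TaskRecord K n) → ℝ≥0∞) x := fun x => rfl
    simp_rw [h2] at h1
    rw [lintegral_indicator_one (measurable_fst hA)] at h1
    refine (h1.trans_le (gauss_norm_tail_le hσq (Real.sqrt_nonneg _))).trans
      (ENNReal.ofReal_le_ofReal (le_of_eq ?_))
    have hlog : 0 ≤ Real.log T := Real.log_nonneg hT1
    rw [Real.sq_sqrt (by positivity), show 2 * (σq : ℝ) ^ 2 * Real.log T / (2 * (σq : ℝ) ^ 2)
      = Real.log T by field_simp, Real.exp_neg, Real.exp_log hT0, hT]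
    field_simp
  have hmarkov : ∀ (f : (Fin K → ℝ) × (Fin m → TaskRecord K n) → ℝ≥0∞), Measurable f →
      ∫⁻ x, f x ∂P ≤ 2 * K → P {x | ENNReal.ofReal T ≤ f x} ≤ ENNReal.ofReal δ := by
    intro f hf hle
    refine (meas_ge_le_lintegral_div hf.aemeasurable (by simpa using hT0)
      ENNReal.ofReal_ne_top).trans ?_
    rw [ENNReal.div_le_iff (by simpa using hT0) ENNReal.ofReal_ne_top, ← ENNReal.ofReal_mul hδ.le]
    refine hle.trans_eq ?_
    rw [hT, mul_div_cancel₀ _ hδ.ne', ENNReal.ofReal_mul (by norm_num)]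
    simp
  have hsample : ∀ s : Fin m, P {x | 0 < (s : ℕ) ∧
      ENNReal.ofReal T ≤ sampleError σ₀ σ s x.1 (x.2 s).sample} ≤ ENNReal.ofReal δ := by
    intro s
    rcases Nat.eq_zero_or_pos (s : ℕ) with h | h
    · simp [h]
    · have hψ : Measurable (Function.uncurry (sampleError (K := K) σ₀ σ s)) :=
        measurable_sampleError σ₀ σ s measurable_fst measurable_snd
      simp only [h, true_and]
      refine hmarkov _ (measurable_sampleError σ₀ σ s measurable_fst
        (measurable_taskRecord_sample.comp ((measurable_pi_apply s).comp measurable_snd))) ?_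
      rw [hP, lintegral_jointLaw_sample hσq hσ₀ hσ s hψ]
      exact lintegral_sampleError_le hσq hσ₀ hσ hKn h
  have hlaw : ∀ s : Fin m, P {x | 0 < (s : ℕ) ∧ ENNReal.ofReal T
      ≤ ∫⁻ ν, sampleError σ₀ σ s x.1 ν ∂(sampleLaw σq σ₀ σ n x.1 s)} ≤ ENNReal.ofReal δ := by
    intro s
    rcases Nat.eq_zero_or_pos (s : ℕ) with h | h
    · simp [h]
    · have hψ : Measurable (Function.uncurry (sampleError (K := K) σ₀ σ s)) :=
        measurable_sampleError σ₀ σ s measurable_fst measurable_snd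
      have hI : Measurable fun μ : Fin K → ℝ =>
          ∫⁻ ν, sampleError σ₀ σ s μ ν ∂(sampleLaw σq σ₀ σ n μ s) :=
        measurable_lintegral_family (measurable_sampleLaw hσq hσ₀ hσ s)
          (fun μ => isProbabilityMeasure_sampleLaw hσq hσ₀ hσ μ s) hψ
      simp only [h, true_and]
      refine hmarkov _ (hI.comp measurable_fst) ?_
      rw [hP, lintegral_jointLaw_fst hσq hσ₀ hσ m hI]
      exact lintegral_sampleError_le hσq hσ₀ hσ hKn h
  refine (measure_union_le _ _).trans ?_
  calc _ ≤ ENNReal.ofReal δ + ∑ _s : Fin m, (ENNReal.ofReal δ + ENNReal.ofReal δ) := by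
        refine add_le_add hmean ((measure_iUnion_fintype_le _ _).trans ?_)
        exact Finset.sum_le_sum fun s _ =>
          (measure_union_le _ _).trans (add_le_add (hsample s) (hlaw s))
    _ = ENNReal.ofReal ((2 * m + 1) * δ) := by
        rw [Finset.sum_const, Finset.card_univ, Fintype.card_fin, nsmul_eq_mul,
          ← ENNReal.ofReal_add hδ.le hδ.le, ← ENNReal.ofReal_natCast,
          ← ENNReal.ofReal_mul (by positivity), ← ENNReal.ofReal_add hδ.le (by positivity)]
        congr 1
        ring

theorem regret_le_of_notMem_badSet (hσq : 0 < σq) (hσ₀ : 0 < σ₀) (hσ : 0 < σ) (hK : 2 ≤ K)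
    (hKn : K ≤ n) {m : ℕ} {δ : ℝ} (hδ : 0 < δ) (hδ1 : δ < 1)
    {x : (Fin K → ℝ) × (Fin m → TaskRecord K n)} (hx : x ∉ badSet σq σ₀ σ K n m δ) {B : ℝ}
    (hB : B = c₁ σ n * √K *
          (√(n + (σ : ℝ) ^ 2 / (σ₀ : ℝ) ^ 2 * K) - √((σ : ℝ) ^ 2 / (σ₀ : ℝ) ^ 2 * K)) * m
        + c₂ σq σ₀ K n δ * c₃ σ₀ σ K δ * K * (n : ℝ) ^ 2 * √m
        + (4 * σ₀ + 2 * σq) * (1 + Real.log (K * n / δ)) ^ 1 * (K * m + n)) :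
    bayesRegret σq σ₀ σ m n x.1 ≤ ENNReal.ofReal B ∧
      ∑ s, taskBayesRegret σ₀ σ n x.1 (x.2 s).sample ≤ ENNReal.ofReal B := by
  have hn : 2 ≤ n := hK.trans hKn
  have hK' : (2 : ℝ) ≤ K := by exact_mod_cast hK
  have hT : (1 : ℝ) < 2 * K / δ := by rw [lt_div_iff₀ hδ]; linarith
  simp only [badSet, Set.mem_union, Set.mem_iUnion, Set.mem_ofPred_eq, not_or, not_exists, not_and,
    not_le, not_lt] at hx
  obtain ⟨hmean, hs⟩ := hx
  have hW := lintegral_width_le_c₂ (σq := σq) hσ₀ hKn hn hmean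
  have hzero : ∀ ν, taskBayesRegret σ₀ σ n x.1 ν ≤ n * ENNReal.ofReal (c₂ σq σ₀ K n δ) := fun ν =>
    (taskBayesRegret_le_width hσ₀ hσ n x.1 ν).trans (mul_le_mul_right hW _)
  have htask := fun ν => taskBayesRegret_le hσ₀ hσ hKn hn x.1 ν hW
  rw [hB]
  constructor
  · rw [bayesRegret_eq hσq hσ₀ hσ]
    refine sum_le_of_task_le hσ₀ hK hKn hδ hδ1 (fun s _ => ?_) fun s h => ?_
    · have := isProbabilityMeasure_sampleLaw (n := n) hσq hσ₀ hσ x.1 s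
      exact (lintegral_mono hzero).trans (by simp)
    · have := isProbabilityMeasure_sampleLaw (n := n) hσq hσ₀ hσ x.1 s
      have hnorm := lintegral_norm_le_errorBound hσ₀ h hT ((hs s).2 h).le
      refine (lintegral_mono htask).trans ?_
      have hm : Measurable fun ν : Fin K → ℝ => ENNReal.ofReal ‖x.1 - ν‖ := by fun_prop
      rw [lintegral_add_left measurable_const, lintegral_const, measure_univ, mul_one,
        lintegral_mul_const _ ((hm.const_mul _).const_mul _),
        lintegral_const_mul _ (hm.const_mul _), lintegral_const_mul _ hm,
        ENNReal.ofReal_mul (by positivity)]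
      gcongr
  · refine sum_le_of_task_le hσ₀ hK hKn hδ hδ1 (fun s _ => hzero _) fun s h => ?_
    refine (htask _).trans ?_
    rw [ENNReal.ofReal_mul (by positivity)]
    gcongr
    exact norm_le_errorBound hσ₀ h hT ((hs s).1 h).le

end Regret

theorem theorem1 (σq σ₀ σ : ℝ≥0) (hσq : 0 < σq) (hσ₀ : 0 < σ₀) (hσ : 0 < σ) :
    ∃ C : ℝ, 0 < C ∧ ∃ p : ℕ, ∀ (K m n : ℕ) [NeZero K], K ≤ n → ∀ δ : ℝ, 0 < δ →
      ∀ B : ℝ,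
        B = c₁ σ n * √K *
              (√(n + (σ : ℝ) ^ 2 / (σ₀ : ℝ) ^ 2 * K) - √((σ : ℝ) ^ 2 / (σ₀ : ℝ) ^ 2 * K)) * m
            + c₂ σq σ₀ K n δ * c₃ σ₀ σ K δ * K * (n : ℝ) ^ 2 * √m
            + C * (1 + Real.log (K * n / δ)) ^ p * (K * m + n) →
        1 - (2 * m + 1) * δ ≤ (jointLaw σq σ₀ σ K m n).real
          {x | bayesRegret σq σ₀ σ m n x.1 ≤ ENNReal.ofReal B ∧
            ∑ s, taskBayesRegret σ₀ σ n x.1 (x.2 s).sample ≤ ENNReal.ofReal B} := by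
  have hq : (0 : ℝ) < σq := hσq
  have h0 : (0 : ℝ) < σ₀ := hσ₀
  refine ⟨4 * σ₀ + 2 * σq, by positivity, 1, fun K m n _ hKn δ hδ B hB => ?_⟩
  have hprob := isProbabilityMeasure_jointLaw (K := K) (n := n) hσq hσ₀ hσ m
  set P := jointLaw σq σ₀ σ K m n
  set S := {x : (Fin K → ℝ) × (Fin m → TaskRecord K n) |
    bayesRegret σq σ₀ σ m n x.1 ≤ ENNReal.ofReal B ∧
      ∑ s, taskBayesRegret σ₀ σ n x.1 (x.2 s).sample ≤ ENNReal.ofReal B} with hS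
  -- only failure probabilities below `1` matter, and these force `δ < 1`
  rcases le_or_gt 1 ((2 * m + 1) * δ) with hδ1 | hδ1
  · have : 0 ≤ P.real S := measureReal_nonneg
    linarith
  have hm : (0 : ℝ) ≤ m := by positivity
  have hδ1' : δ < 1 := by nlinarith
  rcases (Nat.one_le_iff_ne_zero.2 (NeZero.ne K)).eq_or_lt with hK1 | hK2
  -- with a single arm there is no regret; otherwise `2 ≤ n`, so that `log n` is positive
  · have hSuniv : S = Set.univ := by
      ext x
      simp [hS, bayesRegret_eq hσq hσ₀ hσ,
        taskBayesRegret_eq_zero_of_one (K := K) (n := n) hσ₀ hσ hK1.symm]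
    rw [hSuniv, probReal_univ]
    have : 0 ≤ (2 * m + 1) * δ := by positivity
    linarith
  · have hsub : Sᶜ ⊆ badSet σq σ₀ σ K n m δ := fun x hxS => by
      by_contra hx
      exact hxS (regret_le_of_notMem_badSet hσq hσ₀ hσ hK2 hKn hδ hδ1' hx hB)
    have hbad : P.real Sᶜ ≤ (2 * m + 1) * δ :=
      ENNReal.toReal_le_of_le_ofReal (by positivity)
        ((measure_mono hsub).trans (jointLaw_badSet_le hσq hσ₀ hσ hKn m hδ hδ1'))
    have hunion : P.real (S ∪ Sᶜ) ≤ P.real S + P.real Sᶜ := measureReal_union_le S Sᶜ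
    rw [Set.union_compl_self, probReal_univ] at hunion
    linarith
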